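/- **Setting.** Everything is real analytic ($\mathbb K=\mathbb R$) or holomorphic ($\mathbb K=\mathbb C$). Let $M$ be a manifold of dimension $n\ge 2$ with an $(n+1)$-web $W$ of curves in general position: every point has an open neighbourhood on which $W$ is given by $n+1$ foliations by curves $\mathcal F_1,\dots,\mathcal F_{n+1}$ such that any $n$ of the $n+1$ tangent lines are linearly independent at each point. A form $\eta$ is $\mathcal F$-basic if $\iota_v\eta=0$ and $L_v\eta=0$ for every local vector field $v$ tangent to $\mathcal F$. An abelian relation on an open set is a family $(\eta_\lambda)_{1\le\lambda\le n+1}$ of $(n-1)$-forms there with $\sum_\lambda\eta_\lambda=0$ and each $\eta_\lambda$ $\mathcal F_\lambda$-basic. The rank at a point is the dimension of the space of germs of abelian relations there, and the rank of $W$ is the maximum of these dimensions. Let $E=\operatorname{Ker}\bigl(\mathrm{Tr}:\bigoplus_\lambda T(\mathcal F_\lambda)\to TM\bigr)$, $\mathrm{Tr}(V_\lambda)_\lambda=\sum_\lambda V_\lambda$; this is a line bundle, which has nowhere zero local sections near every point. Let $\sigma=(V_\lambda)_\lambda$ be a nowhere zero section of $E$ over an open set $U$ on which the foliations are ordered, and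 let $\hat\sigma$ be the dual section of $E^*$, $\hat\sigma(\sigma)=1$. Let $(\alpha_i)_{1\le i\le n}$ be the coframe dual to $(V_i)_{1\le i\le n}$, write $[V_i,V_j]=\sum_k C_{ij}^kV_k$, and put $$\varphi_i=\sum_{j<i}C_{ji}^j-\sum_{j>i}C_{ij}^j,\qquad \omega=\sum_{i=1}^n\varphi_i\,\alpha_i,\qquad \Omega=d\omega,$$ $$A_i=(-1)^{i+1}\bigwedge_{j\ne i}\alpha_j\ (1\le i\le n),\qquad A_{n+1}=-\sum_{i=1}^nA_i .$$ **Theorem.** (i) If $f$ is a nowhere zero function on $U$ with $d(\log f)=df/f=-\omega$, then $(fA_\lambda)_\lambda$ is an abelian relation on $U$, all of whose members are nowhere zero. If $U$ is connected, every abelian relation on $U$ that is not identically zero is of this form for exactly one such $f$. (ii) The form $\omega$ does not change when the foliations are reordered. The connections defined locally on $\bigotimes^{n-1}E^*$ by $\nabla(\hat\sigma^{\otimes(n-1)})=\omega\cdot\hat\sigma^{\otimes(n-1)}$ do not depend on the order or on the section $\sigma$: any two of them agree on the intersection of their domains. Hence there is exactly one connection $\nabla$ on $\bigotimes^{n-1}E^*$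 over $M$ which satisfies this formula for all $U$, orderings and $\sigma$. Its curvature is a global analytic $2$-form $\Omega$, equal to $d\omega$ on each $U$. On every open set where the foliations are ordered there is a fibrewise linear injective map from $\bigotimes^{n-1}E^*$ to families of $n+1$ alternating $(n-1)$-forms, sending $\hat\sigma^{\otimes(n-1)}$ to $(A_\lambda)_\lambda$ for every $\sigma$, and it identifies the sections with zero covariant derivative with the abelian relations. The rank at a point is $1$ if $\Omega$ vanishes near that point, and $0$ otherwise. If $M$ is connected, the rank of $W$ is $1$ if $\Omega=0$ and $0$ if $\Omega\neq0$. (iii) If $n=2$, $\Omega$ is the Blaschke curvature of the $3$-web: for every triple of nowhere zero $1$-forms $\eta_1,\eta_2,\eta_3$ on an open set $U$ that define the three foliations and satisfy $\eta_1+\eta_2+\eta_3=0$ (such triples exist near every point), there is exactly one $1$-form $\gamma$ on $U$ with $d\eta_\lambda=\gamma\wedge\eta_\lambda$ for $\lambda=1,2,3$, and $\Omega=d\gamma$ on $U$. -/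

import Mathlib

open Set Filter Topology
open scoped Manifold ContDiff DirectSum TensorProduct

noncomputable section

namespace WebGeometry

/-! ## Vector fields and differential forms on an analytic manifold

`𝕜` is `ℝ` or `ℂ` and `M` is a manifold modelled on the finite-dimensional space `E`.  Analytic means
real analytic if `𝕜 = ℝ` and holomorphic if `𝕜 = ℂ`.  Local objects are functions on `M` of which only
the values on the open set under consideration are used. -/

section Forms

variable (𝕜 : Type*) [RCLike 𝕜]
  (E : Type*) [NormedAddCommGroup E] [NormedSpace 𝕜 E]
  (M : Type*) [TopologicalSpace M] [ChartedSpace E M]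

/-- Vector fields on `M` (no regularity). -/
abbrev VField := (x : M) → TangentSpace 𝓘(𝕜, E) x

/-- Fields of covectors on `M` (no regularity). -/
abbrev CovectorField := (x : M) → (TangentSpace 𝓘(𝕜, E) x →L[𝕜] 𝕜)

/-- Differential forms of degree `p` on `M` (no regularity). -/
abbrev Form (p : ℕ) := (x : M) → (TangentSpace 𝓘(𝕜, E) x) [⋀^Fin p]→L[𝕜] 𝕜

variable {𝕜 E M}

/-- The vector field `v` is analytic on `U`. -/
def VField.AnalyticOn [IsManifold 𝓘(𝕜, E) ω M] (v : VField 𝕜 E M) (U : Set M) : Prop :=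
  ContMDiffOn 𝓘(𝕜, E) 𝓘(𝕜, E).tangent ω (fun x => (⟨x, v x⟩ : TangentBundle 𝓘(𝕜, E) M)) U

/-- The function `f` is analytic at `x`. -/
def FunAnalyticAt (𝕜 : Type*) [RCLike 𝕜] (E : Type*) [NormedAddCommGroup E] [NormedSpace 𝕜 E]
    {M : Type*} [TopologicalSpace M] [ChartedSpace E M] (f : M → 𝕜) (x : M) : Prop :=
  ContMDiffAt 𝓘(𝕜, E) 𝓘(𝕜, 𝕜) ω f x

/-- The expression of a form in the preferred chart at `x₀`, i.e. its pull-back by the inverse of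
that chart. -/
def Form.inChart {p : ℕ} (η : Form 𝕜 E M p) (x₀ : M) (y : E) : E [⋀^Fin p]→L[𝕜] 𝕜 :=
  (η ((extChartAt 𝓘(𝕜, E) x₀).symm y)).compContinuousLinearMap
    ((mfderiv 𝓘(𝕜, E) 𝓘(𝕜, E) (extChartAt 𝓘(𝕜, E) x₀).symm y) ∘L
      ((NormedSpace.fromTangentSpace (𝕜 := 𝕜) y).symm : E →L[𝕜] TangentSpace 𝓘(𝕜, E) y))

/-- The form `η` is analytic at `x` (hence near `x`). -/
def Form.AnalyticAt {p : ℕ} (η : Form 𝕜 E M p) (x : M) : Prop :=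
  _root_.AnalyticAt 𝕜 (η.inChart x) (extChartAt 𝓘(𝕜, E) x x)

/-- The form `η` is analytic on `U`. -/
def Form.AnalyticOn {p : ℕ} (η : Form 𝕜 E M p) (U : Set M) : Prop :=
  ∀ x ∈ U, η.AnalyticAt x

/-- The exterior derivative, computed at `x` in the preferred chart at `x`. -/
def Form.d {p : ℕ} (η : Form 𝕜 E M p) : Form 𝕜 E M (p + 1) := fun x =>
  (extDeriv (η.inChart x) (extChartAt 𝓘(𝕜, E) x x)).compContinuousLinearMap
    (mvfderiv 𝓘(𝕜, E) (extChartAt 𝓘(𝕜, E) x) x)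

/-- The interior product of a vector with an alternating form. -/
def interiorAt {T : Type*} [AddCommGroup T] [Module 𝕜 T] [TopologicalSpace T] {p : ℕ}
    (v : T) (η : T [⋀^Fin (p + 1)]→L[𝕜] 𝕜) : T [⋀^Fin p]→L[𝕜] 𝕜 :=
  { η.toAlternatingMap.curryLeft v with
    cont := η.cont.comp (continuous_const.matrixVecCons continuous_id) }

/-- The interior product `ι_v η`. -/
def interiorProduct (v : VField 𝕜 E M) {p : ℕ} (η : Form 𝕜 E M (p + 1)) : Form 𝕜 E M p :=
  fun x => interiorAt (v x) (η x)

/-- The Lie derivative `L_v η = ι_v (dη) + d(ι_v η)`. -/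
def lieDeriv (v : VField 𝕜 E M) {p : ℕ} (η : Form 𝕜 E M (p + 1)) : Form 𝕜 E M (p + 1) :=
  interiorProduct v η.d + (interiorProduct v η).d

/-- The exterior product `α₁ ∧ ⋯ ∧ αₚ` of covectors: `(w₁, …, wₚ) ↦ det (αⱼ(wᵢ))`. -/
def wedge {T : Type*} [AddCommGroup T] [Module 𝕜 T] [TopologicalSpace T] {p : ℕ}
    (α : Fin p → (T →L[𝕜] 𝕜)) : T [⋀^Fin p]→L[𝕜] 𝕜 :=
  { (Matrix.detRowAlternating (R := 𝕜) (n := Fin p)).compLinearMap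
      (LinearMap.pi fun j => (α j : T →ₗ[𝕜] 𝕜)) with
    cont := Continuous.matrix_det (A := fun w : Fin p → T => Matrix.of fun i j => α j (w i))
      (continuous_matrix fun i j => (α j).continuous.comp (continuous_apply i)) }

/-- A field of covectors regarded as a form of degree one. -/
def CovectorField.toForm (α : CovectorField 𝕜 E M) : Form 𝕜 E M 1 :=
  fun x => ContinuousAlternatingMap.ofSubsingleton 𝕜 (TangentSpace 𝓘(𝕜, E) x) 𝕜 (0 : Fin 1) (α x)

/-! ## Foliations by curves, basic forms, abelian relations -/

/-- A field of tangent subspaces. -/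
abbrev Distribution (𝕜 : Type*) [RCLike 𝕜] (E : Type*) [NormedAddCommGroup E] [NormedSpace 𝕜 E]
    (M : Type*) [TopologicalSpace M] [ChartedSpace E M] :=
  (x : M) → Submodule 𝕜 (TangentSpace 𝓘(𝕜, E) x)

/-- `F` is (the tangent bundle of) an analytic foliation by curves on `U`: an analytic field of
lines, locally spanned by a nowhere zero analytic vector field. -/
def IsCurveFoliationOn [IsManifold 𝓘(𝕜, E) ω M] (F : Distribution 𝕜 E M) (U : Set M) : Prop :=
  ∀ x ∈ U, ∃ U' ⊆ U, IsOpen U' ∧ x ∈ U' ∧ ∃ v : VField 𝕜 E M, v.AnalyticOn U' ∧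
    ∀ y ∈ U', v y ≠ 0 ∧ F y = Submodule.span 𝕜 {v y}

/-- The form `η` is basic on `U` for the foliation `F`: `ι_v η = 0` and `L_v η = 0` for every local
analytic vector field `v` tangent to `F`. -/
def IsBasic [IsManifold 𝓘(𝕜, E) ω M] (F : Distribution 𝕜 E M) (U : Set M) {p : ℕ} (η : Form 𝕜 E M (p + 1)) : Prop :=
  ∀ U' ⊆ U, IsOpen U' → ∀ v : VField 𝕜 E M, v.AnalyticOn U' → (∀ y ∈ U', v y ∈ F y) →
    ∀ y ∈ U', interiorProduct v η y = 0 ∧ lieDeriv v η y = 0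

/-- `(η_i)` is an abelian relation on `U` for the foliations `(F_i)`. -/
structure IsAbelianRelation [IsManifold 𝓘(𝕜, E) ω M] {ι : Type*} [Fintype ι] (F : ι → Distribution 𝕜 E M) (U : Set M) {p : ℕ}
    (η : ι → Form 𝕜 E M (p + 1)) : Prop where
  analytic : ∀ i, (η i).AnalyticOn U
  basic : ∀ i, IsBasic (F i) U (η i)
  sum_eq_zero : ∀ x ∈ U, ∑ i, η i x = 0

/-! The facts needed to see that abelian relations near a point form a vector space. -/

lemma Form.inChart_add {p : ℕ} (η θ : Form 𝕜 E M p) (x₀ : M) :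
    (η + θ).inChart x₀ = η.inChart x₀ + θ.inChart x₀ := rfl

lemma Form.inChart_smul {p : ℕ} (c : 𝕜) (η : Form 𝕜 E M p) (x₀ : M) :
    (c • η).inChart x₀ = c • η.inChart x₀ := rfl

lemma Form.AnalyticAt.add {p : ℕ} {η θ : Form 𝕜 E M p} {x : M}
    (hη : η.AnalyticAt x) (hθ : θ.AnalyticAt x) : (η + θ).AnalyticAt x := by
  unfold Form.AnalyticAt at *
  rw [Form.inChart_add]
  exact _root_.AnalyticAt.add hη hθ

lemma Form.AnalyticAt.smul {p : ℕ} (c : 𝕜) {η : Form 𝕜 E M p} {x : M}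
    (hη : η.AnalyticAt x) : (c • η).AnalyticAt x := by
  unfold Form.AnalyticAt at *
  rw [Form.inChart_smul]
  exact AnalyticAt.const_smul hη

lemma Form.zero_analyticAt {p : ℕ} (x : M) : (0 : Form 𝕜 E M p).AnalyticAt x := by
  unfold Form.AnalyticAt
  have : (0 : Form 𝕜 E M p).inChart x = fun _ => 0 := rfl
  rw [this]
  exact analyticAt_const

lemma Form.d_add {p : ℕ} {η θ : Form 𝕜 E M p} {x : M}
    (hη : η.AnalyticAt x) (hθ : θ.AnalyticAt x) : (η + θ).d x = η.d x + θ.d x := by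
  unfold Form.d
  rw [Form.inChart_add, extDeriv_add hη.differentiableAt hθ.differentiableAt]
  rfl

lemma Form.d_smul {p : ℕ} (c : 𝕜) (η : Form 𝕜 E M p) (x : M) :
    (c • η).d x = c • η.d x := by
  unfold Form.d
  rw [Form.inChart_smul, extDeriv_smul]
  rfl

lemma Form.d_eq_zero {p : ℕ} {η : Form 𝕜 E M p} {x : M} (h : ∀ᶠ y in 𝓝 x, η y = 0) :
    η.d x = 0 := by
  have hc : ContinuousAt (extChartAt 𝓘(𝕜, E) x).symm (extChartAt 𝓘(𝕜, E) x x) :=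
    continuousAt_extChartAt_symm x
  have h1 : η.inChart x =ᶠ[𝓝 (extChartAt 𝓘(𝕜, E) x x)] fun _ => 0 := by
    have : Tendsto (extChartAt 𝓘(𝕜, E) x).symm (𝓝 (extChartAt 𝓘(𝕜, E) x x)) (𝓝 x) := by
      simpa [ContinuousAt] using hc
    filter_upwards [this.eventually h] with y hy
    unfold Form.inChart
    rw [hy]
    rfl
  unfold Form.d
  rw [h1.extDeriv_eq]
  have : extDeriv (fun _ : E => (0 : E [⋀^Fin p]→L[𝕜] 𝕜)) (extChartAt 𝓘(𝕜, E) x x) = 0 := by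
    have := extDeriv_smul (x := extChartAt 𝓘(𝕜, E) x x) (0 : 𝕜)
      (fun _ : E => (0 : E [⋀^Fin p]→L[𝕜] 𝕜))
    rw [zero_smul, zero_smul] at this
    exact this
  rw [this]
  rfl

lemma lieDeriv_eq {v : VField 𝕜 E M} {p : ℕ} {η : Form 𝕜 E M (p + 1)} {U : Set M} (hU : IsOpen U)
    (h : ∀ y ∈ U, interiorProduct v η y = 0) {y : M} (hy : y ∈ U) :
    lieDeriv v η y = interiorAt (v y) (η.d y) := by
  have : (interiorProduct v η).d y = 0 := Form.d_eq_zero (by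
    filter_upwards [hU.mem_nhds hy] with z hz using h z hz)
  change interiorProduct v η.d y + (interiorProduct v η).d y = _
  rw [this, add_zero]
  rfl

lemma IsBasic.mono [IsManifold 𝓘(𝕜, E) ω M] {F : Distribution 𝕜 E M} {U U₁ : Set M} {p : ℕ} {η : Form 𝕜 E M (p + 1)}
    (h : IsBasic F U η) (hU : U₁ ⊆ U) : IsBasic F U₁ η :=
  fun U' hU' ho v hv hF => h U' (hU'.trans hU) ho v hv hF

lemma IsBasic.add [IsManifold 𝓘(𝕜, E) ω M] {F : Distribution 𝕜 E M} {U : Set M} {p : ℕ} {η θ : Form 𝕜 E M (p + 1)}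
    (hη : IsBasic F U η) (hθ : IsBasic F U θ) (aη : η.AnalyticOn U) (aθ : θ.AnalyticOn U) :
    IsBasic F U (η + θ) := by
  intro U' hU' ho v hv hF
  have h0 : ∀ y ∈ U', interiorProduct v (η + θ) y = 0 := fun y hy => by
    have : interiorProduct v (η + θ) y = interiorProduct v η y + interiorProduct v θ y := rfl
    rw [this, (hη U' hU' ho v hv hF y hy).1, (hθ U' hU' ho v hv hF y hy).1, add_zero]
  refine fun y hy => ⟨h0 y hy, ?_⟩
  have e1 := (hη U' hU' ho v hv hF y hy).2
  have e2 := (hθ U' hU' ho v hv hF y hy).2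
  rw [lieDeriv_eq ho (fun z hz => (hη U' hU' ho v hv hF z hz).1) hy] at e1
  rw [lieDeriv_eq ho (fun z hz => (hθ U' hU' ho v hv hF z hz).1) hy] at e2
  rw [lieDeriv_eq ho h0 hy, Form.d_add (aη y (hU' hy)) (aθ y (hU' hy))]
  have : interiorAt (v y) (η.d y + θ.d y)
      = interiorAt (v y) (η.d y) + interiorAt (v y) (θ.d y) := rfl
  rw [this, e1, e2, add_zero]

lemma IsBasic.smul [IsManifold 𝓘(𝕜, E) ω M] (c : 𝕜) {F : Distribution 𝕜 E M} {U : Set M} {p : ℕ} {η : Form 𝕜 E M (p + 1)}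
    (hη : IsBasic F U η) : IsBasic F U (c • η) := by
  intro U' hU' ho v hv hF
  have h0 : ∀ y ∈ U', interiorProduct v (c • η) y = 0 := fun y hy => by
    have : interiorProduct v (c • η) y = c • interiorProduct v η y := rfl
    rw [this, (hη U' hU' ho v hv hF y hy).1]
    exact smul_zero (A := (TangentSpace 𝓘(𝕜, E) y) [⋀^Fin p]→L[𝕜] 𝕜) c
  refine fun y hy => ⟨h0 y hy, ?_⟩
  have e1 := (hη U' hU' ho v hv hF y hy).2
  rw [lieDeriv_eq ho (fun z hz => (hη U' hU' ho v hv hF z hz).1) hy] at e1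
  rw [lieDeriv_eq ho h0 hy, Form.d_smul]
  have : interiorAt (v y) (c • η.d y) = c • interiorAt (v y) (η.d y) := rfl
  rw [this, e1]
  exact smul_zero (A := (TangentSpace 𝓘(𝕜, E) y) [⋀^Fin (p + 1)]→L[𝕜] 𝕜) c

lemma IsBasic.zero [IsManifold 𝓘(𝕜, E) ω M] (F : Distribution 𝕜 E M) (U : Set M) (p : ℕ) :
    IsBasic F U (0 : Form 𝕜 E M (p + 1)) := by
  intro U' _ ho v _ _
  have h0 : ∀ y ∈ U', interiorProduct v (0 : Form 𝕜 E M (p + 1)) y = 0 := fun y _ => rfl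
  refine fun y hy => ⟨h0 y hy, ?_⟩
  have hd : (0 : Form 𝕜 E M (p + 1)).d y = 0 := Form.d_eq_zero (Eventually.of_forall fun _ => rfl)
  rw [lieDeriv_eq ho h0 hy, hd]
  rfl

/-- The families of forms that are abelian relations on some neighbourhood of `x`. -/
def abelianRelationsNear [IsManifold 𝓘(𝕜, E) ω M] {ι : Type*} [Fintype ι] (F : ι → Distribution 𝕜 E M) (p : ℕ) (x : M) :
    Submodule 𝕜 (ι → Form 𝕜 E M (p + 1)) where
  carrier := {η | ∃ U, IsOpen U ∧ x ∈ U ∧ IsAbelianRelation F U η}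
  add_mem' := by
    rintro η θ ⟨U, hU, hx, h⟩ ⟨U', hU', hx', h'⟩
    have a1 : ∀ i, (η i).AnalyticOn (U ∩ U') := fun i y hy => h.analytic i y hy.1
    have a2 : ∀ i, (θ i).AnalyticOn (U ∩ U') := fun i y hy => h'.analytic i y hy.2
    refine ⟨U ∩ U', hU.inter hU', ⟨hx, hx'⟩, fun i y hy => (a1 i y hy).add (a2 i y hy),
      fun i => ((h.basic i).mono inter_subset_left).add ((h'.basic i).mono inter_subset_right)
        (a1 i) (a2 i), fun y hy => ?_⟩
    have : ∑ i, (η + θ) i y = ∑ i, η i y + ∑ i, θ i y := by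
      rw [← Finset.sum_add_distrib]; rfl
    rw [this, h.sum_eq_zero y hy.1, h'.sum_eq_zero y hy.2, add_zero]
  zero_mem' := ⟨univ, isOpen_univ, mem_univ x, fun _ y _ => Form.zero_analyticAt y,
    fun i => IsBasic.zero (F i) univ p, fun _ _ => Finset.sum_eq_zero fun _ _ => rfl⟩
  smul_mem' := by
    rintro c η ⟨U, hU, hx, h⟩
    refine ⟨U, hU, hx, fun i y hy => (h.analytic i y hy).smul c, fun i => (h.basic i).smul c,
      fun y hy => ?_⟩
    have : ∑ i, (c • η) i y = c • ∑ i, η i y := by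
      rw [Finset.smul_sum]; rfl
    rw [this, h.sum_eq_zero y hy]
    exact smul_zero (A := (TangentSpace 𝓘(𝕜, E) y) [⋀^Fin (p + 1)]→L[𝕜] 𝕜) c

/-- The families of forms that vanish near `x`. -/
def vanishingNear (𝕜 : Type*) [RCLike 𝕜] (E : Type*) [NormedAddCommGroup E] [NormedSpace 𝕜 E]
    {M : Type*} [TopologicalSpace M] [ChartedSpace E M] (ι : Type*) (p : ℕ) (x : M) :
    Submodule 𝕜 (ι → Form 𝕜 E M p) where
  carrier := {η | ∀ᶠ y in 𝓝 x, ∀ i, η i y = 0}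
  add_mem' := by
    intro η θ h h'
    filter_upwards [h, h'] with y hy hy' i
    have : (η + θ) i y = η i y + θ i y := rfl
    rw [this, hy i, hy' i, add_zero]
  zero_mem' := Eventually.of_forall fun _ _ => rfl
  smul_mem' := by
    intro c η h
    filter_upwards [h] with y hy i
    have : (c • η) i y = c • η i y := rfl
    rw [this, hy i]
    exact smul_zero (A := (TangentSpace 𝓘(𝕜, E) y) [⋀^Fin p]→L[𝕜] 𝕜) c

/-- The vector space of germs at `x` of abelian relations of degree `p + 1`, inside the space of
germs at `x` of families of forms. -/
def AbelianGerms [IsManifold 𝓘(𝕜, E) ω M] {ι : Type*} [Fintype ι] (F : ι → Distribution 𝕜 E M) (p : ℕ) (x : M) :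
    Submodule 𝕜 ((ι → Form 𝕜 E M (p + 1)) ⧸ vanishingNear 𝕜 E ι (p + 1) x) :=
  (abelianRelationsNear F p x).map (vanishingNear 𝕜 E ι (p + 1) x).mkQ

/-! ## The 1-form attached to a family of vector fields -/

/-- The coframe `α₁, …, αₙ` dual to `v₁, …, vₙ` (meaningful where the `vᵢ` form a basis): the
components of the inverse of the map `(c₁, …, cₙ) ↦ ∑ cᵢ vᵢ`. -/
def dualCoframe {n : ℕ} (v : Fin n → VField 𝕜 E M) (i : Fin n) : CovectorField 𝕜 E M := fun x =>
  (ContinuousLinearMap.proj i : (Fin n → 𝕜) →L[𝕜] 𝕜) ∘L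
    ContinuousLinearMap.inverse
      (∑ j, (ContinuousLinearMap.proj j : (Fin n → 𝕜) →L[𝕜] 𝕜).smulRight (v j x))

/-- `C_{ij}^l`, where `[vᵢ, vⱼ] = ∑_l C_{ij}^l v_l`. -/
def structureCoeff {n : ℕ} (v : Fin n → VField 𝕜 E M) (i j l : Fin n) (x : M) : 𝕜 :=
  dualCoframe v l x (VectorField.mlieBracket 𝓘(𝕜, E) (v i) (v j) x)

/-- `φᵢ = ∑_{j<i} C_{ji}^j - ∑_{i<j} C_{ij}^j`. -/
def phi {n : ℕ} (v : Fin n → VField 𝕜 E M) (i : Fin n) (x : M) : 𝕜 :=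
  ∑ j ∈ Finset.univ.filter (fun j => j < i), structureCoeff v j i j x
    - ∑ j ∈ Finset.univ.filter (fun j => i < j), structureCoeff v i j j x

/-- The 1-form `ω = ∑ᵢ φᵢ αᵢ` attached to `V₁, …, Vₙ, Vₙ₊₁`; it is computed from the first `n`
vector fields. -/
def omega {n : ℕ} (V : Fin (n + 1) → VField 𝕜 E M) : CovectorField 𝕜 E M := fun x =>
  ∑ i : Fin n, phi (fun j : Fin n => V j.castSucc) i x •
    dualCoframe (fun j : Fin n => V j.castSucc) i x

/-- `A₁, …, Aₙ, Aₙ₊₁`, where `Aᵢ = (-1)^{i+1} ⋀_{j ≠ i} αⱼ` for `1 ≤ i ≤ n` (the indices of the code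
start at `0`) and `Aₙ₊₁ = -∑ᵢ Aᵢ`. -/
def basicFamily {m : ℕ} (V : Fin (m + 2) → VField 𝕜 E M) (l : Fin (m + 2)) : Form 𝕜 E M m :=
  fun x =>
    let A : Fin (m + 1) → (TangentSpace 𝓘(𝕜, E) x) [⋀^Fin m]→L[𝕜] 𝕜 := fun i =>
      (-1 : 𝕜) ^ (i : ℕ) •
        wedge fun j : Fin m => dualCoframe (fun j : Fin (m + 1) => V j.castSucc) (i.succAbove j) x
    Fin.lastCases (motive := fun _ => (TangentSpace 𝓘(𝕜, E) x) [⋀^Fin m]→L[𝕜] 𝕜)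
      (-∑ i, A i) A l

/-- `f` is a nowhere zero analytic function on `U` with `d(log f) = df / f = -ω` there. -/
def IsLogSolution (θ : CovectorField 𝕜 E M) (U : Set M) (f : M → 𝕜) : Prop :=
  ∀ x ∈ U, FunAnalyticAt 𝕜 E f x ∧ f x ≠ 0 ∧ (f x)⁻¹ • mvfderiv 𝓘(𝕜, E) f x = -θ x

end Forms

/-! ## Webs of `n + 1` curves in dimension `n = k + 2`

The dimension is `n = k + 2 ≥ 2`, there are `n + 1 = k + 3` foliations, and abelian relations are
made of forms of degree `n - 1 = k + 1`. -/

section Webs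

/-- The model space `𝕜ⁿ`, `n = k + 2`. -/
abbrev Model (𝕜 : Type*) [RCLike 𝕜] (k : ℕ) := EuclideanSpace 𝕜 (Fin (k + 2))

variable {𝕜 : Type*} [RCLike 𝕜] {k : ℕ}
  {M : Type*} [TopologicalSpace M] [ChartedSpace (Model 𝕜 k) M]
  [IsManifold 𝓘(𝕜, Model 𝕜 k) ω M]

/-- On the open set `U`, the sets of lines `lines x` are given by the ordered family
`F₁, …, Fₙ₊₁` of foliations by curves, which are in general position: any `n` of the `n + 1` lines
are linearly independent. -/
structure IsOrdering (lines : (x : M) → Set (Submodule 𝕜 (TangentSpace 𝓘(𝕜, Model 𝕜 k) x)))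
    (U : Set M) (F : Fin (k + 3) → Distribution 𝕜 (Model 𝕜 k) M) : Prop where
  isOpen : IsOpen U
  foliation : ∀ l, IsCurveFoliationOn (F l) U
  lines_eq : ∀ x ∈ U, lines x = range fun l => F l x
  general_position : ∀ x ∈ U, ∀ v : Fin (k + 3) → TangentSpace 𝓘(𝕜, Model 𝕜 k) x,
    (∀ l, v l ∈ F l x ∧ v l ≠ 0) → ∀ l₀, LinearIndependent 𝕜 fun l : {l : Fin (k + 3) // l ≠ l₀} => v l.1

variable (𝕜 k M) in
/-- A web of `n + 1` curves in general position on the `n`-dimensional manifold `M`: `n + 1` lines in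
every tangent space, not ordered globally, which locally are the tangent lines of `n + 1` foliations
in general position. -/
structure CurveWeb where
  lines : (x : M) → Set (Submodule 𝕜 (TangentSpace 𝓘(𝕜, Model 𝕜 k) x))
  locally_foliated : ∀ x, ∃ U F, x ∈ U ∧ IsOrdering lines U F

namespace CurveWeb

variable (W : CurveWeb 𝕜 k M)

open scoped Classical in
/-- The map `Tr`, from the direct sum of the lines of the web at `x` to the tangent space. -/
def trace (x : M) :
    (⨁ l : W.lines x, (l : Submodule 𝕜 (TangentSpace 𝓘(𝕜, Model 𝕜 k) x))) →ₗ[𝕜]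
      TangentSpace 𝓘(𝕜, Model 𝕜 k) x :=
  DirectSum.coeLinearMap
    (fun l : W.lines x => (l : Submodule 𝕜 (TangentSpace 𝓘(𝕜, Model 𝕜 k) x)))

/-- The fibre at `x` of the bundle `E = Ker Tr`. -/
abbrev E (x : M) := LinearMap.ker (W.trace x)

/-- The fibre at `x` of the bundle `⊗^{n-1} E*`. -/
def L (x : M) := ⨂[𝕜]^(k + 1) (Module.Dual 𝕜 (W.E x))

instance (x : M) : AddCommGroup (W.L x) :=
  inferInstanceAs (AddCommGroup (⨂[𝕜]^(k + 1) (Module.Dual 𝕜 (W.E x))))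

instance (x : M) : Module 𝕜 (W.L x) :=
  inferInstanceAs (Module 𝕜 (⨂[𝕜]^(k + 1) (Module.Dual 𝕜 (W.E x))))

variable {W}

open scoped Classical in
/-- The component of `e ∈ Eₓ` along the line `l` of the web. -/
def component {x : M} (e : W.E x) (l : Submodule 𝕜 (TangentSpace 𝓘(𝕜, Model 𝕜 k) x)) :
    TangentSpace 𝓘(𝕜, Model 𝕜 k) x :=
  if h : l ∈ W.lines x then ((e.1 ⟨l, h⟩ : l) : TangentSpace 𝓘(𝕜, Model 𝕜 k) x) else 0

/-- The vector fields `V_l` such that `σ = (V_l)_l`, for a section `σ` of `E` and an ordering `F`. -/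
def fields (F : Fin (k + 3) → Distribution 𝕜 (Model 𝕜 k) M) (σ : (x : M) → W.E x)
    (l : Fin (k + 3)) : VField 𝕜 (Model 𝕜 k) M :=
  fun x => component (σ x) (F l x)

variable (W) in
/-- On the open set `U`, the foliations of the web are ordered as `F₁, …, Fₙ₊₁` and `σ = (V_l)_l` is
a nowhere zero analytic section of `E`. -/
structure IsFrame (U : Set M) (F : Fin (k + 3) → Distribution 𝕜 (Model 𝕜 k) M)
    (σ : (x : M) → W.E x) : Prop where
  ordering : IsOrdering W.lines U F
  analytic : ∀ l, (fields F σ l).AnalyticOn U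
  ne_zero : ∀ x ∈ U, σ x ≠ 0

open scoped Classical in
/-- A linear form on `Eₓ` with value `1` on `e`; it is unique since `Eₓ` is a line. -/
def dualForm {x : M} (e : W.E x) : Module.Dual 𝕜 (W.E x) :=
  if h : ∃ φ : Module.Dual 𝕜 (W.E x), φ e = 1 then h.choose else 0

/-- `σ̂^{⊗(n-1)}`, where `σ̂` is the section of `E*` dual to `σ`. -/
def dualPower (σ : (x : M) → W.E x) (x : M) : W.L x :=
  PiTensorProduct.tprod 𝕜 fun _ : Fin (k + 1) => dualForm (σ x)

/-- The section `s` of `⊗^{n-1} E*` is analytic at `x`: near `x` it is an analytic multiple of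
`σ̂^{⊗(n-1)}`, for a local frame `σ`. -/
def SectionAnalyticAt (s : (x : M) → W.L x) (x : M) : Prop :=
  ∃ U F σ, W.IsFrame U F σ ∧ x ∈ U ∧ ∃ f : M → 𝕜, FunAnalyticAt 𝕜 (Model 𝕜 k) f x ∧
    ∀ᶠ y in 𝓝 x, s y = f y • dualPower σ y

variable (W) in
/-- An analytic connection on the line bundle `⊗^{n-1} E*`: `nabla s x w` is `∇_w s` at `x`.  It is
applied to sections that are defined and analytic near `x`, and only depends on their germs. -/
structure Connection where
  nabla : ((x : M) → W.L x) → (x : M) → (TangentSpace 𝓘(𝕜, Model 𝕜 k) x →ₗ[𝕜] W.L x)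
  nabla_congr : ∀ (s t : (x : M) → W.L x) x, SectionAnalyticAt s x → (∀ᶠ y in 𝓝 x, s y = t y) → nabla s x = nabla t x
  nabla_add : ∀ (s t : (x : M) → W.L x) x, SectionAnalyticAt s x → SectionAnalyticAt t x →
    nabla (fun y => s y + t y) x = nabla s x + nabla t x
  leibniz : ∀ (f : M → 𝕜) (s : (x : M) → W.L x) x, FunAnalyticAt 𝕜 (Model 𝕜 k) f x →
    SectionAnalyticAt s x → ∀ w : TangentSpace 𝓘(𝕜, Model 𝕜 k) x,
      nabla (fun y => f y • s y) x w =
        mvfderiv 𝓘(𝕜, Model 𝕜 k) f x w • s x + f x • nabla s x w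
  analytic : ∀ (U : Set M) (s : (x : M) → W.L x) (X : VField 𝕜 (Model 𝕜 k) M), IsOpen U →
    (∀ x ∈ U, SectionAnalyticAt s x) → X.AnalyticOn U →
    ∀ x ∈ U, SectionAnalyticAt (fun y => nabla s y (X y)) x

/-- The 2-form `Ω` is the curvature of `D`:
`∇_X ∇_Y s - ∇_Y ∇_X s - ∇_{[X,Y]} s = Ω(X, Y) s` for all local `X`, `Y`, `s`. -/
def Connection.IsCurvature (D : W.Connection) (Ω : Form 𝕜 (Model 𝕜 k) M 2) : Prop :=
  ∀ (U : Set M) (s : (x : M) → W.L x) (X Y : VField 𝕜 (Model 𝕜 k) M), IsOpen U → (∀ x ∈ U, SectionAnalyticAt s x) →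
    X.AnalyticOn U → Y.AnalyticOn U → ∀ x ∈ U,
      D.nabla (fun y => D.nabla s y (Y y)) x (X x) - D.nabla (fun y => D.nabla s y (X y)) x (Y x)
        - D.nabla s x (VectorField.mlieBracket 𝓘(𝕜, Model 𝕜 k) X Y x) = Ω x ![X x, Y x] • s x

/-- `s` is an analytic section on `U` with zero covariant derivative. -/
def Connection.IsFlat (D : W.Connection) (U : Set M) (s : (x : M) → W.L x) : Prop :=
  ∀ x ∈ U, SectionAnalyticAt s x ∧ D.nabla s x = 0

variable (W) in
/-- The rank of the web: the maximum over all points of the dimension of the space of germs of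
abelian relations of degree `n - 1`. -/
def rank : ℕ∞ :=
  ⨆ (x : M) (F : Fin (k + 3) → Distribution 𝕜 (Model 𝕜 k) M)
    (_ : ∃ U, x ∈ U ∧ IsOrdering W.lines U F),
      Cardinal.toENat (Module.rank 𝕜 (AbelianGerms F k x))

variable (W) in
/-- For a web of three curves on a surface (`k = 0`): `η₁, η₂, η₃` are analytic nowhere zero 1-forms
on `U` with sum zero which define the three foliations. -/
structure IsNormalizedCoframe (U : Set M) (F : Fin (k + 3) → Distribution 𝕜 (Model 𝕜 k) M)
    (η : Fin (k + 3) → CovectorField 𝕜 (Model 𝕜 k) M) : Prop where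
  ordering : IsOrdering W.lines U F
  analytic : ∀ l, (η l).toForm.AnalyticOn U
  ne_zero : ∀ l, ∀ x ∈ U, η l x ≠ 0
  annihilates : ∀ l, ∀ x ∈ U, ∀ w ∈ F l x, η l x w = 0
  sum_eq_zero : ∀ x ∈ U, ∑ l, η l x = 0

/-- `γ` is an analytic 1-form on `U` with `dη_l = γ ∧ η_l` for all `l`. -/
def IsBlaschkeForm (U : Set M) (η : Fin (k + 3) → CovectorField 𝕜 (Model 𝕜 k) M)
    (γ : CovectorField 𝕜 (Model 𝕜 k) M) : Prop :=
  γ.toForm.AnalyticOn U ∧ ∀ x ∈ U, ∀ l, (η l).toForm.d x = wedge ![γ x, η l x]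

variable (W) in
/-- `Θ` is the Blaschke curvature of a web of three curves on a surface (`k = 0`): every normalized
coframe `(η_l)` on an open set `U` (they exist near every point) has exactly one 1-form `γ` with
`dη_l = γ ∧ η_l` for all `l`, and `Θ = dγ` on `U`. -/
def IsBlaschkeCurvature (Θ : Form 𝕜 (Model 𝕜 k) M 2) : Prop :=
  (∀ x, ∃ U F η, x ∈ U ∧ W.IsNormalizedCoframe U F η) ∧
  ∀ U F η, W.IsNormalizedCoframe U F η →
    ∃ γ, IsBlaschkeForm U η γ ∧ (∀ x ∈ U, Θ x = γ.toForm.d x) ∧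
      ∀ γ', IsBlaschkeForm U η γ' → ∀ x ∈ U, γ' x = γ x

end CurveWeb

end Webs

end WebGeometry

end

/-!
# Abelian relations of webs of `n + 1` curves in dimension `n`

Let `σ = (V_l)` be a frame and let `μ = α₁ ∧ ⋯ ∧ αₙ` be the volume form of `V₁, …, Vₙ`.  The starting
point is the formula `A_l = ι_{V_l} μ`, valid for all `l`, the last one included since `∑ V_l = 0`
(`basicFamily_eq`).  It makes everything symmetric in the `n + 1` foliations.

* The forms of degree `n - 1` annihilated by a nonzero vector `v` are the multiples of `ι_v μ`.  Since
  `∑ V_l = 0` is the only linear relation between the `V_l`, a family with sum zero of such forms is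
  `(f A_l)`, with the same factor `f` for all `l` (`IsAdaptedAt.exists_eq_smul`).

* A form of degree `n - 1` annihilated by a foliation by curves is basic if and only if it is closed.
  The divergence formula `d(ι_Z μ) (V₁, …, Vₙ) = ∑ᵢ αᵢ([Vᵢ, Z])` gives
  `d(f A_l) (V₁, …, Vₙ) = (df + f ω)(V_l)` (`IsAdaptedAt.d_smul_basicFamily`).  So `(f A_l)` is an
  abelian relation if and only if `df + f ω = 0` (`isAbelianRelation_smul_basicFamily_iff`).  A
  solution of this linear equation which vanishes at a point vanishes nearby.

* The identity for `d(f A_l)` determines `ω`.  If `V'_l = h V_{τ(l)}`, then `A_{τ(l)}` is a constant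
  multiple of `h^{n-1} A'_l`, so that `ω = ω' + d(h^{n-1}) / h^{n-1}` (`IsAdaptedAt.omega_perm`).  This
  is the change of the connection form of `⊗^{n-1} E*` under a change of frames, and the factor
  depending on the order is constant.  Hence the local connections agree and glue
  (`CurveWeb.webConnection`); the curvature is `dω`, and by the previous point a flat section
  `f σ̂^{⊗(n-1)}` is the same as the abelian relation `(f A_l)`.

* If the curvature vanishes near a point, `exp(-g)` is a solution of `df + f ω = 0` there, for a
  primitive `g` of `ω`, and all solutions are proportional to it; the rank is one.  If there is a
  nonzero germ of solution, the curvature vanishes nearby.  On a connected manifold an analytic form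
  which vanishes near a point is zero.

* For `n = 2`, a normalized coframe is locally the family `A₁, A₂, A₃` of a frame, because a factor can
  be absorbed in `σ`, and then `ω` is the only form `γ` with `dη_l = γ ∧ η_l` for all `l`
  (`CurveWeb.IsFrame.d_eq_wedge_iff`).
-/

set_option linter.unusedSectionVars false

noncomputable section

namespace WebGeometry

/-! ### Tangent vectors and forms read in a chart -/

section ChartDictionary

variable {𝕜 : Type*} [RCLike 𝕜]
  {E : Type*} [NormedAddCommGroup E] [NormedSpace 𝕜 E]
  {M : Type*} [TopologicalSpace M] [ChartedSpace E M]

/-- The differential at `y` of the preferred chart at `x₀`. -/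
def chartPull (𝕜 : Type*) [RCLike 𝕜] {E : Type*} [NormedAddCommGroup E] [NormedSpace 𝕜 E]
    {M : Type*} [TopologicalSpace M] [ChartedSpace E M] (x₀ y : M) :
    TangentSpace 𝓘(𝕜, E) y →L[𝕜] E :=
  mvfderiv 𝓘(𝕜, E) (extChartAt 𝓘(𝕜, E) x₀) y

/-- The inverse of the differential at `y` of the preferred chart at `x₀`. -/
def chartPush (𝕜 : Type*) [RCLike 𝕜] {E : Type*} [NormedAddCommGroup E] [NormedSpace 𝕜 E]
    {M : Type*} [TopologicalSpace M] [ChartedSpace E M] (x₀ y : M) :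
    E →L[𝕜] TangentSpace 𝓘(𝕜, E) y :=
  (chartPull 𝕜 x₀ y).inverse

/-- The expression of a vector field in the preferred chart at `x₀`. -/
def VField.inChart (V : VField 𝕜 E M) (x₀ : M) (z : E) : E :=
  chartPull 𝕜 x₀ ((extChartAt 𝓘(𝕜, E) x₀).symm z) (V ((extChartAt 𝓘(𝕜, E) x₀).symm z))

variable [IsManifold 𝓘(𝕜, E) ω M] {x₀ y : M}

lemma mfderiv_extChartAt_symm_comp (hy : y ∈ (extChartAt 𝓘(𝕜, E) x₀).source) :
    (mfderiv 𝓘(𝕜, E) 𝓘(𝕜, E) (extChartAt 𝓘(𝕜, E) x₀).symm (extChartAt 𝓘(𝕜, E) x₀ y)) ∘L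
      (mfderiv 𝓘(𝕜, E) 𝓘(𝕜, E) (extChartAt 𝓘(𝕜, E) x₀) y) = ContinuousLinearMap.id 𝕜 _ := by
  have := mfderivWithin_extChartAt_symm_comp_mfderiv_extChartAt' (I := 𝓘(𝕜, E)) hy
  rwa [show range (𝓘(𝕜, E)) = univ from by simp, mfderivWithin_univ] at this

lemma mfderiv_extChartAt_comp_symm (hy : y ∈ (extChartAt 𝓘(𝕜, E) x₀).source) :
    (mfderiv 𝓘(𝕜, E) 𝓘(𝕜, E) (extChartAt 𝓘(𝕜, E) x₀) y) ∘L
    (mfderiv 𝓘(𝕜, E) 𝓘(𝕜, E) (extChartAt 𝓘(𝕜, E) x₀).symm (extChartAt 𝓘(𝕜, E) x₀ y))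
       = ContinuousLinearMap.id 𝕜 _ := by
  have := mfderiv_extChartAt_comp_mfderivWithin_extChartAt_symm' (I := 𝓘(𝕜, E)) hy
  rwa [show range (𝓘(𝕜, E)) = univ from by simp, mfderivWithin_univ] at this

lemma chartPull_eq_inverse {z : E} (hz : z ∈ (extChartAt 𝓘(𝕜, E) x₀).target) (w) :
    (mfderiv 𝓘(𝕜, E) 𝓘(𝕜, E) (extChartAt 𝓘(𝕜, E) x₀).symm z).inverse w =
      chartPull 𝕜 x₀ ((extChartAt 𝓘(𝕜, E) x₀).symm z) w := by
  have hy := (extChartAt 𝓘(𝕜, E) x₀).map_target hz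
  have h1 := mfderiv_extChartAt_symm_comp (𝕜 := 𝕜) hy
  have h2 := mfderiv_extChartAt_comp_symm (𝕜 := 𝕜) hy
  rw [(extChartAt 𝓘(𝕜, E) x₀).right_inv hz] at h1 h2
  rw [ContinuousLinearMap.inverse_eq h1 h2]
  rfl

/-- `chartPull` is invertible, with inverse the differential of the inverse chart. -/
lemma chartPush_eq {z : E} (hz : z ∈ (extChartAt 𝓘(𝕜, E) x₀).target) (w : E) :
    chartPush 𝕜 x₀ ((extChartAt 𝓘(𝕜, E) x₀).symm z) w =
    ((mfderiv 𝓘(𝕜, E) 𝓘(𝕜, E) (extChartAt 𝓘(𝕜, E) x₀).symm z) ∘L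
      ((NormedSpace.fromTangentSpace (𝕜 := 𝕜) z).symm : E →L[𝕜] TangentSpace 𝓘(𝕜, E) z)) w := by
  have hy := (extChartAt 𝓘(𝕜, E) x₀).map_target hz
  have h1 := mfderiv_extChartAt_symm_comp (𝕜 := 𝕜) hy
  have h2 := mfderiv_extChartAt_comp_symm (𝕜 := 𝕜) hy
  rw [(extChartAt 𝓘(𝕜, E) x₀).right_inv hz] at h1 h2
  have h1' : ((mfderiv 𝓘(𝕜, E) 𝓘(𝕜, E) (extChartAt 𝓘(𝕜, E) x₀).symm z) ∘L
      ((NormedSpace.fromTangentSpace (𝕜 := 𝕜) z).symm : E →L[𝕜] TangentSpace 𝓘(𝕜, E) z)) ∘L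
      chartPull 𝕜 x₀ ((extChartAt 𝓘(𝕜, E) x₀).symm z) = ContinuousLinearMap.id 𝕜 _ := h1
  have h2' : chartPull 𝕜 x₀ ((extChartAt 𝓘(𝕜, E) x₀).symm z) ∘L ((mfderiv 𝓘(𝕜, E) 𝓘(𝕜, E)
      (extChartAt 𝓘(𝕜, E) x₀).symm z) ∘L ((NormedSpace.fromTangentSpace (𝕜 := 𝕜) z).symm :
      E →L[𝕜] TangentSpace 𝓘(𝕜, E) z)) = ContinuousLinearMap.id 𝕜 _ := h2
  rw [chartPush, ContinuousLinearMap.inverse_eq h2' h1']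

lemma chartPull_chartPush (hy : y ∈ (extChartAt 𝓘(𝕜, E) x₀).source) (w : E) :
    chartPull 𝕜 x₀ y (chartPush 𝕜 x₀ y w) = w := by
  have h2 := mfderiv_extChartAt_comp_symm (𝕜 := 𝕜) hy
  have h := chartPush_eq (𝕜 := 𝕜) ((extChartAt 𝓘(𝕜, E) x₀).map_source hy) w
  rw [(extChartAt 𝓘(𝕜, E) x₀).left_inv hy] at h
  rw [h]
  exact DFunLike.congr_fun h2 w

lemma chartPush_chartPull (hy : y ∈ (extChartAt 𝓘(𝕜, E) x₀).source) (w : TangentSpace 𝓘(𝕜, E) y) :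
    chartPush 𝕜 x₀ y (chartPull 𝕜 x₀ y w) = w := by
  have h2 := mfderiv_extChartAt_symm_comp (𝕜 := 𝕜) hy
  have h := chartPush_eq (𝕜 := 𝕜) ((extChartAt 𝓘(𝕜, E) x₀).map_source hy) (chartPull 𝕜 x₀ y w)
  rw [(extChartAt 𝓘(𝕜, E) x₀).left_inv hy] at h
  rw [h]
  exact DFunLike.congr_fun h2 w

/-- The tangent space is identified with the model space by the differential of a chart. -/
def chartEquiv (hy : y ∈ (extChartAt 𝓘(𝕜, E) x₀).source) : TangentSpace 𝓘(𝕜, E) y ≃L[𝕜] E :=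
  ContinuousLinearEquiv.equivOfInverse (chartPull 𝕜 x₀ y) (chartPush 𝕜 x₀ y)
    (chartPush_chartPull hy) (chartPull_chartPush hy)

omit [IsManifold 𝓘(𝕜, E) ω M] in
lemma VField.inChart_apply (V : VField 𝕜 E M) (hy : y ∈ (extChartAt 𝓘(𝕜, E) x₀).source) :
    V.inChart x₀ (extChartAt 𝓘(𝕜, E) x₀ y) = chartPull 𝕜 x₀ y (V y) := by
  rw [VField.inChart, (extChartAt 𝓘(𝕜, E) x₀).left_inv hy]

lemma Form.inChart_apply {p : ℕ} (η : Form 𝕜 E M p)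
    (hy : y ∈ (extChartAt 𝓘(𝕜, E) x₀).source) (w : Fin p → E) :
    η.inChart x₀ (extChartAt 𝓘(𝕜, E) x₀ y) w = η y (fun i => chartPush 𝕜 x₀ y (w i)) := by
  have hz := (extChartAt 𝓘(𝕜, E) x₀).map_source hy
  have : ∀ z ∈ (extChartAt 𝓘(𝕜, E) x₀).target, η.inChart x₀ z w =
      η ((extChartAt 𝓘(𝕜, E) x₀).symm z)
        (fun i => chartPush 𝕜 x₀ ((extChartAt 𝓘(𝕜, E) x₀).symm z) (w i)) := by
    intro z hz
    rw [Form.inChart, ContinuousAlternatingMap.compContinuousLinearMap_apply]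
    congr 1
    funext i
    exact (chartPush_eq hz (w i)).symm
  rw [this _ hz, (extChartAt 𝓘(𝕜, E) x₀).left_inv hy]

lemma Form.inChart_apply_inChart {p : ℕ} (η : Form 𝕜 E M p) (V : Fin p → VField 𝕜 E M)
    (hy : y ∈ (extChartAt 𝓘(𝕜, E) x₀).source) :
    η.inChart x₀ (extChartAt 𝓘(𝕜, E) x₀ y) (fun i => (V i).inChart x₀ (extChartAt 𝓘(𝕜, E) x₀ y)) =
      η y (fun i => V i y) := by
  rw [Form.inChart_apply η hy]
  congr 1
  funext i
  rw [VField.inChart_apply _ hy, chartPush_chartPull hy]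

lemma contMDiffAt_extChartAt_symm' (hy : y ∈ (extChartAt 𝓘(𝕜, E) x₀).source) :
    ContMDiffAt 𝓘(𝕜, E) 𝓘(𝕜, E) ω (extChartAt 𝓘(𝕜, E) x₀).symm (extChartAt 𝓘(𝕜, E) x₀ y) :=
  (contMDiffOn_extChartAt_symm x₀).contMDiffAt
    ((isOpen_extChartAt_target x₀).mem_nhds ((extChartAt 𝓘(𝕜, E) x₀).map_source hy))

lemma contMDiffAt_extChartAt_of_mem (hy : y ∈ (extChartAt 𝓘(𝕜, E) x₀).source) :
    ContMDiffAt 𝓘(𝕜, E) 𝓘(𝕜, E) ω (extChartAt 𝓘(𝕜, E) x₀) y :=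
  contMDiffAt_extChartAt' (by rwa [extChartAt_source] at hy)

variable (𝕜) in
lemma eventually_extChartAt_symm (hy : y ∈ (extChartAt 𝓘(𝕜, E) x₀).source) {P : M → Prop}
    (h : ∀ᶠ x in 𝓝 y, P x) :
    ∀ᶠ z in 𝓝 (extChartAt 𝓘(𝕜, E) x₀ y), P ((extChartAt 𝓘(𝕜, E) x₀).symm z) := by
  have := (contMDiffAt_extChartAt_symm' (𝕜 := 𝕜) hy).continuousAt
  rw [ContinuousAt, (extChartAt 𝓘(𝕜, E) x₀).left_inv hy] at this
  exact this.eventually h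

variable (𝕜) in
lemma eventually_of_extChartAt (hy : y ∈ (extChartAt 𝓘(𝕜, E) x₀).source) {P : E → Prop}
    (h : ∀ᶠ z in 𝓝 (extChartAt 𝓘(𝕜, E) x₀ y), P z) :
    ∀ᶠ x in 𝓝 y, P (extChartAt 𝓘(𝕜, E) x₀ x) :=
  (contMDiffAt_extChartAt_of_mem (𝕜 := 𝕜) hy).continuousAt.eventually h

variable (𝕜) in
omit [IsManifold 𝓘(𝕜, E) ω M] in
lemma eventually_mem_extChartAt_source (hy : y ∈ (extChartAt 𝓘(𝕜, E) x₀).source) :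
    ∀ᶠ x in 𝓝 y, x ∈ (extChartAt 𝓘(𝕜, E) x₀).source :=
  (isOpen_extChartAt_source x₀).mem_nhds hy

variable (𝕜) in
/-- A property holds near `y` as soon as it holds near the image of `y` in the chart. -/
lemma eventually_nhds_extChartAt (hy : y ∈ (extChartAt 𝓘(𝕜, E) x₀).source) {P : E → Prop}
    (h : ∀ᶠ x in 𝓝 y, P (extChartAt 𝓘(𝕜, E) x₀ x)) :
    ∀ᶠ z in 𝓝 (extChartAt 𝓘(𝕜, E) x₀ y), P z := by
  filter_upwards [eventually_extChartAt_symm 𝕜 hy h, (isOpen_extChartAt_target x₀).mem_nhds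
    ((extChartAt 𝓘(𝕜, E) x₀).map_source hy)] with z hz hz'
  rwa [(extChartAt 𝓘(𝕜, E) x₀).right_inv hz'] at hz

section Functions

variable {F : Type*} [NormedAddCommGroup F] [NormedSpace 𝕜 F]

lemma analyticAt_iff_contDiffAt [CompleteSpace F] {f : E → F} {z : E} :
    AnalyticAt 𝕜 f z ↔ ContDiffAt 𝕜 ω f z := by
  rw [← contDiffWithinAt_univ, contDiffWithinAt_omega_iff_analyticWithinAt, analyticWithinAt_univ]

lemma contMDiffAt_iff_analyticAt_comp_symm [CompleteSpace F] {f : M → F}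
    (hy : y ∈ (extChartAt 𝓘(𝕜, E) x₀).source) :
    ContMDiffAt 𝓘(𝕜, E) 𝓘(𝕜, F) ω f y ↔
      AnalyticAt 𝕜 (f ∘ (extChartAt 𝓘(𝕜, E) x₀).symm) (extChartAt 𝓘(𝕜, E) x₀ y) := by
  rw [analyticAt_iff_contDiffAt, ← contMDiffAt_iff_contDiffAt]
  constructor
  · intro h
    refine ContMDiffAt.comp (I' := 𝓘(𝕜, E)) _ ?_ (contMDiffAt_extChartAt_symm' hy)
    rwa [(extChartAt 𝓘(𝕜, E) x₀).left_inv hy]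
  · intro h
    refine (ContMDiffAt.comp (I' := 𝓘(𝕜, E)) _ h
      (contMDiffAt_extChartAt_of_mem hy)).congr_of_eventuallyEq ?_
    filter_upwards [eventually_mem_extChartAt_source 𝕜 hy] with x hx
    rw [Function.comp_apply, Function.comp_apply, (extChartAt 𝓘(𝕜, E) x₀).left_inv hx]

lemma mvfderiv_eq_fderiv {f : M → F} (hy : y ∈ (extChartAt 𝓘(𝕜, E) x₀).source)
    (hf : MDifferentiableAt 𝓘(𝕜, E) 𝓘(𝕜, F) f y) (w : TangentSpace 𝓘(𝕜, E) y) :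
    mvfderiv 𝓘(𝕜, E) f y w =
      fderiv 𝕜 (f ∘ (extChartAt 𝓘(𝕜, E) x₀).symm) (extChartAt 𝓘(𝕜, E) x₀ y)
        (chartPull 𝕜 x₀ y w) := by
  have hf' : MDifferentiableAt 𝓘(𝕜, E) 𝓘(𝕜, F) f
      ((extChartAt 𝓘(𝕜, E) x₀).symm (extChartAt 𝓘(𝕜, E) x₀ y)) := by
    rwa [(extChartAt 𝓘(𝕜, E) x₀).left_inv hy]
  have hs : MDifferentiableAt 𝓘(𝕜, E) 𝓘(𝕜, E) (extChartAt 𝓘(𝕜, E) x₀).symm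
      (extChartAt 𝓘(𝕜, E) x₀ y) := (contMDiffAt_extChartAt_symm' hy).mdifferentiableAt (by simp)
  have key := mfderiv_comp (extChartAt 𝓘(𝕜, E) x₀ y) hf' hs
  rw [(extChartAt 𝓘(𝕜, E) x₀).left_inv hy] at key
  have h2 := mfderiv_extChartAt_symm_comp (𝕜 := 𝕜) hy
  rw [← mfderiv_eq_fderiv, key]
  change mfderiv 𝓘(𝕜, E) 𝓘(𝕜, F) f y w = mfderiv 𝓘(𝕜, E) 𝓘(𝕜, F) f y
    (((mfderiv 𝓘(𝕜, E) 𝓘(𝕜, E) (extChartAt 𝓘(𝕜, E) x₀).symm (extChartAt 𝓘(𝕜, E) x₀ y)) ∘L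
      (mfderiv 𝓘(𝕜, E) 𝓘(𝕜, E) (extChartAt 𝓘(𝕜, E) x₀) y)) w)
  rw [h2]
  rfl

end Functions

/-! ### Vector fields, brackets and exterior derivatives read in a chart -/

/-- The vector field `V` is analytic at `y`. -/
def VField.AnalyticAt (V : VField 𝕜 E M) (y : M) : Prop :=
  ContMDiffAt 𝓘(𝕜, E) 𝓘(𝕜, E).tangent ω (fun x => (⟨x, V x⟩ : TangentBundle 𝓘(𝕜, E) M)) y

lemma VField.AnalyticOn.analyticAt {V : VField 𝕜 E M} {U : Set M} (h : V.AnalyticOn U)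
    (hU : IsOpen U) (hy : y ∈ U) : V.AnalyticAt y :=
  ContMDiffOn.contMDiffAt h (hU.mem_nhds hy)

lemma VField.AnalyticAt.mdifferentiableAt {V : VField 𝕜 E M} (h : V.AnalyticAt y) :
    MDifferentiableAt 𝓘(𝕜, E) 𝓘(𝕜, E).tangent
      (fun x => (⟨x, V x⟩ : TangentBundle 𝓘(𝕜, E) M)) y :=
  ContMDiffAt.mdifferentiableAt h (by simp)

lemma VField.inChart_eq_mpullback (V : VField 𝕜 E M) {z : E}
    (hz : z ∈ (extChartAt 𝓘(𝕜, E) x₀).target) :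
    VectorField.mpullback 𝓘(𝕜, E) 𝓘(𝕜, E) (extChartAt 𝓘(𝕜, E) x₀).symm V z =
      V.inChart x₀ z := by
  rw [VectorField.mpullback_apply, chartPull_eq_inverse hz]
  rfl

lemma isInvertible_mfderiv_extChartAt_symm (hy : y ∈ (extChartAt 𝓘(𝕜, E) x₀).source) :
    (mfderiv 𝓘(𝕜, E) 𝓘(𝕜, E) (extChartAt 𝓘(𝕜, E) x₀).symm
      (extChartAt 𝓘(𝕜, E) x₀ y)).IsInvertible := by
  have := isInvertible_mfderivWithin_extChartAt_symm (𝕜 := 𝕜) (I := 𝓘(𝕜, E))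
    ((extChartAt 𝓘(𝕜, E) x₀).map_source hy)
  rwa [show range (𝓘(𝕜, E)) = univ from by simp, mfderivWithin_univ] at this

variable [CompleteSpace E]

lemma VField.AnalyticAt.inChart {V : VField 𝕜 E M} (h : V.AnalyticAt y)
    (hy : y ∈ (extChartAt 𝓘(𝕜, E) x₀).source) :
    _root_.AnalyticAt 𝕜 (V.inChart x₀) (extChartAt 𝓘(𝕜, E) x₀ y) := by
  have h' : V.AnalyticAt ((extChartAt 𝓘(𝕜, E) x₀).symm (extChartAt 𝓘(𝕜, E) x₀ y)) := by
    rwa [(extChartAt 𝓘(𝕜, E) x₀).left_inv hy]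
  have := ContMDiffAt.mpullback_vectorField_preimage (n := ω) (m := ω) h'
    (contMDiffAt_extChartAt_symm' hy) (isInvertible_mfderiv_extChartAt_symm hy) (by simp)
  rw [contMDiffAt_vectorSpace_iff_contDiffAt] at this
  refine (analyticAt_iff_contDiffAt.2 this).congr ?_
  filter_upwards [(isOpen_extChartAt_target x₀).mem_nhds
    ((extChartAt 𝓘(𝕜, E) x₀).map_source hy)] with z hz using V.inChart_eq_mpullback hz

lemma mlieBracket_inChart {V W : VField 𝕜 E M} (hV : V.AnalyticAt y) (hW : W.AnalyticAt y)
    (hy : y ∈ (extChartAt 𝓘(𝕜, E) x₀).source) :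
    VField.inChart (VectorField.mlieBracket 𝓘(𝕜, E) V W) x₀ (extChartAt 𝓘(𝕜, E) x₀ y) =
      VectorField.lieBracket 𝕜 (V.inChart x₀) (W.inChart x₀) (extChartAt 𝓘(𝕜, E) x₀ y) := by
  have hz := (extChartAt 𝓘(𝕜, E) x₀).map_source hy
  have hV' : V.AnalyticAt ((extChartAt 𝓘(𝕜, E) x₀).symm (extChartAt 𝓘(𝕜, E) x₀ y)) := by
    rwa [(extChartAt 𝓘(𝕜, E) x₀).left_inv hy]
  have hW' : W.AnalyticAt ((extChartAt 𝓘(𝕜, E) x₀).symm (extChartAt 𝓘(𝕜, E) x₀ y)) := by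
    rwa [(extChartAt 𝓘(𝕜, E) x₀).left_inv hy]
  have := VectorField.mpullback_mlieBracket (n := ω) hV'.mdifferentiableAt hW'.mdifferentiableAt
    (contMDiffAt_extChartAt_symm' hy) (by simp)
  rw [VField.inChart_eq_mpullback _ hz] at this
  rw [this, ← VectorField.mlieBracketWithin_univ, VectorField.mlieBracketWithin_eq_lieBracketWithin]
  have aux : ∀ A B A' B' : E → E, ∀ z : E, A =ᶠ[𝓝 z] A' → B =ᶠ[𝓝 z] B' →
      VectorField.lieBracketWithin 𝕜 A B univ z = VectorField.lieBracket 𝕜 A' B' z :=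
    fun A B A' B' z h h' => by
      rw [VectorField.lieBracketWithin_univ, h.lieBracket_vectorField_eq h']
  refine aux _ _ _ _ _ ?_ ?_ <;>
  filter_upwards [(isOpen_extChartAt_target x₀).mem_nhds hz] with z hz
    using VField.inChart_eq_mpullback _ hz

omit [CompleteSpace E] in
/-- The exterior derivative may be computed in any chart. -/
lemma Form.d_eq_extDeriv {p : ℕ} {η : Form 𝕜 E M p} (hy : y ∈ (extChartAt 𝓘(𝕜, E) x₀).source)
    (hη : DifferentiableAt 𝕜 (η.inChart x₀) (extChartAt 𝓘(𝕜, E) x₀ y))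
    (w : Fin (p + 1) → TangentSpace 𝓘(𝕜, E) y) :
    η.d y w = extDeriv (η.inChart x₀) (extChartAt 𝓘(𝕜, E) x₀ y)
      (fun i => chartPull 𝕜 x₀ y (w i)) := by
  have hyy : y ∈ (extChartAt 𝓘(𝕜, E) y).source := mem_extChartAt_source y
  set T : E → E := extChartAt 𝓘(𝕜, E) x₀ ∘ (extChartAt 𝓘(𝕜, E) y).symm with hT
  have hd : ∀ y' ∈ (extChartAt 𝓘(𝕜, E) x₀).source, y' ∈ (extChartAt 𝓘(𝕜, E) y).source →
      ∀ v, chartPull 𝕜 x₀ y' v =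
        fderiv 𝕜 T (extChartAt 𝓘(𝕜, E) y y') (chartPull 𝕜 y y' v) := fun y' h1 h2 v =>
    mvfderiv_eq_fderiv h2 ((contMDiffAt_extChartAt_of_mem h1).mdifferentiableAt (by simp)) v
  have e : η.inChart y =ᶠ[𝓝 (extChartAt 𝓘(𝕜, E) y y)]
      fun z => (η.inChart x₀ (T z)).compContinuousLinearMap (fderiv 𝕜 T z) := by
    refine eventually_nhds_extChartAt 𝕜 hyy ?_
    filter_upwards [eventually_mem_extChartAt_source 𝕜 hyy,
      eventually_mem_extChartAt_source 𝕜 hy] with y' h2 h1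
    ext w
    have hTy : T (extChartAt 𝓘(𝕜, E) y y') = extChartAt 𝓘(𝕜, E) x₀ y' := by
      rw [hT, Function.comp_apply, (extChartAt 𝓘(𝕜, E) y).left_inv h2]
    rw [ContinuousAlternatingMap.compContinuousLinearMap_apply, hTy, Form.inChart_apply _ h2,
      Form.inChart_apply _ h1]
    congr 1
    funext i
    have := hd y' h1 h2 (chartPush 𝕜 y y' (w i))
    rw [chartPull_chartPush h2] at this
    rw [Function.comp_apply, ← this, chartPush_chartPull h1]
  have hTy : T (extChartAt 𝓘(𝕜, E) y y) = extChartAt 𝓘(𝕜, E) x₀ y := by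
    rw [hT, Function.comp_apply, (extChartAt 𝓘(𝕜, E) y).left_inv hyy]
  have hTs : ContDiffAt 𝕜 ω T (extChartAt 𝓘(𝕜, E) y y) := by
    rw [← contMDiffAt_iff_contDiffAt]
    refine ContMDiffAt.comp (I' := 𝓘(𝕜, E)) _ ?_ (contMDiffAt_extChartAt_symm' hyy)
    rw [(extChartAt 𝓘(𝕜, E) y).left_inv hyy]
    exact contMDiffAt_extChartAt_of_mem hy
  rw [Form.d, ContinuousAlternatingMap.compContinuousLinearMap_apply, e.extDeriv_eq,
    extDeriv_pullback (by rwa [hTy]) hTs (by simp),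
    ContinuousAlternatingMap.compContinuousLinearMap_apply, hTy]
  congr 1
  funext i
  exact (hd y hy hyy (w i)).symm

end ChartDictionary

/-! ### Analytic forms on a vector space -/

section VectorSpace

variable {𝕜 : Type*} [RCLike 𝕜]
  {E : Type*} [NormedAddCommGroup E] [NormedSpace 𝕜 E] [FiniteDimensional 𝕜 E]
  {G : Type*} [NormedAddCommGroup G] [NormedSpace 𝕜 G]
  {F : Type*} [NormedAddCommGroup F] [NormedSpace 𝕜 F] {z : G}

omit [FiniteDimensional 𝕜 E] in
lemma analyticAt_clm_apply {f : G → E →L[𝕜] F} {g : G → E} (hf : AnalyticAt 𝕜 f z)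
    (hg : AnalyticAt 𝕜 g z) : AnalyticAt 𝕜 (fun x => f x (g x)) z :=
  AnalyticAt.comp₂ (h := fun p : (E →L[𝕜] F) × E => p.1 p.2)
    ((ContinuousLinearMap.id 𝕜 (E →L[𝕜] F)).analyticAt_bilinear _) hf hg

omit [FiniteDimensional 𝕜 E] in
/-- A form on a finite-dimensional space depends analytically on a parameter as soon as its values
on the vectors of a basis do. -/
lemma analyticAt_of_basis {ι : Type*} [Fintype ι] (b : Module.Basis ι 𝕜 E) {p : ℕ}
    {g : G → E [⋀^Fin p]→L[𝕜] 𝕜}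
    (h : ∀ r : Fin p → ι, AnalyticAt 𝕜 (fun x => g x (fun a => b (r a))) z) :
    AnalyticAt 𝕜 g z := by
  let ev : (E [⋀^Fin p]→L[𝕜] 𝕜) →ₗ[𝕜] ((Fin p → ι) → 𝕜) :=
    LinearMap.pi fun r => (ContinuousAlternatingMap.apply 𝕜 E 𝕜 (fun a => b (r a))).toLinearMap
  have hev : LinearMap.ker ev = ⊥ := by
    rw [LinearMap.ker_eq_bot]
    intro g₁ g₂ h12
    apply ContinuousAlternatingMap.toAlternatingMap_injective
    refine Module.Basis.ext_alternating b fun r _ => ?_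
    exact congrFun h12 r
  obtain ⟨inv, hinv⟩ := LinearMap.exists_leftInverse_of_injective ev hev
  have hg : g = fun x => (LinearMap.toContinuousLinearMap inv) (ev (g x)) := by
    funext x
    exact (DFunLike.congr_fun hinv (g x)).symm
  rw [hg]
  refine ((LinearMap.toContinuousLinearMap inv).analyticAt _).comp ?_
  exact AnalyticAt.pi fun r => h r

omit [FiniteDimensional 𝕜 E] in
/-- Values of a form on analytic combinations of given fields. -/
lemma analyticAt_apply_of_combination {ι : Type*} [Fintype ι] {p : ℕ}
    {g : G → E [⋀^Fin p]→L[𝕜] 𝕜} {u : ι → G → E} {c : Fin p → ι → G → 𝕜} {w : Fin p → G → E}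
    (h : ∀ r : Fin p → ι, AnalyticAt 𝕜 (fun x => g x (fun a => u (r a) x)) z)
    (hc : ∀ a i, AnalyticAt 𝕜 (c a i) z)
    (hw : ∀ a, ∀ᶠ x in 𝓝 z, w a x = ∑ i, c a i x • u i x) :
    AnalyticAt 𝕜 (fun x => g x (fun a => w a x)) z := by
  have : AnalyticAt 𝕜 (fun x => ∑ r : Fin p → ι, (∏ a, c a (r a) x) *
      g x (fun a => u (r a) x)) z :=
    Finset.analyticAt_fun_sum _ fun r _ =>
      (Finset.analyticAt_fun_prod _ fun a _ => hc a (r a)).mul (h r)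
  refine this.congr ?_
  filter_upwards [eventually_all.2 hw] with x hx
  have : (fun a => w a x) = fun a => ∑ i, c a i x • u i x := funext hx
  rw [this, ContinuousAlternatingMap.map_sum]
  refine Finset.sum_congr rfl fun r _ => ?_
  have := (g x).toContinuousMultilinearMap.map_smul_univ (fun a => c a (r a) x) (fun a => u (r a) x)
  exact this.symm

/-- Values of an analytic form on analytic fields. -/
lemma analyticAt_apply {p : ℕ} {g : G → E [⋀^Fin p]→L[𝕜] 𝕜} {w : Fin p → G → E}
    (hg : AnalyticAt 𝕜 g z) (hw : ∀ a, AnalyticAt 𝕜 (w a) z) :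
    AnalyticAt 𝕜 (fun x => g x (fun a => w a x)) z := by
  let b := Module.finBasis 𝕜 E
  refine analyticAt_apply_of_combination (u := fun i _ => b i) (c := fun a i x => b.repr (w a x) i)
    (fun r => ?_) (fun a i => ?_) (fun a => ?_)
  · exact ((ContinuousAlternatingMap.apply 𝕜 E 𝕜 (fun a => b (r a))).analyticAt _).comp hg
  · exact ((LinearMap.toContinuousLinearMap (b.coord i)).analyticAt _).comp (hw a)
  · exact Eventually.of_forall fun x => (b.sum_repr (w a x)).symm

lemma analyticAt_interiorAt {p : ℕ} {g : G → E [⋀^Fin (p + 1)]→L[𝕜] 𝕜} {Z : G → E}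
    (hZ : AnalyticAt 𝕜 Z z) (hg : AnalyticAt 𝕜 g z) :
    AnalyticAt 𝕜 (fun x => interiorAt (Z x) (g x)) z := by
  let b := Module.finBasis 𝕜 E
  refine analyticAt_of_basis b fun r => ?_
  refine analyticAt_apply (w := fun a x => Matrix.vecCons (Z x) (fun a => b (r a)) a) hg fun a => ?_
  refine Fin.cases hZ (fun a => analyticAt_const) a

/-- The exterior derivative of `ι_Z μ`, where `μ` is a form of top degree which is constant along the
frame `V`: the divergence of `Z`. -/
lemma extDeriv_interiorAt {m : ℕ} {μ : E → E [⋀^Fin (m + 1)]→L[𝕜] 𝕜} {V : Fin (m + 1) → E → E}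
    {Z : E → E} {x : E} (hμ : AnalyticAt 𝕜 μ x) (hV : ∀ i, DifferentiableAt 𝕜 (V i) x)
    (hZ : AnalyticAt 𝕜 Z x) (hc : ∀ᶠ y in 𝓝 x, μ y (fun i => V i y) = 1)
    {c : Fin (m + 1) → 𝕜} (hcZ : Z x = ∑ j, c j • V j x) :
    extDeriv (fun y => interiorAt (Z y) (μ y)) x (fun i => V i x) =
      ∑ i, μ x (Function.update (fun i => V i x) i (VectorField.lieBracket 𝕜 (V i) Z x)) := by
  set w : Fin (m + 1) → E := fun i => V i x with hw
  have key : ∀ (g : E [⋀^Fin (m + 1)]→L[𝕜] 𝕜) (i : Fin (m + 1)) (u : E),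
      (-1 : 𝕜) ^ (i : ℕ) * g (Matrix.vecCons u (i.removeNth w)) = g (Function.update w i u) := by
    intro g i u
    have := AlternatingMap.map_insertNth g.toAlternatingMap i u (i.removeNth w)
    rw [Fin.insertNth_removeNth] at this
    refine Eq.trans ?_ this.symm
    rcases neg_one_pow_eq_or ℤ (i : ℕ) with h | h <;> rcases Nat.even_or_odd (i : ℕ) with h' | h' <;>
    simp [h'.neg_one_pow]
  have hdiff : DifferentiableAt 𝕜 (fun y => interiorAt (Z y) (μ y)) x :=
    (analyticAt_interiorAt hZ hμ).differentiableAt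
  rw [extDeriv_apply hdiff]
  -- as `Z = ∑ cⱼ Vⱼ` at `x`, only `j = i` contributes to the term where `μ` is differentiated
  have hterm : ∀ i : Fin (m + 1),
      (-1 : ℤ) ^ (i : ℕ) • fderiv 𝕜 (fun y => interiorAt (Z y) (μ y) (i.removeNth w)) x (w i) =
      c i * fderiv 𝕜 μ x (w i) w + μ x (Function.update w i (fderiv 𝕜 Z x (w i))) := by
    intro i
    let g : Fin (m + 1) → E → E := fun a y => Matrix.vecCons (Z y) (i.removeNth w) a
    have hg : ∀ a, DifferentiableAt 𝕜 (g a) x := by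
      intro a
      refine Fin.cases ?_ (fun a => ?_) a
      · exact hZ.differentiableAt
      · exact differentiableAt_const _
    have h1 := fderiv_continuousAlternatingMap_apply_apply hμ.differentiableAt hg (w i)
    have h2 : (fun y => interiorAt (Z y) (μ y) (i.removeNth w)) = fun y => μ y (g · y) := rfl
    rw [h2, h1, Fin.sum_univ_succ]
    have h3 : ∀ a : Fin m, μ x (Function.update (g · x) a.succ (fderiv 𝕜 (g a.succ) x (w i))) = 0 := by
      intro a
      have : fderiv 𝕜 (g a.succ) x = 0 := fderiv_const_apply _
      rw [this]
      exact (μ x).toContinuousMultilinearMap.map_update_zero _ _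
    rw [Finset.sum_eq_zero fun a _ => h3 a, add_zero]
    have h4 : Function.update (g · x) 0 (fderiv 𝕜 (g 0) x (w i)) =
        Matrix.vecCons (fderiv 𝕜 Z x (w i)) (i.removeNth w) := by
      funext a
      refine Fin.cases ?_ (fun a => ?_) a
      · rw [Function.update_self]; rfl
      · rw [Function.update_of_ne (Fin.succ_ne_zero a)]; rfl
    have h5 : (g · x) = Matrix.vecCons (Z x) (i.removeNth w) := rfl
    rw [h4, h5, smul_add]
    have hz : ∀ t : 𝕜, (-1 : ℤ) ^ (i : ℕ) • t = (-1 : 𝕜) ^ (i : ℕ) * t := fun t => by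
      rw [zsmul_eq_mul]; push_cast; rfl
    rw [hz, hz, key, key]
    congr 1
    have hsum := (fderiv 𝕜 μ x (w i)).toAlternatingMap.map_update_sum Finset.univ i
      (fun j => c j • V j x) w
    rw [hcZ]
    refine hsum.trans ?_
    rw [Finset.sum_eq_single i]
    · have := (fderiv 𝕜 μ x (w i)).toContinuousMultilinearMap.map_update_smul w i (c i) (w i)
      rw [Function.update_eq_self] at this
      exact this
    · intro j _ hji
      have := (fderiv 𝕜 μ x (w i)).toContinuousMultilinearMap.map_update_smul w i (c j) (w j)
      refine Eq.trans this ?_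
      have h0 : (fderiv 𝕜 μ x (w i)) (Function.update w i (w j)) = 0 :=
        (fderiv 𝕜 μ x (w i)).map_eq_zero_of_eq _ (i := i) (j := j)
          (by rw [Function.update_self, Function.update_of_ne hji]) hji.symm
      erw [h0]; simp
    · simp
  rw [Finset.sum_congr rfl fun i _ => hterm i, Finset.sum_add_distrib]
  -- the derivative of `μ (V₁, …, Vₙ) = 1` along `Z`
  have h0 : fderiv 𝕜 (fun y => μ y (V · y)) x (Z x) = 0 := by
    have : (fun y => μ y (V · y)) =ᶠ[𝓝 x] fun _ => 1 := hc
    rw [this.fderiv_eq]; simp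
  rw [fderiv_continuousAlternatingMap_apply_apply hμ.differentiableAt hV] at h0
  have h1 : ∑ i, c i * fderiv 𝕜 μ x (w i) w = fderiv 𝕜 μ x (Z x) (V · x) := by
    rw [hcZ, map_sum, ContinuousAlternatingMap.sum_apply]
    refine Finset.sum_congr rfl fun i _ => ?_
    rw [map_smul]; rfl
  rw [h1, eq_neg_of_add_eq_zero_left h0, neg_add_eq_sub, ← Finset.sum_sub_distrib]
  refine Finset.sum_congr rfl fun i _ => ?_
  rw [VectorField.lieBracket]
  exact ((μ x).toContinuousMultilinearMap.map_update_sub w i _ _).symm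

end VectorSpace

/-! ### Frames of vector fields -/

section LinearFrames

variable {𝕜 : Type*} [RCLike 𝕜] {T : Type*} [AddCommGroup T] [Module 𝕜 T] [TopologicalSpace T]
  [IsTopologicalAddGroup T] [ContinuousSMul 𝕜 T] {n : ℕ}

/-- The linear map `(c₁, …, cₙ) ↦ ∑ cᵢ uᵢ`. -/
def frameMap (u : Fin n → T) : (Fin n → 𝕜) →L[𝕜] T :=
  ∑ j, (ContinuousLinearMap.proj j : (Fin n → 𝕜) →L[𝕜] 𝕜).smulRight (u j)

lemma frameMap_apply (u : Fin n → T) (c : Fin n → 𝕜) : frameMap u c = ∑ j, c j • u j := by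
  simp [frameMap]

variable [T2Space T] [FiniteDimensional 𝕜 T]

lemma exists_frameEquiv {u : Fin n → T} (hu : LinearIndependent 𝕜 u)
    (hn : n = Module.finrank 𝕜 T) : ∃ e : (Fin n → 𝕜) ≃L[𝕜] T, (e : (Fin n → 𝕜) →L[𝕜] T) = frameMap u := by
  have hinj : Function.Injective (frameMap (𝕜 := 𝕜) u : (Fin n → 𝕜) →ₗ[𝕜] T) := by
    rw [← LinearMap.ker_eq_bot, LinearMap.ker_eq_bot']
    intro c hc
    have hc' : ∑ j, c j • u j = 0 := by rw [← frameMap_apply]; exact hc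
    exact funext fun j => Fintype.linearIndependent_iff.1 hu c hc' j
  refine ⟨(LinearEquiv.ofInjectiveOfFinrankEq _ hinj (by simp [hn])).toContinuousLinearEquiv, ?_⟩
  ext; rfl

lemma sum_inverse_smul {u : Fin n → T} (hu : LinearIndependent 𝕜 u)
    (hn : n = Module.finrank 𝕜 T) (w : T) : ∑ j, (frameMap (𝕜 := 𝕜) u).inverse w j • u j = w := by
  obtain ⟨e, he⟩ := exists_frameEquiv hu hn
  rw [← frameMap_apply, ← he, ContinuousLinearMap.inverse_equiv]
  exact e.apply_symm_apply w

lemma inverse_eq_of_sum {u : Fin n → T} (hu : LinearIndependent 𝕜 u)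
    (hn : n = Module.finrank 𝕜 T) {w : T} {c : Fin n → 𝕜} (h : ∑ j, c j • u j = w) :
    (frameMap (𝕜 := 𝕜) u).inverse w = c := by
  obtain ⟨e, he⟩ := exists_frameEquiv hu hn
  rw [← frameMap_apply, ← he] at h
  rw [← he, ContinuousLinearMap.inverse_equiv, ← h]
  exact e.symm_apply_apply c

end LinearFrames

section AnalyticFrames

variable {𝕜 : Type*} [RCLike 𝕜]
  {E : Type*} [NormedAddCommGroup E] [NormedSpace 𝕜 E] [FiniteDimensional 𝕜 E] [CompleteSpace E]
  {G : Type*} [NormedAddCommGroup G] [NormedSpace 𝕜 G] {z : G} {n : ℕ}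

lemma analyticAt_frameMap {u : Fin n → G → E} (hu : ∀ i, AnalyticAt 𝕜 (u i) z) :
    AnalyticAt 𝕜 (fun x => frameMap (𝕜 := 𝕜) (fun i => u i x)) z :=
  Finset.analyticAt_fun_sum _ fun j _ =>
    ((ContinuousLinearMap.smulRightL 𝕜 (Fin n → 𝕜) E (ContinuousLinearMap.proj j)).analyticAt _).comp
      (hu j)

lemma analyticAt_inverse_frameMap {u : Fin n → G → E} {w : G → E} (hu : ∀ i, AnalyticAt 𝕜 (u i) z)
    (hi : LinearIndependent 𝕜 (fun i => u i z)) (hn : n = Module.finrank 𝕜 E)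
    (hw : AnalyticAt 𝕜 w z) (i : Fin n) :
    AnalyticAt 𝕜 (fun x => (frameMap (𝕜 := 𝕜) (fun i => u i x)).inverse (w x) i) z := by
  obtain ⟨e, he⟩ := exists_frameEquiv hi hn
  have h1 : AnalyticAt 𝕜 (ContinuousLinearMap.inverse (M := Fin n → 𝕜) (M₂ := E))
      (frameMap (𝕜 := 𝕜) (fun i => u i z)) := by
    rw [analyticAt_iff_contDiffAt, ← he]
    exact contDiffAt_map_inverse e
  have h2 := analyticAt_clm_apply (AnalyticAt.comp
    (f := fun x => frameMap (𝕜 := 𝕜) (fun i => u i x)) h1 (analyticAt_frameMap hu)) hw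
  exact ((ContinuousLinearMap.proj (R := 𝕜) (φ := fun _ : Fin n => 𝕜) i).analyticAt _).comp h2

lemma eventually_linearIndependent {u : Fin n → G → E} (hu : ∀ i, AnalyticAt 𝕜 (u i) z)
    (hi : LinearIndependent 𝕜 (fun i => u i z)) :
    ∀ᶠ x in 𝓝 z, LinearIndependent 𝕜 (fun i => u i x) := by
  have : Tendsto (fun x i => u i x) (𝓝 z) (𝓝 (fun i => u i z)) :=
    tendsto_pi_nhds.2 fun i => (hu i).continuousAt
  exact this.eventually hi.eventually

end AnalyticFrames

section ManifoldFrames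

variable {𝕜 : Type*} [RCLike 𝕜]
  {E : Type*} [NormedAddCommGroup E] [NormedSpace 𝕜 E] [FiniteDimensional 𝕜 E] [CompleteSpace E]
  {M : Type*} [TopologicalSpace M] [ChartedSpace E M]

instance (x : M) : T2Space (TangentSpace 𝓘(𝕜, E) x) := inferInstanceAs (T2Space E)

instance (x : M) : FiniteDimensional 𝕜 (TangentSpace 𝓘(𝕜, E) x) :=
  inferInstanceAs (FiniteDimensional 𝕜 E)

/-- The vector fields `v₁, …, vₙ` are analytic at `y`, and their values at `y` are a basis of the
tangent space. -/
structure IsFrameAt [IsManifold 𝓘(𝕜, E) ω M] {n : ℕ} (v : Fin n → VField 𝕜 E M) (y : M) : Prop where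
  analytic : ∀ i, (v i).AnalyticAt y
  linearIndependent : LinearIndependent 𝕜 (fun i => v i y)
  card_eq : n = Module.finrank 𝕜 E

variable {n : ℕ} {v : Fin n → VField 𝕜 E M} {x₀ y : M}

lemma sum_dualCoframe_smul (hi : LinearIndependent 𝕜 (fun i => v i y))
    (hn : n = Module.finrank 𝕜 E) (w : TangentSpace 𝓘(𝕜, E) y) :
    ∑ i, dualCoframe v i y w • v i y = w :=
  sum_inverse_smul hi hn w

lemma dualCoframe_eq_of_sum (hi : LinearIndependent 𝕜 (fun i => v i y))
    (hn : n = Module.finrank 𝕜 E) {w : TangentSpace 𝓘(𝕜, E) y} {c : Fin n → 𝕜}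
    (h : ∑ i, c i • v i y = w) (i : Fin n) : dualCoframe v i y w = c i :=
  congrFun (inverse_eq_of_sum hi hn h) i

lemma dualCoframe_apply_self (hi : LinearIndependent 𝕜 (fun i => v i y))
    (hn : n = Module.finrank 𝕜 E) (i j : Fin n) :
    dualCoframe v i y (v j y) = if i = j then 1 else 0 := by
  refine dualCoframe_eq_of_sum hi hn (c := fun i => if i = j then 1 else 0) ?_ i
  simp

variable [IsManifold 𝓘(𝕜, E) ω M]

/-! ### Analyticity tested in a chart and on a frame -/

lemma VField.analyticAt_iff_inChart {V : VField 𝕜 E M}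
    (hy : y ∈ (extChartAt 𝓘(𝕜, E) x₀).source) :
    V.AnalyticAt y ↔ _root_.AnalyticAt 𝕜 (V.inChart x₀) (extChartAt 𝓘(𝕜, E) x₀ y) := by
  refine ⟨fun h => h.inChart hy, fun h => ?_⟩
  have h1 : ContMDiffAt 𝓘(𝕜, E) 𝓘(𝕜, E).tangent ω
      (fun z => (⟨z, V.inChart x₀ z⟩ : TangentBundle 𝓘(𝕜, E) E)) (extChartAt 𝓘(𝕜, E) x₀ y) :=
    contMDiffAt_vectorSpace_iff_contDiffAt.2 (analyticAt_iff_contDiffAt.1 h)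
  have h2 := ContMDiffAt.mpullback_vectorField_preimage (m := ω) (n := ω) h1
    (contMDiffAt_extChartAt_of_mem hy) (isInvertible_mfderiv_extChartAt hy) (by simp)
  refine ContMDiffAt.congr_of_eventuallyEq h2 ?_
  filter_upwards [eventually_mem_extChartAt_source 𝕜 hy] with x hx
  have h3 : VectorField.mpullback 𝓘(𝕜, E) 𝓘(𝕜, E) (extChartAt 𝓘(𝕜, E) x₀) (V.inChart x₀) x =
      V x :=
    (congrArg (chartPush 𝕜 x₀ x) (V.inChart_apply hx)).trans (chartPush_chartPull hx (V x))
  rw [h3]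

lemma VField.AnalyticAt.eventually {V : VField 𝕜 E M} (h : V.AnalyticAt y) :
    ∀ᶠ x in 𝓝 y, V.AnalyticAt x := by
  have hy := mem_extChartAt_source (I := 𝓘(𝕜, E)) y
  filter_upwards [eventually_mem_extChartAt_source 𝕜 hy,
    eventually_of_extChartAt 𝕜 hy (h.inChart hy).eventually_analyticAt] with x hx h'
  exact (VField.analyticAt_iff_inChart hx).2 h'

lemma VField.AnalyticAt.mlieBracket {X Y : VField 𝕜 E M} (hX : X.AnalyticAt y)
    (hY : Y.AnalyticAt y) : VField.AnalyticAt (VectorField.mlieBracket 𝓘(𝕜, E) X Y) y := by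
  have hy := mem_extChartAt_source (I := 𝓘(𝕜, E)) y
  rw [VField.analyticAt_iff_inChart hy]
  have hX' := hX.inChart hy
  have hY' := hY.inChart hy
  have h1 : _root_.AnalyticAt 𝕜 (VectorField.lieBracket 𝕜 (X.inChart y) (Y.inChart y))
      (extChartAt 𝓘(𝕜, E) y y) :=
    (analyticAt_clm_apply hY'.fderiv hX').sub (analyticAt_clm_apply hX'.fderiv hY')
  refine h1.congr (eventually_nhds_extChartAt 𝕜 hy ?_)
  filter_upwards [eventually_mem_extChartAt_source 𝕜 hy, hX.eventually, hY.eventually]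
    with x hx h2 h3
  exact (mlieBracket_inChart h2 h3 hx).symm

lemma VField.AnalyticAt.sum_smul {ι : Type*} [Fintype ι] {c : ι → M → 𝕜} {X : ι → VField 𝕜 E M}
    (hc : ∀ i, FunAnalyticAt 𝕜 E (c i) y) (hX : ∀ i, (X i).AnalyticAt y) :
    VField.AnalyticAt (fun x => ∑ i, c i x • X i x) y :=
  ContMDiffAt.sum_section fun i _ => (hc i).smul_section (hX i)

lemma linearIndependent_inChart (hi : LinearIndependent 𝕜 (fun i => v i y))
    (hy : y ∈ (extChartAt 𝓘(𝕜, E) x₀).source) :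
    LinearIndependent 𝕜 (fun i => (v i).inChart x₀ (extChartAt 𝓘(𝕜, E) x₀ y)) := by
  have := hi.map' (chartEquiv hy).toLinearEquiv.toLinearMap (LinearEquiv.ker _)
  have e : (fun i => (v i).inChart x₀ (extChartAt 𝓘(𝕜, E) x₀ y)) =
      (chartEquiv hy).toLinearEquiv.toLinearMap ∘ (fun i => v i y) :=
    funext fun i => (v i).inChart_apply hy
  rw [e]
  exact this

lemma linearIndependent_of_inChart (hy : y ∈ (extChartAt 𝓘(𝕜, E) x₀).source)
    (hi : LinearIndependent 𝕜 (fun i => (v i).inChart x₀ (extChartAt 𝓘(𝕜, E) x₀ y))) :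
    LinearIndependent 𝕜 (fun i => v i y) := by
  have e : (fun i => (v i).inChart x₀ (extChartAt 𝓘(𝕜, E) x₀ y)) =
      (chartEquiv hy).toLinearEquiv.toLinearMap ∘ (fun i => v i y) :=
    funext fun i => (v i).inChart_apply hy
  rw [e] at hi
  exact LinearIndependent.of_comp _ hi

lemma dualCoframe_inChart (hi : LinearIndependent 𝕜 (fun i => v i y))
    (hn : n = Module.finrank 𝕜 E) (hy : y ∈ (extChartAt 𝓘(𝕜, E) x₀).source)
    (w : TangentSpace 𝓘(𝕜, E) y) (i : Fin n) :
    dualCoframe v i y w =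
      (frameMap (𝕜 := 𝕜) fun j => (v j).inChart x₀ (extChartAt 𝓘(𝕜, E) x₀ y)).inverse
        (chartPull 𝕜 x₀ y w) i := by
  refine (congrFun (inverse_eq_of_sum (linearIndependent_inChart hi hy) hn
    (c := fun i => dualCoframe v i y w) ?_) i).symm
  conv_rhs => rw [← sum_dualCoframe_smul hi hn w]
  rw [map_sum]
  refine Finset.sum_congr rfl fun j _ => ?_
  rw [map_smul, (v j).inChart_apply hy]

lemma FunAnalyticAt.eventually {f : M → 𝕜} (h : FunAnalyticAt 𝕜 E f y) :
    ∀ᶠ x in 𝓝 y, FunAnalyticAt 𝕜 E f x :=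
  (contMDiffAt_iff_contMDiffAt_nhds (by simp)).1 h

lemma FunAnalyticAt.mdifferentiableAt {f : M → 𝕜} (h : FunAnalyticAt 𝕜 E f y) :
    MDifferentiableAt 𝓘(𝕜, E) 𝓘(𝕜, 𝕜) f y :=
  ContMDiffAt.mdifferentiableAt h (by simp)

lemma IsFrameAt.eventually (hv : IsFrameAt v y) : ∀ᶠ x in 𝓝 y, IsFrameAt v x := by
  have hy := mem_extChartAt_source (I := 𝓘(𝕜, E)) y
  filter_upwards [eventually_all.2 fun i => (hv.analytic i).eventually,
    eventually_mem_extChartAt_source 𝕜 hy,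
    eventually_of_extChartAt 𝕜 hy (eventually_linearIndependent (fun i => (hv.analytic i).inChart hy)
      (linearIndependent_inChart hv.linearIndependent hy))] with x h1 hx h2
  exact ⟨h1, linearIndependent_of_inChart hx h2, hv.card_eq⟩

lemma funAnalyticAt_of_inChart {f : M → 𝕜} {g : E → 𝕜} (hy : y ∈ (extChartAt 𝓘(𝕜, E) x₀).source)
    (hg : AnalyticAt 𝕜 g (extChartAt 𝓘(𝕜, E) x₀ y))
    (h : ∀ᶠ x in 𝓝 y, f x = g (extChartAt 𝓘(𝕜, E) x₀ x)) : FunAnalyticAt 𝕜 E f y := by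
  rw [FunAnalyticAt, contMDiffAt_iff_analyticAt_comp_symm hy]
  refine hg.congr (eventually_nhds_extChartAt 𝕜 hy ?_)
  filter_upwards [h, eventually_mem_extChartAt_source 𝕜 hy] with x h1 hx
  rw [Function.comp_apply, (extChartAt 𝓘(𝕜, E) x₀).left_inv hx, h1]

/-- The components of an analytic vector field in an analytic frame are analytic. -/
lemma IsFrameAt.funAnalyticAt_dualCoframe (hv : IsFrameAt v y) {X : VField 𝕜 E M}
    (hX : X.AnalyticAt y) (i : Fin n) : FunAnalyticAt 𝕜 E (fun x => dualCoframe v i x (X x)) y := by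
  have hy := mem_extChartAt_source (I := 𝓘(𝕜, E)) y
  refine funAnalyticAt_of_inChart hy (analyticAt_inverse_frameMap
    (fun i => (hv.analytic i).inChart hy) (linearIndependent_inChart hv.linearIndependent hy)
    hv.card_eq (hX.inChart hy) i) ?_
  filter_upwards [hv.eventually, eventually_mem_extChartAt_source 𝕜 hy] with x h1 hx
  rw [dualCoframe_inChart h1.linearIndependent h1.card_eq hx, VField.inChart_apply X hx]

lemma FunAnalyticAt.mvfderiv {f : M → 𝕜} {X : VField 𝕜 E M} (hf : FunAnalyticAt 𝕜 E f y)
    (hX : X.AnalyticAt y) :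
    FunAnalyticAt 𝕜 E (fun x => mvfderiv 𝓘(𝕜, E) f x (X x)) y := by
  have hy := mem_extChartAt_source (I := 𝓘(𝕜, E)) y
  have hf' := (contMDiffAt_iff_analyticAt_comp_symm hy).1 hf
  refine funAnalyticAt_of_inChart hy (analyticAt_clm_apply hf'.fderiv (hX.inChart hy)) ?_
  filter_upwards [hf.eventually, eventually_mem_extChartAt_source 𝕜 hy] with x h1 hx
  rw [mvfderiv_eq_fderiv hx h1.mdifferentiableAt, X.inChart_apply hx]

/-- Values of an analytic form on analytic vector fields. -/
lemma Form.AnalyticAt.apply {p : ℕ} {η : Form 𝕜 E M p} {X : Fin p → VField 𝕜 E M}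
    (hη : η.AnalyticAt y) (hX : ∀ a, (X a).AnalyticAt y) :
    FunAnalyticAt 𝕜 E (fun x => η x (fun a => X a x)) y := by
  have hy := mem_extChartAt_source (I := 𝓘(𝕜, E)) y
  refine funAnalyticAt_of_inChart hy (analyticAt_apply hη fun a => (hX a).inChart hy) ?_
  filter_upwards [eventually_mem_extChartAt_source 𝕜 hy] with x hx
  rw [Form.inChart_apply_inChart η X hx]

/-- A form is analytic as soon as its values on the vectors of an analytic frame are. -/
lemma IsFrameAt.inChart_analyticAt (hv : IsFrameAt v y) {p : ℕ} {η : Form 𝕜 E M p}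
    (hy : y ∈ (extChartAt 𝓘(𝕜, E) x₀).source)
    (h : ∀ r : Fin p → Fin n, FunAnalyticAt 𝕜 E (fun x => η x (fun a => v (r a) x)) y) :
    AnalyticAt 𝕜 (η.inChart x₀) (extChartAt 𝓘(𝕜, E) x₀ y) := by
  let b := Module.finBasis 𝕜 E
  refine analyticAt_of_basis b fun r => ?_
  have hl := linearIndependent_inChart hv.linearIndependent hy
  refine analyticAt_apply_of_combination (u := fun i z => (v i).inChart x₀ z)
    (c := fun a i z => (frameMap (𝕜 := 𝕜) fun j => (v j).inChart x₀ z).inverse (b (r a)) i)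
    (w := fun a _ => b (r a)) (fun r => ?_)
    (fun a i => analyticAt_inverse_frameMap (fun i => (hv.analytic i).inChart hy) hl hv.card_eq
      analyticAt_const i) (fun a => ?_)
  · have := (contMDiffAt_iff_analyticAt_comp_symm hy).1 (h r)
    refine this.congr (eventually_nhds_extChartAt 𝕜 hy ?_)
    filter_upwards [eventually_mem_extChartAt_source 𝕜 hy] with x hx
    rw [Form.inChart_apply_inChart η (fun a => v (r a)) hx, Function.comp_apply,
      (extChartAt 𝓘(𝕜, E) x₀).left_inv hx]
  · filter_upwards [eventually_linearIndependent (fun i => (hv.analytic i).inChart hy) hl] with z hz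
    exact (sum_inverse_smul hz hv.card_eq (b (r a))).symm

lemma IsFrameAt.analyticAt_iff (hv : IsFrameAt v y) {p : ℕ} {η : Form 𝕜 E M p} :
    η.AnalyticAt y ↔
      ∀ r : Fin p → Fin n, FunAnalyticAt 𝕜 E (fun x => η x (fun a => v (r a) x)) y :=
  ⟨fun h r => h.apply fun a => hv.analytic (r a),
    fun h => hv.inChart_analyticAt (mem_extChartAt_source y) h⟩

end ManifoldFrames

/-! ### Primitives of analytic 1-forms and linear differential equations -/

section Primitive

variable {𝕜 : Type*} [RCLike 𝕜]
  {E : Type*} [NormedAddCommGroup E] [NormedSpace 𝕜 E]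

/-- A function whose differential is analytic is analytic: along each ray, the Taylor series of the
differential is integrated term by term. -/
lemma analyticAt_of_hasFDerivAt {g : E → 𝕜} {a : E → E →L[𝕜] 𝕜} {z₀ : E} (ha : AnalyticAt 𝕜 a z₀)
    (hg : ∀ᶠ z in 𝓝 z₀, HasFDerivAt g (a z) z) : AnalyticAt 𝕜 g z₀ := by
  let _ : NormedSpace ℝ E := NormedSpace.restrictScalars ℝ 𝕜 E
  have _ : IsScalarTower ℝ 𝕜 E := RestrictScalars.isScalarTower ℝ 𝕜 E
  obtain ⟨p, r, hp⟩ := ha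
  let q : FormalMultilinearSeries 𝕜 E (E →L[𝕜] 𝕜) := fun n => ((n + 1 : 𝕜)⁻¹) • p n
  have hqn : ∀ n, ‖q n‖ ≤ ‖p n‖ := by
    intro n
    have h1 : ‖((n + 1 : 𝕜)⁻¹)‖ ≤ 1 := by
      rw [norm_inv]
      refine inv_le_one_of_one_le₀ ?_
      have : ((n : 𝕜) + 1) = ((n + 1 : ℕ) : 𝕜) := by push_cast; ring
      rw [this, RCLike.norm_natCast]
      exact_mod_cast Nat.le_add_left 1 n
    refine ContinuousMultilinearMap.opNorm_le_bound (norm_nonneg _) fun m => ?_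
    calc ‖(n + 1 : 𝕜)⁻¹ • p n m‖ = ‖((n + 1 : 𝕜)⁻¹)‖ * ‖p n m‖ := norm_smul _ _
      _ ≤ 1 * ‖p n m‖ := by gcongr
      _ = ‖p n m‖ := one_mul _
      _ ≤ _ := (p n).le_opNorm m
  have hqr : p.radius ≤ q.radius := by
    refine ENNReal.le_of_forall_nnreal_lt fun s hs => ?_
    obtain ⟨C, _, hC⟩ := p.norm_mul_pow_le_of_lt_radius hs
    exact q.le_radius_of_bound C fun n => (by gcongr; exact hqn n : _ ≤ _).trans (hC n)
  have hq := q.hasFPowerSeriesOnBall (hp.r_pos.trans_le (hp.r_le.trans hqr))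
  have han : AnalyticAt 𝕜 (fun z => g z₀ + q.sum (z - z₀) (z - z₀)) z₀ := by
    have h0 : AnalyticAt 𝕜 q.sum (z₀ - z₀) := by rw [sub_self]; exact hq.analyticAt
    have hs : AnalyticAt 𝕜 (fun z => z - z₀) z₀ := analyticAt_id.sub analyticAt_const
    exact analyticAt_const.add (analyticAt_clm_apply (AnalyticAt.comp (f := fun z => z - z₀) h0 hs) hs)
  refine han.congr ?_
  obtain ⟨ε, hε, hball⟩ := Metric.eventually_nhds_iff_ball.1 hg
  have hr : ∀ᶠ z in 𝓝 z₀, z ∈ Metric.eball z₀ r := Metric.eball_mem_nhds _ hp.r_pos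
  filter_upwards [hr, Metric.ball_mem_nhds z₀ hε] with z hz hzε
  set y := z - z₀ with hy
  have hy0 : ∀ t ∈ Icc (0 : ℝ) 1, ‖t • y‖ ≤ ‖y‖ := by
    intro t ht
    rw [norm_smul, Real.norm_eq_abs, abs_of_nonneg ht.1]
    exact mul_le_of_le_one_left (norm_nonneg _) ht.2
  have hyr : y ∈ Metric.eball (0 : E) r := by
    rw [mem_eball_zero_iff]; rwa [Metric.mem_eball, edist_eq_enorm_sub] at hz
  have hty : ∀ t ∈ Icc (0 : ℝ) 1, t • y ∈ Metric.eball (0 : E) r := by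
    intro t ht
    rw [mem_eball_zero_iff] at hyr ⊢
    refine lt_of_le_of_lt ?_ hyr
    rw [← ofReal_norm, ← ofReal_norm]
    exact ENNReal.ofReal_le_ofReal (hy0 t ht)
  have htε : ∀ t ∈ Icc (0 : ℝ) 1, z₀ + t • y ∈ Metric.ball z₀ ε := by
    intro t ht
    rw [mem_ball_iff_norm, add_sub_cancel_left]
    exact (hy0 t ht).trans_lt (by rwa [mem_ball_iff_norm] at hzε)
  let c : ℕ → 𝕜 := fun n => p n (fun _ => y) y
  -- the differential along the ray
  have hsum : ∀ t ∈ Icc (0 : ℝ) 1, HasSum (fun n => t ^ n • c n) (a (z₀ + t • y) y) := by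
    intro t ht
    have h1 := ((ContinuousLinearMap.apply 𝕜 𝕜 y).hasSum (hp.hasSum (hty t ht)))
    refine (congrArg (fun F => HasSum F (a (z₀ + t • y) y)) (funext fun n => ?_)).mp h1
    have h2 : (p n fun _ => t • y) = (t : 𝕜) ^ n • p n fun _ => y := by
      have := (p n).map_smul_univ (fun _ => (t : 𝕜)) (fun _ => y)
      rw [Finset.prod_const, Finset.card_univ, Fintype.card_fin] at this
      rw [← this]
      congr 1
    refine (congrArg (fun T : E →L[𝕜] 𝕜 => T y) h2).trans ?_
    change (t : 𝕜) ^ n * c n = t ^ n • c n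
    rw [RCLike.real_smul_eq_coe_mul, RCLike.ofReal_pow]
  have hcs : Summable fun n => ‖c n‖ := by
    have h1 := p.summable_norm_apply (x := y) (Metric.eball_subset_eball hp.r_le hyr)
    refine Summable.of_nonneg_of_le (fun _ => norm_nonneg _) (fun n => ?_) (h1.mul_right ‖y‖)
    exact ContinuousLinearMap.le_opNorm _ _
  have hint := intervalIntegral.hasSum_integral_of_dominated_convergence
    (a := 0) (b := 1) (μ := MeasureTheory.volume)
    (F := fun n (t : ℝ) => t ^ n • c n) (f := fun t => a (z₀ + t • y) y) (fun n _ => ‖c n‖)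
    (fun n => (by fun_prop : Continuous fun t : ℝ => t ^ n • c n).aestronglyMeasurable)
    (fun n => Eventually.of_forall fun t ht => ?_)
    (Eventually.of_forall fun t _ => hcs)
    (by simp)
    (Eventually.of_forall fun t ht => hsum t ?_)
  · have hder : ∀ t ∈ uIcc (0 : ℝ) 1,
        HasDerivAt (fun t : ℝ => g (z₀ + t • y)) (a (z₀ + t • y) y) t := by
      intro t ht
      rw [uIcc_of_le zero_le_one] at ht
      have h1 := (hball _ (htε t ht)).restrictScalars ℝ
      have h2 : HasDerivAt (fun t : ℝ => z₀ + t • y) y t := by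
        simpa using ((hasDerivAt_id t).smul_const y).const_add z₀
      exact h1.comp_hasDerivAt t h2
    have hcont : ContinuousOn (fun t : ℝ => a (z₀ + t • y) y) (uIcc 0 1) := by
      intro t ht
      rw [uIcc_of_le zero_le_one] at ht
      have h1 : ContinuousAt a (z₀ + t • y) := by
        refine (hp.analyticAt_of_mem ?_).continuousAt
        have := hty t ht
        rw [mem_eball_zero_iff] at this
        rwa [Metric.mem_eball, edist_eq_enorm_sub, add_sub_cancel_left]
      have h2 : ContinuousAt (fun t : ℝ => a (z₀ + t • y)) t :=
        ContinuousAt.comp (f := fun t : ℝ => z₀ + t • y) h1 (by fun_prop)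
      exact (h2.clm_apply continuousAt_const).continuousWithinAt
    rw [intervalIntegral.integral_eq_sub_of_hasDerivAt hder hcont.intervalIntegrable] at hint
    have hI : ∀ n : ℕ, ∫ t in (0 : ℝ)..1, t ^ n • c n = ((n + 1 : 𝕜)⁻¹) * c n := by
      intro n
      rw [intervalIntegral.integral_smul_const, integral_pow]
      simp [RCLike.real_smul_eq_coe_mul]
    simp only [hI] at hint
    have hqs : HasSum (fun n : ℕ => ((n + 1 : 𝕜)⁻¹) * c n) (q.sum y y) := by
      have h1 := (ContinuousLinearMap.apply 𝕜 𝕜 y).hasSum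
        (hq.hasSum (Metric.eball_subset_eball (hp.r_le.trans hqr) hyr))
      rw [zero_add] at h1
      exact h1
    have := hqs.unique hint
    rw [this]
    simp [hy]
  · rw [uIoc_of_le zero_le_one] at ht
    rw [norm_smul, norm_pow, Real.norm_eq_abs, abs_of_pos ht.1]
    exact mul_le_of_le_one_left (norm_nonneg _) (pow_le_one₀ ht.1.le ht.2)
  · rw [uIoc_of_le zero_le_one] at ht
    exact ⟨ht.1.le, ht.2⟩

/-- Poincaré's lemma for analytic 1-forms. -/
lemma exists_primitive {a : E → E →L[𝕜] 𝕜} {z₀ : E} (ha : AnalyticAt 𝕜 a z₀)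
    (hs : ∀ᶠ z in 𝓝 z₀, ∀ u v, fderiv 𝕜 a z u v = fderiv 𝕜 a z v u) :
    ∃ g : E → 𝕜, AnalyticAt 𝕜 g z₀ ∧ ∀ᶠ z in 𝓝 z₀, HasFDerivAt g (a z) z := by
  let _ : NormedSpace ℝ E := NormedSpace.restrictScalars ℝ 𝕜 E
  have _ : IsScalarTower ℝ 𝕜 E := RestrictScalars.isScalarTower ℝ 𝕜 E
  obtain ⟨ε, hε, hball⟩ := Metric.eventually_nhds_iff_ball.1 (hs.and ha.eventually_analyticAt)
  obtain ⟨g, hg⟩ := (convex_ball z₀ ε).exists_forall_hasFDerivAt_of_fderiv_symmetric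
    Metric.isOpen_ball
    (fun z hz => (((hball z hz).2.differentiableAt).restrictScalars ℝ).differentiableWithinAt)
    (fun z hz u v => by
      rw [((hball z hz).2.differentiableAt).fderiv_restrictScalars ℝ]
      exact (hball z hz).1 u v)
  have hg' : ∀ᶠ z in 𝓝 z₀, HasFDerivAt g (a z) z := by
    filter_upwards [Metric.ball_mem_nhds z₀ hε] with z hz using hg z hz
  exact ⟨g, analyticAt_of_hasFDerivAt ha hg', hg'⟩

/-- A solution of a homogeneous linear differential equation `df = f • b` which vanishes at a point
vanishes near this point. -/
lemma eventually_eq_zero_of_fderiv_eq {f : E → 𝕜} {b : E → E →L[𝕜] 𝕜} {z₀ : E}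
    (hb : ContinuousAt b z₀) (hf : ∀ᶠ z in 𝓝 z₀, HasFDerivAt f (f z • b z) z) (h0 : f z₀ = 0) :
    ∀ᶠ z in 𝓝 z₀, f z = 0 := by
  let _ : NormedSpace ℝ E := NormedSpace.restrictScalars ℝ 𝕜 E
  have _ : IsScalarTower ℝ 𝕜 E := RestrictScalars.isScalarTower ℝ 𝕜 E
  have hb' : ∀ᶠ z in 𝓝 z₀, ‖b z‖ < ‖b z₀‖ + 1 :=
    hb.norm.eventually (gt_mem_nhds (lt_add_one _))
  obtain ⟨ε, hε, hball⟩ := Metric.eventually_nhds_iff_ball.1 (hf.and hb')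
  filter_upwards [Metric.ball_mem_nhds z₀ hε] with z hz
  set y := z - z₀ with hy
  have htε : ∀ t ∈ Icc (0 : ℝ) 1, z₀ + t • y ∈ Metric.ball z₀ ε := by
    intro t ht
    rw [mem_ball_iff_norm, add_sub_cancel_left, norm_smul, Real.norm_eq_abs, abs_of_nonneg ht.1]
    exact (mul_le_of_le_one_left (norm_nonneg _) ht.2).trans_lt (by rwa [mem_ball_iff_norm] at hz)
  have hder : ∀ t ∈ Icc (0 : ℝ) 1, HasDerivAt (fun t : ℝ => f (z₀ + t • y))
      ((f (z₀ + t • y) • b (z₀ + t • y)) y) t := by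
    intro t ht
    have h1 := ((hball _ (htε t ht)).1).restrictScalars ℝ
    have h2 : HasDerivAt (fun t : ℝ => z₀ + t • y) y t := by
      simpa using ((hasDerivAt_id t).smul_const y).const_add z₀
    exact h1.comp_hasDerivAt t h2
  have := eq_zero_of_abs_deriv_le_mul_abs_self_of_eq_zero_right (K := (‖b z₀‖ + 1) * ‖y‖)
    (f := fun t : ℝ => f (z₀ + t • y)) (a := 0) (b := 1)
    (fun t ht => (hder t ht).continuousAt.continuousWithinAt)
    (fun t ht => (hder t ⟨ht.1, ht.2.le⟩).hasDerivWithinAt) (by simpa using h0)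
    (fun t ht => by
      have hb := (hball _ (htε t ⟨ht.1, ht.2.le⟩)).2.le
      change ‖f (z₀ + t • y) • (b (z₀ + t • y) y)‖ ≤ _
      rw [norm_smul, mul_comm]
      gcongr
      exact (ContinuousLinearMap.le_opNorm _ _).trans (by gcongr)) 1 (by simp)
  simpa [hy] using this

end Primitive

/-! ### Calculus with vector fields -/

section Calculus

variable {𝕜 : Type*} [RCLike 𝕜]
  {E : Type*} [NormedAddCommGroup E] [NormedSpace 𝕜 E] [FiniteDimensional 𝕜 E] [CompleteSpace E]
  {M : Type*} [TopologicalSpace M] [ChartedSpace E M] [IsManifold 𝓘(𝕜, E) ω M] {x₀ y : M}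

lemma mvfderiv_of_inChart {f : M → 𝕜} {g : E → 𝕜} (hy : y ∈ (extChartAt 𝓘(𝕜, E) x₀).source)
    (hg : AnalyticAt 𝕜 g (extChartAt 𝓘(𝕜, E) x₀ y))
    (h : ∀ᶠ x in 𝓝 y, f x = g (extChartAt 𝓘(𝕜, E) x₀ x)) (w : TangentSpace 𝓘(𝕜, E) y) :
    mvfderiv 𝓘(𝕜, E) f y w =
      fderiv 𝕜 g (extChartAt 𝓘(𝕜, E) x₀ y) (chartPull 𝕜 x₀ y w) := by
  rw [mvfderiv_eq_fderiv hy (funAnalyticAt_of_inChart hy hg h).mdifferentiableAt]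
  have : f ∘ (extChartAt 𝓘(𝕜, E) x₀).symm =ᶠ[𝓝 (extChartAt 𝓘(𝕜, E) x₀ y)] g := by
    refine eventually_nhds_extChartAt 𝕜 hy ?_
    filter_upwards [h, eventually_mem_extChartAt_source 𝕜 hy] with x h1 hx
    rw [Function.comp_apply, (extChartAt 𝓘(𝕜, E) x₀).left_inv hx, h1]
  rw [this.fderiv_eq]

/-- The bracket of vector fields is the commutator of the derivations. -/
lemma mvfderiv_mlieBracket {f : M → 𝕜} {X Y : VField 𝕜 E M} (hf : FunAnalyticAt 𝕜 E f y)
    (hX : X.AnalyticAt y) (hY : Y.AnalyticAt y) :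
    mvfderiv 𝓘(𝕜, E) f y (VectorField.mlieBracket 𝓘(𝕜, E) X Y y) =
      mvfderiv 𝓘(𝕜, E) (fun x => mvfderiv 𝓘(𝕜, E) f x (Y x)) y (X y) -
        mvfderiv 𝓘(𝕜, E) (fun x => mvfderiv 𝓘(𝕜, E) f x (X x)) y (Y y) := by
  have hy := mem_extChartAt_source (I := 𝓘(𝕜, E)) y
  have hf' := (contMDiffAt_iff_analyticAt_comp_symm hy).1 hf
  have hX' := hX.inChart hy
  have hY' := hY.inChart hy
  have hd : ∀ Z : VField 𝕜 E M, ∀ᶠ x in 𝓝 y, mvfderiv 𝓘(𝕜, E) f x (Z x) =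
      (fun z => fderiv 𝕜 (f ∘ (extChartAt 𝓘(𝕜, E) y).symm) z (Z.inChart y z))
        (extChartAt 𝓘(𝕜, E) y x) := by
    intro Z
    filter_upwards [hf.eventually, eventually_mem_extChartAt_source 𝕜 hy] with x h1 hx
    rw [mvfderiv_eq_fderiv hx h1.mdifferentiableAt, Z.inChart_apply hx]
  rw [mvfderiv_of_inChart hy (analyticAt_clm_apply hf'.fderiv hY') (hd Y),
    mvfderiv_of_inChart hy (analyticAt_clm_apply hf'.fderiv hX') (hd X),
    mvfderiv_eq_fderiv hy hf.mdifferentiableAt, ← VField.inChart_apply _ hy,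
    ← VField.inChart_apply _ hy, ← VField.inChart_apply _ hy, mlieBracket_inChart hX hY hy,
    fderiv_clm_apply hf'.fderiv.differentiableAt hY'.differentiableAt,
    fderiv_clm_apply hf'.fderiv.differentiableAt hX'.differentiableAt]
  have hsymm := (analyticAt_iff_contDiffAt.1 hf').isSymmSndFDerivAt (by simp)
  have := hsymm (X.inChart y (extChartAt 𝓘(𝕜, E) y y)) (Y.inChart y (extChartAt 𝓘(𝕜, E) y y))
  simp only [VectorField.lieBracket, map_sub, add_apply,
    ContinuousLinearMap.comp_apply, ContinuousLinearMap.flip_apply, this]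
  ring

/-- Cartan's formula for the exterior derivative of a 1-form. -/
lemma Form.d_one_apply {η : Form 𝕜 E M 1} {X Y : VField 𝕜 E M} (hη : η.AnalyticAt y)
    (hX : X.AnalyticAt y) (hY : Y.AnalyticAt y) :
    η.d y ![X y, Y y] = mvfderiv 𝓘(𝕜, E) (fun x => η x ![Y x]) y (X y) -
      mvfderiv 𝓘(𝕜, E) (fun x => η x ![X x]) y (Y y) -
        η y ![VectorField.mlieBracket 𝓘(𝕜, E) X Y y] := by
  have hy := mem_extChartAt_source (I := 𝓘(𝕜, E)) y
  have hη' : _root_.AnalyticAt 𝕜 (η.inChart y) (extChartAt 𝓘(𝕜, E) y y) := hη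
  have hX' := hX.inChart hy
  have hY' := hY.inChart hy
  have hval : ∀ Z : VField 𝕜 E M, ∀ x ∈ (extChartAt 𝓘(𝕜, E) y).source, η x ![Z x] =
      η.inChart y (extChartAt 𝓘(𝕜, E) y x)
        (fun a => (fun _ z => Z.inChart y z : Fin 1 → E → E) a (extChartAt 𝓘(𝕜, E) y x)) := by
    intro Z x hx
    have := Form.inChart_apply_inChart η (fun _ => Z) hx
    rw [this]
    congr 1
    funext i
    rw [Subsingleton.elim i 0]; rfl
  have hder : ∀ Z : VField 𝕜 E M, Z.AnalyticAt y → ∀ w, mvfderiv 𝓘(𝕜, E) (fun x => η x ![Z x]) y w =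
      fderiv 𝕜 (η.inChart y) (extChartAt 𝓘(𝕜, E) y y) (chartPull 𝕜 y y w)
        (fun _ => Z.inChart y (extChartAt 𝓘(𝕜, E) y y)) + η.inChart y (extChartAt 𝓘(𝕜, E) y y)
        (fun _ => fderiv 𝕜 (Z.inChart y) (extChartAt 𝓘(𝕜, E) y y) (chartPull 𝕜 y y w)) := by
    intro Z hZ w
    have hZ' := hZ.inChart hy
    rw [mvfderiv_of_inChart hy (analyticAt_apply (w := fun _ z => Z.inChart y z) hη' fun _ => hZ')
      ((eventually_mem_extChartAt_source 𝕜 hy).mono fun x hx => hval Z x hx),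
      fderiv_continuousAlternatingMap_apply_apply hη'.differentiableAt
        (fun _ => hZ'.differentiableAt)]
    rw [Fin.sum_univ_one]
    congr 2
    funext a
    rw [Subsingleton.elim a 0, Function.update_self]
  have hbr : η y ![VectorField.mlieBracket 𝓘(𝕜, E) X Y y] =
      η.inChart y (extChartAt 𝓘(𝕜, E) y y) (fun _ => VectorField.lieBracket 𝕜 (X.inChart y)
        (Y.inChart y) (extChartAt 𝓘(𝕜, E) y y)) :=
    (hval _ y hy).trans (congrArg (fun u : E => η.inChart y (extChartAt 𝓘(𝕜, E) y y) fun _ => u)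
      (mlieBracket_inChart hX hY hy))
  rw [hder X hX, hder Y hY, hbr,
    Form.d_eq_extDeriv hy hη'.differentiableAt, extDeriv_apply hη'.differentiableAt]
  simp only [← VField.inChart_apply _ hy]
  set z := extChartAt 𝓘(𝕜, E) y y
  rw [Fin.sum_univ_two, fderiv_continuousAlternatingMap_apply_const_apply hη'.differentiableAt,
    fderiv_continuousAlternatingMap_apply_const_apply hη'.differentiableAt]
  have e0 : ((0 : Fin 2).removeNth fun i => chartPull 𝕜 y y (![X y, Y y] i)) =
      fun _ => Y.inChart y z := by
    funext a
    rw [Subsingleton.elim a 0]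
    exact (VField.inChart_apply Y hy).symm
  have e1 : ((1 : Fin 2).removeNth fun i => chartPull 𝕜 y y (![X y, Y y] i)) =
      fun _ => X.inChart y z := by
    funext a
    rw [Subsingleton.elim a 0]
    exact (VField.inChart_apply X hy).symm
  rw [e0, e1]
  have e2 : chartPull 𝕜 y y (![X y, Y y] 0) = X.inChart y z := (VField.inChart_apply X hy).symm
  have e3 : chartPull 𝕜 y y (![X y, Y y] 1) = Y.inChart y z := (VField.inChart_apply Y hy).symm
  rw [e2, e3]
  have e4 : η.inChart y z (fun _ => VectorField.lieBracket 𝕜 (X.inChart y) (Y.inChart y) z) =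
      η.inChart y z (fun _ => fderiv 𝕜 (Y.inChart y) z (X.inChart y z)) -
        η.inChart y z (fun _ => fderiv 𝕜 (X.inChart y) z (Y.inChart y z)) := by
    have := (η.inChart y z).toContinuousMultilinearMap.map_update_sub (fun _ => 0) 0
      (fderiv 𝕜 (Y.inChart y) z (X.inChart y z)) (fderiv 𝕜 (X.inChart y) z (Y.inChart y z))
    have hu : ∀ u : E, Function.update (fun _ : Fin 1 => (0 : E)) 0 u = fun _ => u := by
      intro u; funext a; rw [Subsingleton.elim a 0, Function.update_self]
    rw [hu, hu, hu] at this
    exact this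
  rw [e4]
  simp
  ring

end Calculus

/-! ### The volume form of a frame and the divergence -/

section Volume

variable {𝕜 : Type*} [RCLike 𝕜]
  {E : Type*} [NormedAddCommGroup E] [NormedSpace 𝕜 E] [FiniteDimensional 𝕜 E] [CompleteSpace E]
  {M : Type*} [TopologicalSpace M] [ChartedSpace E M] {n m p : ℕ}

/-- The volume form `α₁ ∧ ⋯ ∧ αₙ` of a frame. -/
def volumeForm (v : Fin n → VField 𝕜 E M) : Form 𝕜 E M n := fun x =>
  wedge fun i => dualCoframe v i x

lemma volumeForm_apply (v : Fin n → VField 𝕜 E M) (x : M) (w : Fin n → TangentSpace 𝓘(𝕜, E) x) :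
    volumeForm v x w = (Matrix.of fun i j => dualCoframe v j x (w i)).det := rfl

variable {y : M}

lemma volumeForm_update {v : Fin n → VField 𝕜 E M} (hi : LinearIndependent 𝕜 (fun i => v i y))
    (hn : n = Module.finrank 𝕜 E) (i : Fin n) (w : TangentSpace 𝓘(𝕜, E) y) :
    volumeForm v y (Function.update (fun i => v i y) i w) = dualCoframe v i y w := by
  rw [volumeForm_apply]
  have : (Matrix.of fun a b => dualCoframe v b y (Function.update (fun i => v i y) i w a)) =
      (1 : Matrix (Fin n) (Fin n) 𝕜).updateRow i (fun b => dualCoframe v b y w) := by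
    ext a b
    rw [Matrix.of_apply]
    by_cases h : a = i
    · subst h
      rw [Matrix.updateRow_self, Function.update_self]
    · rw [Matrix.updateRow_ne h, Function.update_of_ne h, dualCoframe_apply_self hi hn,
        Matrix.one_apply]
      simp only [eq_comm]
  rw [this, ← Matrix.cramer_transpose_apply, Matrix.transpose_one, Matrix.cramer_one]
  rfl

lemma volumeForm_self {v : Fin n → VField 𝕜 E M} (hi : LinearIndependent 𝕜 (fun i => v i y))
    (hn : n = Module.finrank 𝕜 E) : volumeForm v y (fun i => v i y) = 1 := by
  rw [volumeForm_apply]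
  have : (Matrix.of fun a b => dualCoframe v b y (v a y)) = (1 : Matrix (Fin n) (Fin n) 𝕜) := by
    ext a b
    rw [Matrix.of_apply, dualCoframe_apply_self hi hn, Matrix.one_apply]
    simp only [eq_comm]
  rw [this, Matrix.det_one]

variable [IsManifold 𝓘(𝕜, E) ω M]

lemma IsFrameAt.volumeForm_analyticAt {v : Fin n → VField 𝕜 E M} (hv : IsFrameAt v y) :
    (volumeForm v).AnalyticAt y := by
  refine hv.analyticAt_iff.2 fun r => ?_
  have hc : FunAnalyticAt 𝕜 E (fun _ : M =>
      (Matrix.of fun a b : Fin n => if b = r a then (1 : 𝕜) else 0).det) y := contMDiffAt_const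
  refine ContMDiffAt.congr_of_eventuallyEq hc ?_
  filter_upwards [hv.eventually] with x hx
  rw [volumeForm_apply]
  congr 1
  ext a b
  rw [Matrix.of_apply, Matrix.of_apply, dualCoframe_apply_self hx.linearIndependent hx.card_eq]

/-- Alternating forms which agree on the vectors of a frame are equal. -/
lemma IsFrameAt.ext {v : Fin n → VField 𝕜 E M} (hv : IsFrameAt v y)
    {η θ : (TangentSpace 𝓘(𝕜, E) y) [⋀^Fin p]→L[𝕜] 𝕜}
    (h : ∀ r : Fin p → Fin n, Function.Injective r →
      η (fun a => v (r a) y) = θ (fun a => v (r a) y)) : η = θ := by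
  have : Fintype.card (Fin n) = Module.finrank 𝕜 (TangentSpace 𝓘(𝕜, E) y) := by
    rw [Fintype.card_fin]; exact hv.card_eq
  rcases Nat.eq_zero_or_pos n with rfl | hn
  · refine ContinuousAlternatingMap.toAlternatingMap_injective
      (Module.Basis.ext_alternating (Module.Basis.mk hv.linearIndependent ?_) fun r hr => ?_)
    · have h0 : Module.finrank 𝕜 (TangentSpace 𝓘(𝕜, E) y) = 0 := this.symm
      have := Module.finrank_zero_iff.1 h0
      intro x _
      rw [Subsingleton.elim x 0]; exact zero_mem _
    · simpa using h r hr
  · have : Nonempty (Fin n) := ⟨⟨0, hn⟩⟩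
    refine ContinuousAlternatingMap.toAlternatingMap_injective
      (Module.Basis.ext_alternating
        (basisOfLinearIndependentOfCardEqFinrank hv.linearIndependent ‹_›) fun r hr => ?_)
    simpa using h r hr

/-- A form of top degree which vanishes on a frame is zero. -/
lemma IsFrameAt.eq_zero_of_apply {v : Fin n → VField 𝕜 E M} (hv : IsFrameAt v y)
    {η : (TangentSpace 𝓘(𝕜, E) y) [⋀^Fin n]→L[𝕜] 𝕜} (h : η (fun a => v a y) = 0) : η = 0 := by
  refine hv.ext fun r hr => ?_
  have := η.toAlternatingMap.map_perm (fun a => v a y)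
    (Equiv.ofBijective r (Finite.injective_iff_bijective.1 hr))
  have h2 : η (fun a => v (r a) y) =
      Equiv.Perm.sign (Equiv.ofBijective r (Finite.injective_iff_bijective.1 hr)) •
        η (fun a => v a y) := this
  rw [h2, h, smul_zero]; rfl

lemma VField.AnalyticAt.smul {f : M → 𝕜} {Z : VField 𝕜 E M} (hZ : Z.AnalyticAt y)
    (hf : FunAnalyticAt 𝕜 E f y) : VField.AnalyticAt (fun x => f x • Z x) y := by
  have := VField.AnalyticAt.sum_smul (ι := Fin 1) (c := fun _ => f) (X := fun _ => Z)
    (fun _ => hf) (fun _ => hZ)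
  simp only [Fin.sum_univ_one] at this
  exact this

/-- The divergence of the vector field `Z`, for the volume form of a frame. -/
lemma IsFrameAt.d_interiorProduct_volumeForm {v : Fin (m + 1) → VField 𝕜 E M} (hv : IsFrameAt v y)
    {Z : VField 𝕜 E M} (hZ : Z.AnalyticAt y) :
    (interiorProduct Z (volumeForm v)).d y (fun i => v i y) =
      ∑ i, dualCoframe v i y (VectorField.mlieBracket 𝓘(𝕜, E) (v i) Z y) := by
  have hy := mem_extChartAt_source (I := 𝓘(𝕜, E)) y
  set z := extChartAt 𝓘(𝕜, E) y y with hz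
  have hμ : _root_.AnalyticAt 𝕜 ((volumeForm v).inChart y) z := hv.volumeForm_analyticAt
  have hV : ∀ i, _root_.AnalyticAt 𝕜 ((v i).inChart y) z := fun i => (hv.analytic i).inChart hy
  have hZ' : _root_.AnalyticAt 𝕜 (Z.inChart y) z := hZ.inChart hy
  have hev : (interiorProduct Z (volumeForm v)).inChart y =ᶠ[𝓝 z]
      fun u => interiorAt (Z.inChart y u) ((volumeForm v).inChart y u) := by
    refine eventually_nhds_extChartAt 𝕜 hy ?_
    filter_upwards [eventually_mem_extChartAt_source 𝕜 hy] with x hx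
    ext w
    rw [Form.inChart_apply _ hx]
    have h1 := Form.inChart_apply (volumeForm v) hx
      (Matrix.vecCons (Z.inChart y (extChartAt 𝓘(𝕜, E) y x)) w)
    refine Eq.trans ?_ h1.symm
    change volumeForm v x (Matrix.vecCons (Z x) fun i => chartPush 𝕜 y x (w i)) = _
    congr 1
    funext i
    refine Fin.cases ?_ (fun i => rfl) i
    change Z x = chartPush 𝕜 y x (Z.inChart y (extChartAt 𝓘(𝕜, E) y x))
    rw [Z.inChart_apply hx, chartPush_chartPull hx]
  have hc : ∀ᶠ u in 𝓝 z, (volumeForm v).inChart y u (fun i => (v i).inChart y u) = 1 := by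
    refine eventually_nhds_extChartAt 𝕜 hy ?_
    filter_upwards [eventually_mem_extChartAt_source 𝕜 hy, hv.eventually] with x hx hvx
    exact (Form.inChart_apply_inChart _ v hx).trans
      (volumeForm_self hvx.linearIndependent hvx.card_eq)
  have hcZ : Z.inChart y z = ∑ j, dualCoframe v j y (Z y) • (v j).inChart y z := by
    have h1 := congrArg (chartPull 𝕜 y y)
      (sum_dualCoframe_smul hv.linearIndependent hv.card_eq (Z y))
    rw [map_sum] at h1
    refine (Z.inChart_apply hy).trans (h1.symm.trans (Finset.sum_congr rfl fun j _ => ?_))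
    exact (map_smul _ _ _).trans (congrArg (fun u : E => dualCoframe v j y (Z y) • u)
      ((v j).inChart_apply hy).symm)
  have hd := extDeriv_interiorAt hμ (fun i => (hV i).differentiableAt) hZ' hc hcZ
  have hda : DifferentiableAt 𝕜 ((interiorProduct Z (volumeForm v)).inChart y) z :=
    ((analyticAt_interiorAt hZ' hμ).congr hev.symm).differentiableAt
  rw [Form.d_eq_extDeriv hy hda, hev.extDeriv_eq]
  refine Eq.trans ?_ (hd.trans (Finset.sum_congr rfl fun i _ => ?_))
  · congr 1
    funext i
    exact ((v i).inChart_apply hy).symm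
  · refine (Form.inChart_apply _ hy _).trans ?_
    rw [← volumeForm_update hv.linearIndependent hv.card_eq]
    congr 1
    funext a
    by_cases h : a = i
    · subst h
      rw [Function.update_self, Function.update_self]
      have := mlieBracket_inChart (hv.analytic a) hZ hy
      rw [VField.inChart_apply _ hy] at this
      exact (congrArg (chartPush 𝕜 y y) this.symm).trans (chartPush_chartPull hy _)
    · rw [Function.update_of_ne h, Function.update_of_ne h]
      exact (congrArg (chartPush 𝕜 y y) ((v a).inChart_apply hy)).trans (chartPush_chartPull hy _)

lemma IsFrameAt.d_smul_interiorProduct_volumeForm {v : Fin (m + 1) → VField 𝕜 E M}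
    (hv : IsFrameAt v y) {f : M → 𝕜} {Z : VField 𝕜 E M} (hf : FunAnalyticAt 𝕜 E f y)
    (hZ : Z.AnalyticAt y) :
    Form.d (fun x => f x • interiorProduct Z (volumeForm v) x) y (fun i => v i y) =
      mvfderiv 𝓘(𝕜, E) f y (Z y) +
        f y * ∑ i, dualCoframe v i y (VectorField.mlieBracket 𝓘(𝕜, E) (v i) Z y) := by
  have hfZ : VField.AnalyticAt (f • Z) y := hZ.smul hf
  have h1 : (fun x => f x • interiorProduct Z (volumeForm v) x) =
      interiorProduct (f • Z) (volumeForm v) := by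
    funext x
    ext w
    exact (DFunLike.congr_fun
      ((volumeForm v x).toAlternatingMap.curryLeft.map_smul (f x) (Z x)) w).symm
  rw [h1, hv.d_interiorProduct_volumeForm hfZ]
  have h2 : ∀ i, dualCoframe v i y (VectorField.mlieBracket 𝓘(𝕜, E) (v i) (f • Z) y) =
      mvfderiv 𝓘(𝕜, E) f y (dualCoframe v i y (Z y) • v i y) +
        f y * dualCoframe v i y (VectorField.mlieBracket 𝓘(𝕜, E) (v i) Z y) := by
    intro i
    refine (congrArg (dualCoframe v i y) (VectorField.mlieBracket_smul_right
      hf.mdifferentiableAt hZ.mdifferentiableAt)).trans ?_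
    rw [map_add, map_smul, map_smul, map_smul, smul_eq_mul, smul_eq_mul, smul_eq_mul, mul_comm]
  rw [Finset.sum_congr rfl fun i _ => h2 i, Finset.sum_add_distrib, ← Finset.mul_sum, ← map_sum,
    sum_dualCoframe_smul hv.linearIndependent hv.card_eq]

end Volume

/-! ### Closed 1-forms, linear differential equations, unique continuation -/

section LocalExistence

variable {𝕜 : Type*} [RCLike 𝕜]
  {E : Type*} [NormedAddCommGroup E] [NormedSpace 𝕜 E] [FiniteDimensional 𝕜 E] [CompleteSpace E]
  {M : Type*} [TopologicalSpace M] [ChartedSpace E M] [IsManifold 𝓘(𝕜, E) ω M] {y : M}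

/-- The covector field `θ` read in the chart at `y`. -/
def CovectorField.inChart (θ : CovectorField 𝕜 E M) (y : M) (z : E) : E →L[𝕜] 𝕜 :=
  (ContinuousAlternatingMap.ofSubsingletonLIE (𝕜 := 𝕜) (E := E) (F := 𝕜) (0 : Fin 1)).symm
    (θ.toForm.inChart y z)

lemma CovectorField.inChart_apply (θ : CovectorField 𝕜 E M) {x : M}
    (hx : x ∈ (extChartAt 𝓘(𝕜, E) y).source) (w : E) :
    θ.inChart y (extChartAt 𝓘(𝕜, E) y x) w = θ x (chartPush 𝕜 y x w) :=
  Form.inChart_apply θ.toForm hx fun _ => w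

lemma CovectorField.analyticAt_inChart {θ : CovectorField 𝕜 E M} (hθ : θ.toForm.AnalyticAt y) :
    AnalyticAt 𝕜 (θ.inChart y) (extChartAt 𝓘(𝕜, E) y y) :=
  (ContinuousLinearEquiv.analyticAt
    (ContinuousAlternatingMap.ofSubsingletonLIE (𝕜 := 𝕜) (E := E) (F := 𝕜)
      (0 : Fin 1)).symm.toContinuousLinearEquiv _).comp hθ

lemma hasFDerivAt_inChart {f : M → 𝕜} {θ : CovectorField 𝕜 E M} {x : M}
    (hx : x ∈ (extChartAt 𝓘(𝕜, E) y).source) (hf : FunAnalyticAt 𝕜 E f x)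
    (h : mvfderiv 𝓘(𝕜, E) f x = θ x) :
    HasFDerivAt (f ∘ (extChartAt 𝓘(𝕜, E) y).symm) (θ.inChart y (extChartAt 𝓘(𝕜, E) y x))
      (extChartAt 𝓘(𝕜, E) y x) := by
  have h1 := ((contMDiffAt_iff_analyticAt_comp_symm hx).1 hf).differentiableAt.hasFDerivAt
  refine h1.congr_fderiv (ContinuousLinearMap.ext fun w => ?_)
  rw [θ.inChart_apply hx, ← h, mvfderiv_eq_fderiv hx hf.mdifferentiableAt, chartPull_chartPush hx]

/-- Poincaré's lemma. -/
lemma CovectorField.exists_primitive {θ : CovectorField 𝕜 E M} (hθ : θ.toForm.AnalyticAt y)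
    (h : ∀ᶠ x in 𝓝 y, θ.toForm.d x = 0) :
    ∃ g : M → 𝕜, ∀ᶠ x in 𝓝 y, FunAnalyticAt 𝕜 E g x ∧ mvfderiv 𝓘(𝕜, E) g x = θ x := by
  have hy := mem_extChartAt_source (I := 𝓘(𝕜, E)) y
  have ha := CovectorField.analyticAt_inChart hθ
  have hη : _root_.AnalyticAt 𝕜 (θ.toForm.inChart y) (extChartAt 𝓘(𝕜, E) y y) := hθ
  have hs : ∀ᶠ z in 𝓝 (extChartAt 𝓘(𝕜, E) y y), ∀ u v,
      fderiv 𝕜 (θ.inChart y) z u v = fderiv 𝕜 (θ.inChart y) z v u := by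
    refine eventually_nhds_extChartAt 𝕜 hy ?_
    filter_upwards [h, eventually_mem_extChartAt_source 𝕜 hy,
      eventually_of_extChartAt 𝕜 hy hη.eventually_analyticAt,
      eventually_of_extChartAt 𝕜 hy ha.eventually_analyticAt] with x h0 hx hηx hax u v
    have h1 := Form.d_eq_extDeriv hx hηx.differentiableAt ![chartPush 𝕜 y x u, chartPush 𝕜 y x v]
    rw [h0, extDeriv_apply hηx.differentiableAt, Fin.sum_univ_two] at h1
    have e : ∀ w : E, ∀ b : Fin 1 → E, b = (fun _ => w) →
        (fun z => θ.toForm.inChart y z b) = fun z => θ.inChart y z w := by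
      rintro w b rfl; rfl
    have e0 : chartPull 𝕜 y x (![chartPush 𝕜 y x u, chartPush 𝕜 y x v] 0) = u :=
      chartPull_chartPush hx u
    have e1 : chartPull 𝕜 y x (![chartPush 𝕜 y x u, chartPush 𝕜 y x v] 1) = v :=
      chartPull_chartPush hx v
    rw [e v _ (by funext a; rw [Subsingleton.elim a 0]; exact e1),
      e u _ (by funext a; rw [Subsingleton.elim a 0]; exact e0), e0, e1,
      fderiv_clm_apply hax.differentiableAt (differentiableAt_const _),
      fderiv_clm_apply hax.differentiableAt (differentiableAt_const _)] at h1
    simp at h1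
    have h2 : fderiv 𝕜 (θ.inChart y) (extChartAt 𝓘(𝕜, E) y x) u v +
      -(fderiv 𝕜 (θ.inChart y) (extChartAt 𝓘(𝕜, E) y x) v u) = 0 := h1.symm
    linear_combination h2
  obtain ⟨g, hga, hg⟩ := WebGeometry.exists_primitive ha hs
  refine ⟨g ∘ extChartAt 𝓘(𝕜, E) y, ?_⟩
  filter_upwards [eventually_mem_extChartAt_source 𝕜 hy, eventually_of_extChartAt 𝕜 hy hg,
    eventually_of_extChartAt 𝕜 hy hga.eventually_analyticAt] with x hx hgx hgax
  refine ⟨funAnalyticAt_of_inChart hx hgax (Eventually.of_forall fun _ => rfl), ?_⟩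
  ext w
  refine (mvfderiv_of_inChart hx hgax (Eventually.of_forall fun _ => rfl) w).trans ?_
  rw [hgx.fderiv,
    θ.inChart_apply hx, chartPush_chartPull hx]

/-- A solution of `df + f θ = 0` which vanishes at a point vanishes near this point. -/
lemma eventually_eq_zero_of_mvfderiv_add_eq_zero {f : M → 𝕜} {θ : CovectorField 𝕜 E M}
    (hθ : θ.toForm.AnalyticAt y)
    (hf : ∀ᶠ x in 𝓝 y, FunAnalyticAt 𝕜 E f x ∧ mvfderiv 𝓘(𝕜, E) f x + f x • θ x = 0)
    (h0 : f y = 0) : ∀ᶠ x in 𝓝 y, f x = 0 := by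
  have hy := mem_extChartAt_source (I := 𝓘(𝕜, E)) y
  have ha := CovectorField.analyticAt_inChart hθ
  have h1 := eventually_eq_zero_of_fderiv_eq (f := f ∘ (extChartAt 𝓘(𝕜, E) y).symm)
    (b := fun z => -θ.inChart y z) ha.neg.continuousAt ?_
    (by rw [Function.comp_apply, extChartAt_to_inv]; exact h0)
  · filter_upwards [eventually_of_extChartAt 𝕜 hy h1, eventually_mem_extChartAt_source 𝕜 hy]
      with x hx hxs
    rwa [Function.comp_apply, (extChartAt 𝓘(𝕜, E) y).left_inv hxs] at hx
  · refine eventually_nhds_extChartAt 𝕜 hy ?_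
    filter_upwards [hf, eventually_mem_extChartAt_source 𝕜 hy] with x hx hxs
    have := hasFDerivAt_inChart (θ := fun x => mvfderiv 𝓘(𝕜, E) f x) hxs hx.1 rfl
    refine this.congr_fderiv (ContinuousLinearMap.ext fun w => ?_)
    rw [CovectorField.inChart_apply _ hxs, eq_neg_of_add_eq_zero_left hx.2, Function.comp_apply,
      (extChartAt 𝓘(𝕜, E) y).left_inv hxs]
    change -(f x * θ x (chartPush 𝕜 y x w)) = f x * -(θ.inChart y (extChartAt 𝓘(𝕜, E) y x) w)
    rw [CovectorField.inChart_apply _ hxs, mul_neg]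

/-- The identity theorem for analytic forms. -/
lemma Form.AnalyticAt.eventually_eq_zero {p : ℕ} {η : Form 𝕜 E M p} (hη : η.AnalyticAt y)
    (h : ∃ᶠ x in 𝓝 y, ∀ᶠ z in 𝓝 x, η z = 0) : ∀ᶠ x in 𝓝 y, η x = 0 := by
  have hy := mem_extChartAt_source (I := 𝓘(𝕜, E)) y
  have hη' : _root_.AnalyticAt 𝕜 (η.inChart y) (extChartAt 𝓘(𝕜, E) y y) := hη
  obtain ⟨ε, hε, hball⟩ := Metric.eventually_nhds_iff_ball.1 hη'.eventually_analyticAt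
  obtain ⟨x, hx, hxs, hxb⟩ := (h.and_eventually ((eventually_mem_extChartAt_source 𝕜 hy).and
    (eventually_of_extChartAt 𝕜 hy (Metric.ball_mem_nhds _ hε)))).exists
  let _ : NormedSpace ℝ E := NormedSpace.restrictScalars ℝ 𝕜 E
  have h1 : η.inChart y =ᶠ[𝓝 (extChartAt 𝓘(𝕜, E) y x)] 0 := by
    refine eventually_nhds_extChartAt 𝕜 hxs ?_
    filter_upwards [hx, eventually_mem_extChartAt_source 𝕜 hxs] with z hz hzs
    ext w
    rw [Form.inChart_apply _ hzs, hz]; rfl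
  have h2 := AnalyticOnNhd.eqOn_zero_of_preconnected_of_eventuallyEq_zero
    (fun z hz => hball z hz) (convex_ball _ ε).isPreconnected hxb h1
  filter_upwards [eventually_mem_extChartAt_source 𝕜 hy,
    eventually_of_extChartAt 𝕜 hy (Metric.ball_mem_nhds _ hε)] with z hzs hzb
  ext w
  have h3 := Form.inChart_apply η hzs fun i => chartPull 𝕜 y z (w i)
  have h4 : η.inChart y (extChartAt 𝓘(𝕜, E) y z) = 0 := h2 hzb
  rw [h4] at h3
  refine Eq.trans ?_ (h3.symm.trans rfl)
  congr 1
  funext i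
  exact (chartPush_chartPull hzs _).symm

end LocalExistence

/-! ### Alternating forms of degree `n` and `n - 1` in dimension `n` -/

section Algebra

variable {𝕜 : Type*} [RCLike 𝕜] {T : Type*} [AddCommGroup T] [Module 𝕜 T] [TopologicalSpace T]
  {p : ℕ}

lemma interiorAt_apply (v : T) (η : T [⋀^Fin (p + 1)]→L[𝕜] 𝕜) (w : Fin p → T) :
    interiorAt v η w = η (Matrix.vecCons v w) := rfl

lemma interiorAt_smul (c : 𝕜) (v : T) (η : T [⋀^Fin (p + 1)]→L[𝕜] 𝕜) :
    interiorAt (c • v) η = c • interiorAt v η := by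
  ext w
  exact DFunLike.congr_fun (η.toAlternatingMap.curryLeft.map_smul c v) w

lemma interiorAt_sum {ι : Type*} (s : Finset ι) (v : ι → T) (η : T [⋀^Fin (p + 1)]→L[𝕜] 𝕜) :
    interiorAt (∑ i ∈ s, v i) η = ∑ i ∈ s, interiorAt (v i) η := by
  ext w
  rw [ContinuousAlternatingMap.sum_apply]
  let ev : (T [⋀^Fin p]→ₗ[𝕜] 𝕜) →ₗ[𝕜] 𝕜 :=
    { toFun := fun θ => θ w, map_add' := fun _ _ => rfl, map_smul' := fun _ _ => rfl }
  exact map_sum (ev ∘ₗ η.toAlternatingMap.curryLeft) v s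

lemma interiorAt_neg (v : T) (η : T [⋀^Fin (p + 1)]→L[𝕜] 𝕜) :
    interiorAt (-v) η = -interiorAt v η := by
  ext w
  exact DFunLike.congr_fun (map_neg η.toAlternatingMap.curryLeft v) w

lemma interiorAt_self (v : T) (η : T [⋀^Fin (p + 2)]→L[𝕜] 𝕜) : interiorAt v (interiorAt v η) = 0 := by
  ext w
  exact η.map_eq_zero_of_eq (i := 0) (j := 1) _ rfl (by simp)

lemma apply_eq_zero_of_interiorAt_eq_zero {v : T} {η : T [⋀^Fin (p + 1)]→L[𝕜] 𝕜}
    (h : interiorAt v η = 0) {u : Fin (p + 1) → T} {j : Fin (p + 1)} (hu : u j = v) : η u = 0 := by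
  have h1 : η (u ∘ Equiv.swap 0 j) = 0 := by
    have h2 := DFunLike.congr_fun h (fun a => u (Equiv.swap 0 j a.succ))
    refine Eq.trans ?_ h2
    rw [interiorAt_apply]
    congr 1
    funext a
    refine Fin.cases ?_ (fun a => rfl) a
    change u (Equiv.swap 0 j 0) = v
    rw [Equiv.swap_apply_left, hu]
  have h3 := η.toAlternatingMap.map_perm u (Equiv.swap 0 j)
  have h4 : η (u ∘ Equiv.swap 0 j) = Equiv.Perm.sign (Equiv.swap 0 j) • η u := h3
  rw [h1] at h4
  exact ((smul_eq_zero_iff_eq _).1 h4.symm)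

/-- If `u` is a basis, a form `η` of codegree 1 with `ι_{uⱼ} η = 0` is determined by its value on the
other vectors of the basis. -/
lemma eq_zero_of_interiorAt_eq_zero {u : Fin (p + 2) → T} (hu : LinearIndependent 𝕜 u)
    (hn : p + 2 = Module.finrank 𝕜 T) {j : Fin (p + 2)} {η : T [⋀^Fin (p + 1)]→L[𝕜] 𝕜}
    (h : interiorAt (u j) η = 0) (h0 : η (fun a => u (j.succAbove a)) = 0) : η = 0 := by
  refine ContinuousAlternatingMap.toAlternatingMap_injective
      (Module.Basis.ext_alternating (basisOfLinearIndependentOfCardEqFinrank hu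
        (by rw [Fintype.card_fin]; exact hn)) fun r hr => ?_)
  rw [coe_basisOfLinearIndependentOfCardEqFinrank]
  change η (fun a => u (r a)) = 0
  by_cases hj : ∃ a, r a = j
  · obtain ⟨a, ha⟩ := hj
    exact apply_eq_zero_of_interiorAt_eq_zero h (j := a) (by rw [ha])
  · push Not at hj
    choose s hs using fun a => Fin.exists_succAbove_eq (hj a)
    have hsi : Function.Injective s := fun a b hab => hr (by rw [← hs a, ← hs b, hab])
    have h3 := η.toAlternatingMap.map_perm (fun a => u (j.succAbove a))
      (Equiv.ofBijective s (Finite.injective_iff_bijective.1 hsi))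
    have h4 : η (fun a => u (j.succAbove (s a))) =
      Equiv.Perm.sign (Equiv.ofBijective s (Finite.injective_iff_bijective.1 hsi)) •
        η (fun a => u (j.succAbove a)) := h3
    rw [h0, smul_zero] at h4
    simpa only [hs] using h4

end Algebra

section Pointwise

variable {𝕜 : Type*} [RCLike 𝕜]
  {E : Type*} [NormedAddCommGroup E] [NormedSpace 𝕜 E] [FiniteDimensional 𝕜 E] [CompleteSpace E]
  {M : Type*} [TopologicalSpace M] [ChartedSpace E M] {y : M} {m p : ℕ}

lemma eq_smul_volumeForm {n : ℕ} {v : Fin n → VField 𝕜 E M}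
    (hi : LinearIndependent 𝕜 (fun i => v i y)) (hn : n = Module.finrank 𝕜 E)
    (θ : (TangentSpace 𝓘(𝕜, E) y) [⋀^Fin n]→L[𝕜] 𝕜) :
    θ = θ (fun i => v i y) • volumeForm v y := by
  refine ContinuousAlternatingMap.toAlternatingMap_injective
      (Module.Basis.ext_alternating (basisOfLinearIndependentOfCardEqFinrank' _ hi
        (by rw [Fintype.card_fin]; exact hn)) fun r hr => ?_)
  have h3 : ∀ θ : (TangentSpace 𝓘(𝕜, E) y) [⋀^Fin n]→L[𝕜] 𝕜, θ (fun a => v (r a) y) =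
      Equiv.Perm.sign (Equiv.ofBijective r (Finite.injective_iff_bijective.1 hr)) •
        θ (fun a => v a y) := fun θ =>
    θ.toAlternatingMap.map_perm (fun a => v a y)
      (Equiv.ofBijective r (Finite.injective_iff_bijective.1 hr))
  simp only [coe_basisOfLinearIndependentOfCardEqFinrank']
  refine (h3 θ).trans (Eq.trans ?_ (h3 (θ (fun i => v i y) • volumeForm v y)).symm)
  rw [ContinuousAlternatingMap.smul_apply, volumeForm_self hi hn, smul_eq_mul, mul_one]

/-- A nonzero vector is the member of a basis, obtained from `v` by replacing one vector. -/
lemma exists_dualCoframe_ne_zero {n : ℕ} {v : Fin n → VField 𝕜 E M}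
    (hi : LinearIndependent 𝕜 (fun i => v i y)) (hn : n = Module.finrank 𝕜 E)
    {w : TangentSpace 𝓘(𝕜, E) y} (hw : w ≠ 0) : ∃ j, dualCoframe v j y w ≠ 0 ∧
      LinearIndependent 𝕜 (Function.update (fun i => v i y) j w) := by
  by_contra! h
  have h0 : ∀ j, dualCoframe v j y w = 0 := by
    intro j
    by_contra hj
    refine h j hj ?_
    by_contra hd
    refine hj ?_
    rw [← volumeForm_update hi hn]
    exact (volumeForm v y).toAlternatingMap.map_linearDependent _ hd
  refine hw ?_
  rw [← sum_dualCoframe_smul hi hn w]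
  exact Finset.sum_eq_zero fun i _ => by rw [h0 i, zero_smul]

lemma eq_zero_of_interiorAt_top {v : Fin (m + 1) → VField 𝕜 E M}
    (hi : LinearIndependent 𝕜 (fun i => v i y)) (hn : m + 1 = Module.finrank 𝕜 E)
    {w : TangentSpace 𝓘(𝕜, E) y} (hw : w ≠ 0)
    {θ : (TangentSpace 𝓘(𝕜, E) y) [⋀^Fin (m + 1)]→L[𝕜] 𝕜} (h : interiorAt w θ = 0) : θ = 0 := by
  obtain ⟨j, hj, _⟩ := exists_dualCoframe_ne_zero hi hn hw
  have h1 := apply_eq_zero_of_interiorAt_eq_zero h (j := j)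
    (u := Function.update (fun i => v i y) j w) (Function.update_self ..)
  have h2 := eq_smul_volumeForm hi hn θ
  rw [h2, ContinuousAlternatingMap.smul_apply, volumeForm_update hi hn] at h1
  rw [h2, (mul_eq_zero.1 h1).resolve_right hj]
  exact zero_smul 𝕜 (volumeForm v y)

lemma interiorAt_volumeForm_ne_zero {v : Fin (m + 1) → VField 𝕜 E M}
    (hi : LinearIndependent 𝕜 (fun i => v i y)) (hn : m + 1 = Module.finrank 𝕜 E)
    {w : TangentSpace 𝓘(𝕜, E) y} (hw : w ≠ 0) : interiorAt w (volumeForm v y) ≠ 0 := by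
  intro h
  have h1 := volumeForm_self hi hn
  rw [eq_zero_of_interiorAt_top hi hn hw h] at h1
  exact zero_ne_one h1

/-- The forms of degree `n - 1` annihilated by a nonzero vector `w` are the multiples of the interior
product of `w` with the volume form. -/
lemma exists_eq_smul_interiorAt_volumeForm {v : Fin (p + 2) → VField 𝕜 E M}
    (hi : LinearIndependent 𝕜 (fun i => v i y)) (hn : p + 2 = Module.finrank 𝕜 E)
    {w : TangentSpace 𝓘(𝕜, E) y} (hw : w ≠ 0)
    {η : (TangentSpace 𝓘(𝕜, E) y) [⋀^Fin (p + 1)]→L[𝕜] 𝕜} (h : interiorAt w η = 0) :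
    ∃ g : 𝕜, η = g • interiorAt w (volumeForm v y) := by
  obtain ⟨j, hj, hu⟩ := exists_dualCoframe_ne_zero hi hn hw
  set u := Function.update (fun i => v i y) j w with hu'
  have huj : u j = w := Function.update_self ..
  set A := interiorAt w (volumeForm v y) with hA
  have hA0 : A (fun a => u (j.succAbove a)) ≠ 0 := by
    intro h0
    refine interiorAt_volumeForm_ne_zero hi hn hw (eq_zero_of_interiorAt_eq_zero hu hn (j := j) ?_ h0)
    rw [huj]
    exact interiorAt_self _ _
  refine ⟨η (fun a => u (j.succAbove a)) * (A (fun a => u (j.succAbove a)))⁻¹, ?_⟩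
  refine sub_eq_zero.1 (eq_zero_of_interiorAt_eq_zero hu hn (j := j) ?_ ?_)
  · rw [huj]
    ext b
    change η (Matrix.vecCons w b) - _ * A (Matrix.vecCons w b) = 0
    have e1 : η (Matrix.vecCons w b) = 0 := DFunLike.congr_fun h b
    have e2 : A (Matrix.vecCons w b) = 0 :=
      DFunLike.congr_fun (interiorAt_self w (volumeForm v y)) b
    rw [e1, e2, mul_zero, sub_zero]
  · change η _ - _ * A _ = 0
    rw [mul_assoc, inv_mul_cancel₀ hA0, mul_one, sub_self]

/-- `A_l = ι_{V_l} (α₁ ∧ ⋯ ∧ αₙ)` for all `l`, including the last one. -/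
lemma basicFamily_eq {V : Fin (m + 2) → VField 𝕜 E M}
    (hi : LinearIndependent 𝕜 (fun i : Fin (m + 1) => V i.castSucc y))
    (hn : m + 1 = Module.finrank 𝕜 E) (h0 : ∑ l, V l y = 0) (l : Fin (m + 2)) :
    basicFamily V l y = interiorAt (V l y) (volumeForm (fun i : Fin (m + 1) => V i.castSucc) y) := by
  set v : Fin (m + 1) → VField 𝕜 E M := fun i => V i.castSucc with hv
  have hA : ∀ i : Fin (m + 1), (-1 : 𝕜) ^ (i : ℕ) •
      (wedge fun j : Fin m => dualCoframe v (i.succAbove j) y) = interiorAt (v i y) (volumeForm v y) := by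
    intro i
    ext w
    change (-1 : 𝕜) ^ (i : ℕ) * (Matrix.of fun a b => dualCoframe v (i.succAbove b) y (w a)).det =
      (Matrix.of fun a b => dualCoframe v b y (Matrix.vecCons (v i y) w a)).det
    rw [Matrix.det_succ_row_zero, Finset.sum_eq_single i]
    · have e : (Matrix.of fun a b => dualCoframe v b y (Matrix.vecCons (v i y) w a)) 0 i = 1 := by
        rw [Matrix.of_apply]
        exact (dualCoframe_apply_self hi hn i i).trans (if_pos rfl)
      rw [e, mul_one]
      rfl
    · intro b _ hb
      have e : (Matrix.of fun a b => dualCoframe v b y (Matrix.vecCons (v i y) w a)) 0 b = 0 := by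
        rw [Matrix.of_apply]
        exact (dualCoframe_apply_self hi hn b i).trans (if_neg hb)
      rw [e, mul_zero, zero_mul]
    · simp
  refine Fin.lastCases ?_ (fun i => ?_) l
  · have h1 : V (Fin.last (m + 1)) y = -∑ i, v i y := by
      rw [Fin.sum_univ_castSucc] at h0
      exact eq_neg_of_add_eq_zero_right h0
    rw [h1, interiorAt_neg, interiorAt_sum]
    unfold basicFamily
    simp only [Fin.lastCases_last]
    rw [Finset.sum_congr rfl fun i _ => hA i]
  · unfold basicFamily
    simp only [Fin.lastCases_castSucc]
    exact hA i

end Pointwise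

/-! ### The 1-form of a family of vector fields with sum zero -/

section Adapted

variable {𝕜 : Type*} [RCLike 𝕜]
  {E : Type*} [NormedAddCommGroup E] [NormedSpace 𝕜 E] [FiniteDimensional 𝕜 E] [CompleteSpace E]
  {M : Type*} [TopologicalSpace M] [ChartedSpace E M] [IsManifold 𝓘(𝕜, E) ω M] {y : M} {m k : ℕ}

/-- Near `y`, the vector fields `V₁, …, Vₙ₊₁` are analytic with sum zero, and the first `n` of them
form a frame; the last one does not vanish either. -/
structure IsAdaptedAt (V : Fin (m + 2) → VField 𝕜 E M) (y : M) : Prop where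
  analytic : ∀ l, (V l).AnalyticAt y
  linearIndependent : LinearIndependent 𝕜 (fun i : Fin (m + 1) => V i.castSucc y)
  card_eq : m + 1 = Module.finrank 𝕜 E
  sum_eq_zero : ∀ᶠ x in 𝓝 y, ∑ l, V l x = 0
  ne_zero : V (Fin.last (m + 1)) y ≠ 0

namespace IsAdaptedAt

variable {V : Fin (m + 2) → VField 𝕜 E M}

lemma isFrameAt (hV : IsAdaptedAt V y) : IsFrameAt (fun i : Fin (m + 1) => V i.castSucc) y :=
  ⟨fun i => hV.analytic i.castSucc, hV.linearIndependent, hV.card_eq⟩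

lemma basicFamily_eq (hV : IsAdaptedAt V y) (l : Fin (m + 2)) : basicFamily V l y =
    interiorAt (V l y) (volumeForm (fun i : Fin (m + 1) => V i.castSucc) y) :=
  WebGeometry.basicFamily_eq hV.linearIndependent hV.card_eq hV.sum_eq_zero.self_of_nhds l

lemma apply_ne_zero (hV : IsAdaptedAt V y) (l : Fin (m + 2)) : V l y ≠ 0 :=
  Fin.lastCases hV.ne_zero (fun i => hV.linearIndependent.ne_zero i) l

lemma basicFamily_ne_zero (hV : IsAdaptedAt V y) (l : Fin (m + 2)) : basicFamily V l y ≠ 0 := by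
  rw [hV.basicFamily_eq]
  exact interiorAt_volumeForm_ne_zero hV.linearIndependent hV.card_eq (hV.apply_ne_zero l)

lemma eventually (hV : IsAdaptedAt V y) : ∀ᶠ x in 𝓝 y, IsAdaptedAt V x := by
  have h1 : ∀ᶠ x in 𝓝 y, ∀ l, (V l).AnalyticAt x :=
    eventually_all.2 fun l => (hV.analytic l).eventually
  have h2 : ∀ᶠ x in 𝓝 y, V (Fin.last (m + 1)) x ≠ 0 := by
    obtain ⟨j, hj, _⟩ := exists_dualCoframe_ne_zero hV.linearIndependent hV.card_eq hV.ne_zero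
    have h3 := (hV.isFrameAt.funAnalyticAt_dualCoframe (hV.analytic (Fin.last (m + 1))) j).continuousAt
    filter_upwards [h3.eventually_ne hj] with x hx h0
    refine hx ?_
    rw [h0, map_zero]
  filter_upwards [h1, hV.isFrameAt.eventually, hV.sum_eq_zero.eventually_nhds, h2] with x a b c d
  exact ⟨a, b.linearIndependent, b.card_eq, c, d⟩

lemma basicFamily_eventuallyEq (hV : IsAdaptedAt V y) (l : Fin (m + 2)) :
    ∀ᶠ x in 𝓝 y, basicFamily V l x =
      interiorProduct (V l) (volumeForm (fun i : Fin (m + 1) => V i.castSucc)) x :=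
  hV.eventually.mono fun _ hx => hx.basicFamily_eq l

end IsAdaptedAt

lemma Form.inChart_eventuallyEq {p : ℕ} {η θ : Form 𝕜 E M p} (h : ∀ᶠ x in 𝓝 y, η x = θ x) :
    η.inChart y =ᶠ[𝓝 (extChartAt 𝓘(𝕜, E) y y)] θ.inChart y := by
  have hy := mem_extChartAt_source (I := 𝓘(𝕜, E)) y
  refine eventually_nhds_extChartAt 𝕜 hy ?_
  filter_upwards [h, eventually_mem_extChartAt_source 𝕜 hy] with x hx hxs
  ext w
  rw [Form.inChart_apply _ hxs, Form.inChart_apply _ hxs, hx]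

lemma Form.d_congr {p : ℕ} {η θ : Form 𝕜 E M p} (h : ∀ᶠ x in 𝓝 y, η x = θ x) : η.d y = θ.d y := by
  unfold Form.d
  rw [(Form.inChart_eventuallyEq h).extDeriv_eq]

lemma Form.AnalyticAt.congr {p : ℕ} {η θ : Form 𝕜 E M p} (hη : η.AnalyticAt y)
    (h : ∀ᶠ x in 𝓝 y, η x = θ x) : θ.AnalyticAt y :=
  _root_.AnalyticAt.congr hη (Form.inChart_eventuallyEq h)

lemma Form.AnalyticAt.sum {p : ℕ} {ι : Type*} {s : Finset ι} {η : ι → Form 𝕜 E M p}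
    (h : ∀ i ∈ s, (η i).AnalyticAt y) : (∑ i ∈ s, η i).AnalyticAt y := by
  classical
  induction s using Finset.induction_on with
  | empty => exact Form.zero_analyticAt y
  | insert a s ha ih =>
    rw [Finset.sum_insert ha]
    exact (h a (Finset.mem_insert_self ..)).add (ih fun i hi => h i (Finset.mem_insert_of_mem hi))

lemma Form.d_sum {p : ℕ} {ι : Type*} {s : Finset ι} {η : ι → Form 𝕜 E M p}
    (h : ∀ i ∈ s, (η i).AnalyticAt y) : (∑ i ∈ s, η i).d y = ∑ i ∈ s, (η i).d y := by
  classical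
  induction s using Finset.induction_on with
  | empty => exact Form.d_eq_zero (Eventually.of_forall fun _ => rfl)
  | insert a s ha ih =>
    have hs : ∀ i ∈ s, (η i).AnalyticAt y := fun i hi => h i (Finset.mem_insert_of_mem hi)
    rw [Finset.sum_insert ha, Finset.sum_insert ha, ← ih hs]
    exact Form.d_add (h a (Finset.mem_insert_self ..)) (Form.AnalyticAt.sum hs)

lemma phi_eq {n : ℕ} (v : Fin n → VField 𝕜 E M) (i : Fin n) (x : M) :
    phi v i x = ∑ j, dualCoframe v j x (VectorField.mlieBracket 𝓘(𝕜, E) (v j) (v i) x) := by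
  have h : ∀ j, dualCoframe v j x (VectorField.mlieBracket 𝓘(𝕜, E) (v j) (v i) x) =
      (if j < i then structureCoeff v j i j x else 0) -
        (if i < j then structureCoeff v i j j x else 0) := by
    intro j
    rcases lt_trichotomy j i with h | h | h
    · rw [if_pos h, if_neg h.not_gt, sub_zero]; rfl
    · subst h
      rw [if_neg (lt_irrefl _), sub_zero, VectorField.mlieBracket_self]
      exact map_zero _
    · rw [if_neg h.not_gt, if_pos h, zero_sub]
      refine (congrArg (dualCoframe v j x) VectorField.mlieBracket_swap_apply).trans ?_
      exact map_neg _ _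
  rw [Finset.sum_congr rfl fun j _ => h j, Finset.sum_sub_distrib, ← Finset.sum_filter,
    ← Finset.sum_filter]
  rfl

namespace IsAdaptedAt

variable {V : Fin (m + 2) → VField 𝕜 E M}

lemma basicFamily_analyticAt {V : Fin (k + 3) → VField 𝕜 E M} (hV : IsAdaptedAt V y) {f : M → 𝕜}
    (hf : FunAnalyticAt 𝕜 E f y) (l : Fin (k + 3)) :
    Form.AnalyticAt (fun x => f x • basicFamily V l x) y := by
  refine hV.isFrameAt.analyticAt_iff.2 fun r => ?_
  have h1 := hV.isFrameAt.volumeForm_analyticAt.apply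
    (X := Matrix.vecCons (V l) fun a => V (r a).castSucc)
    (fun a => Fin.cases (hV.analytic l) (fun a => hV.analytic _) a)
  refine ContMDiffAt.congr_of_eventuallyEq (hf.mul h1) ?_
  filter_upwards [hV.basicFamily_eventuallyEq l] with x hx
  rw [hx]
  refine congrArg (fun c : 𝕜 => f x * c) (congrArg
    (volumeForm (fun i : Fin (k + 2) => V i.castSucc) x) (funext fun a => ?_))
  exact Fin.cases rfl (fun _ => rfl) a

lemma omega_apply_castSucc (hV : IsAdaptedAt V y) (i : Fin (m + 1)) :
    omega V y (V i.castSucc y) = ∑ j : Fin (m + 1),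
      dualCoframe (fun j : Fin (m + 1) => V j.castSucc) j y
        (VectorField.mlieBracket 𝓘(𝕜, E) (V j.castSucc) (V i.castSucc) y) := by
  refine Eq.trans ?_ (phi_eq (fun j : Fin (m + 1) => V j.castSucc) i y)
  change (∑ a : Fin (m + 1), _ • _ : TangentSpace 𝓘(𝕜, E) y →L[𝕜] 𝕜) _ = _
  rw [sum_apply, Finset.sum_eq_single i]
  · rw [smul_apply]
    have := (dualCoframe_apply_self hV.linearIndependent hV.card_eq i i).trans (if_pos rfl)
    exact (congrArg (fun c : 𝕜 => _ * c) this).trans (mul_one _)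
  · intro b _ hb
    have := (dualCoframe_apply_self hV.linearIndependent hV.card_eq b i).trans (if_neg hb)
    exact (congrArg (fun c : 𝕜 => _ * c) this).trans (mul_zero _)
  · simp

/-- `d (f A_l) (V₁, …, Vₙ) = (df + f ω) (V_l)`. -/
lemma d_smul_basicFamily {V : Fin (k + 3) → VField 𝕜 E M} (hV : IsAdaptedAt V y) {f : M → 𝕜}
    (hf : FunAnalyticAt 𝕜 E f y) (l : Fin (k + 3)) :
    Form.d (fun x => f x • basicFamily V l x) y (fun i : Fin (k + 2) => V i.castSucc y) =
      mvfderiv 𝓘(𝕜, E) f y (V l y) + f y * omega V y (V l y) := by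
  have hcast : ∀ i : Fin (k + 2),
      Form.d (fun x => f x • basicFamily V i.castSucc x) y (fun i : Fin (k + 2) => V i.castSucc y) =
        mvfderiv 𝓘(𝕜, E) f y (V i.castSucc y) + f y * omega V y (V i.castSucc y) := by
    intro i
    have h1 : Form.d (fun x => f x • basicFamily V i.castSucc x) y = Form.d (fun x => f x •
        interiorProduct (V i.castSucc) (volumeForm (fun i : Fin (k + 2) => V i.castSucc)) x) y :=
      Form.d_congr ((hV.basicFamily_eventuallyEq i.castSucc).mono fun x hx => by rw [hx])
    rw [h1, hV.omega_apply_castSucc]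
    exact hV.isFrameAt.d_smul_interiorProduct_volumeForm hf (hV.analytic _)
  refine Fin.lastCases ?_ hcast l
  -- the members of the family have sum zero, and so do the vector fields
  have h2 : (∑ l, fun x => f x • basicFamily V l x : Form 𝕜 E M (k + 1)).d y = 0 := by
    refine Form.d_eq_zero (hV.eventually.mono fun x hx => ?_)
    have e : (∑ l, fun x => f x • basicFamily V l x : Form 𝕜 E M (k + 1)) x =
        ∑ l, f x • basicFamily V l x := Finset.sum_apply _ _ _
    rw [e, ← Finset.smul_sum, Finset.sum_congr rfl fun l _ => hx.basicFamily_eq l, ← interiorAt_sum,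
      hx.sum_eq_zero.self_of_nhds]
    have : interiorAt (0 : TangentSpace 𝓘(𝕜, E) x)
        (volumeForm (fun i : Fin (k + 2) => V i.castSucc) x) = 0 := by
      ext w
      exact DFunLike.congr_fun (map_zero (volumeForm (fun i : Fin (k + 2) => V i.castSucc)
        x).toAlternatingMap.curryLeft) w
    rw [this]
    exact smul_zero (A := (TangentSpace 𝓘(𝕜, E) x) [⋀^Fin (k + 1)]→L[𝕜] 𝕜) (f x)
  rw [Form.d_sum fun l _ => hV.basicFamily_analyticAt hf l, Fin.sum_univ_castSucc] at h2
  have h3 := DFunLike.congr_fun h2 (fun i : Fin (k + 2) => V i.castSucc y)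
  rw [ContinuousAlternatingMap.add_apply, ContinuousAlternatingMap.sum_apply,
    Finset.sum_congr rfl fun i _ => hcast i] at h3
  have h4 := hV.sum_eq_zero.self_of_nhds
  rw [Fin.sum_univ_castSucc] at h4
  rw [eq_neg_of_add_eq_zero_right h4, map_neg, map_neg, map_sum, map_sum,
    eq_neg_of_add_eq_zero_right h3, Finset.sum_add_distrib, ← Finset.mul_sum]
  ring

lemma covector_ext (hV : IsAdaptedAt V y) {α β : TangentSpace 𝓘(𝕜, E) y →L[𝕜] 𝕜}
    (h : ∀ l, α (V l y) = β (V l y)) : α = β := by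
  ext w
  rw [← sum_dualCoframe_smul hV.linearIndependent hV.card_eq w, map_sum, map_sum]
  exact Finset.sum_congr rfl fun i _ => by rw [map_smul, map_smul, h]

/-- `f A_l` is closed for all `l` if and only if `df + f ω = 0`. -/
lemma d_smul_basicFamily_eq_zero_iff {V : Fin (k + 3) → VField 𝕜 E M} (hV : IsAdaptedAt V y)
    {f : M → 𝕜} (hf : FunAnalyticAt 𝕜 E f y) :
    (∀ l, Form.d (fun x => f x • basicFamily V l x) y = 0) ↔
      mvfderiv 𝓘(𝕜, E) f y + f y • omega V y = 0 := by
  constructor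
  · intro h
    refine hV.covector_ext fun l => ?_
    have := hV.d_smul_basicFamily hf l
    rw [h l] at this
    exact this.symm
  · intro h l
    refine hV.isFrameAt.eq_zero_of_apply ((hV.d_smul_basicFamily hf l).trans ?_)
    exact DFunLike.congr_fun h (V l y)

end IsAdaptedAt

end Adapted

/-! ### Abelian relations and the equation `df + f ω = 0` -/

section AbelianRelations

variable {𝕜 : Type*} [RCLike 𝕜]
  {E : Type*} [NormedAddCommGroup E] [NormedSpace 𝕜 E] [FiniteDimensional 𝕜 E] [CompleteSpace E]
  {M : Type*} [TopologicalSpace M] [ChartedSpace E M] [IsManifold 𝓘(𝕜, E) ω M] {k : ℕ}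
  {U : Set M} {V : Fin (k + 3) → VField 𝕜 E M} {F : Fin (k + 3) → Distribution 𝕜 E M}

/-- A basic form is closed, if it has degree `n - 1`. -/
lemma IsBasic.d_eq_zero (hU : IsOpen U) (hV : ∀ x ∈ U, IsAdaptedAt V x)
    (hF : ∀ l, ∀ x ∈ U, F l x = Submodule.span 𝕜 {V l x}) {l : Fin (k + 3)} {η : Form 𝕜 E M (k + 1)}
    (h : IsBasic (F l) U η) {x : M} (hx : x ∈ U) : interiorAt (V l x) (η x) = 0 ∧ η.d x = 0 := by
  have h1 := h U subset_rfl hU (V l) (fun z hz => ((hV z hz).analytic l).contMDiffWithinAt)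
    (fun z hz => by rw [hF l z hz]; exact Submodule.mem_span_singleton_self _)
  refine ⟨(h1 x hx).1, ?_⟩
  have h2 := (h1 x hx).2
  rw [lieDeriv_eq hU (fun z hz => (h1 z hz).1) hx] at h2
  exact eq_zero_of_interiorAt_top (hV x hx).linearIndependent (hV x hx).card_eq
    ((hV x hx).apply_ne_zero l) h2

lemma isBasic_of_d_eq_zero (hF : ∀ l, ∀ x ∈ U, F l x = Submodule.span 𝕜 {V l x}) {l : Fin (k + 3)}
    {η : Form 𝕜 E M (k + 1)} (h : ∀ x ∈ U, interiorAt (V l x) (η x) = 0)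
    (hd : ∀ x ∈ U, η.d x = 0) : IsBasic (F l) U η := by
  intro U' hU' ho w _ hw
  have h0 : ∀ x ∈ U', interiorProduct w η x = 0 := by
    intro x hx
    have hwx := hw x hx
    rw [hF l x (hU' hx)] at hwx
    obtain ⟨c, hc⟩ := Submodule.mem_span_singleton.1 hwx
    change interiorAt (w x) (η x) = 0
    rw [← hc, interiorAt_smul, h x (hU' hx)]
    exact smul_zero (A := (TangentSpace 𝓘(𝕜, E) x) [⋀^Fin k]→L[𝕜] 𝕜) c
  refine fun x hx => ⟨h0 x hx, ?_⟩
  rw [lieDeriv_eq ho h0 hx, hd x (hU' hx)]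
  rfl

/-- `(f A_l)` is an abelian relation if and only if `df + f ω = 0`. -/
lemma isAbelianRelation_smul_basicFamily_iff (hU : IsOpen U) (hV : ∀ x ∈ U, IsAdaptedAt V x)
    (hF : ∀ l, ∀ x ∈ U, F l x = Submodule.span 𝕜 {V l x}) {f : M → 𝕜} :
    IsAbelianRelation F U (fun l x => f x • basicFamily V l x) ↔
      ∀ x ∈ U, FunAnalyticAt 𝕜 E f x ∧ mvfderiv 𝓘(𝕜, E) f x + f x • omega V x = 0 := by
  constructor
  · intro h x hx
    have hf : FunAnalyticAt 𝕜 E f x := by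
      have h1 := (h.analytic (0 : Fin (k + 2)).castSucc x hx).apply
        (X := fun a : Fin (k + 1) => V a.succ.castSucc) (fun a => (hV x hx).analytic _)
      refine ContMDiffAt.congr_of_eventuallyEq h1 ((hV x hx).eventually.mono fun z hz => ?_)
      dsimp only
      rw [hz.basicFamily_eq, ContinuousAlternatingMap.smul_apply, interiorAt_apply]
      have e : (Matrix.vecCons (V (0 : Fin (k + 2)).castSucc z)
          fun a : Fin (k + 1) => V a.succ.castSucc z) = fun i : Fin (k + 2) => V i.castSucc z :=
        funext fun i => Fin.cases rfl (fun _ => rfl) i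
      rw [e, volumeForm_self hz.linearIndependent hz.card_eq, smul_eq_mul, mul_one]
    exact ⟨hf, ((hV x hx).d_smul_basicFamily_eq_zero_iff hf).1 fun l =>
      (IsBasic.d_eq_zero hU hV hF (h.basic l) hx).2⟩
  · intro h
    refine ⟨fun l x hx => (hV x hx).basicFamily_analyticAt (h x hx).1 l, fun l =>
      isBasic_of_d_eq_zero hF (fun x hx => ?_) fun x hx =>
        ((hV x hx).d_smul_basicFamily_eq_zero_iff (h x hx).1).2 (h x hx).2 l, fun x hx => ?_⟩
    · rw [(hV x hx).basicFamily_eq, ← interiorAt_smul]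
      have e : interiorAt (f x • V l x) (volumeForm (fun i : Fin (k + 2) => V i.castSucc) x) =
        f x • interiorAt (V l x) (volumeForm (fun i : Fin (k + 2) => V i.castSucc) x) :=
        interiorAt_smul _ _ _
      ext w
      rw [e]
      have := DFunLike.congr_fun (interiorAt_self (V l x)
        (volumeForm (fun i : Fin (k + 2) => V i.castSucc) x)) w
      change f x * _ = 0
      exact (congrArg (fun c => f x * c) this).trans (mul_zero _)
    · have h0 := (hV x hx).sum_eq_zero.self_of_nhds
      rw [← Finset.smul_sum, Finset.sum_congr rfl fun l _ => (hV x hx).basicFamily_eq l,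
        ← interiorAt_sum, h0, ← interiorAt_smul, smul_zero]
      ext w
      exact DFunLike.congr_fun (map_zero (volumeForm (fun i : Fin (k + 2) => V i.castSucc)
        x).toAlternatingMap.curryLeft) w

/-- Forms of degree `n - 1` with sum zero, such that the `l`-th one is annihilated by `V_l`, are the
same multiple of the forms `A_l`. -/
lemma IsAdaptedAt.exists_eq_smul {x : M} (hV : IsAdaptedAt V x)
    {η : Fin (k + 3) → (TangentSpace 𝓘(𝕜, E) x) [⋀^Fin (k + 1)]→L[𝕜] 𝕜}
    (hη : ∀ l, interiorAt (V l x) (η l) = 0) (hs : ∑ l, η l = 0) :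
    ∃ c : 𝕜, ∀ l, η l = c • basicFamily V l x := by
  have hi := hV.linearIndependent
  have hn := hV.card_eq
  have h0 := hV.sum_eq_zero.self_of_nhds
  choose g hg using fun l =>
    exists_eq_smul_interiorAt_volumeForm hi hn (hV.apply_ne_zero l) (hη l)
  refine ⟨g (Fin.last (k + 2)), fun l => ?_⟩
  rw [hV.basicFamily_eq, hg l]
  suffices hgl : g l = g (Fin.last (k + 2)) by rw [hgl]
  -- the interior product of this vector with the volume form is `∑ η_l`
  have h1 : ∑ l, g l • V l x = 0 := by
    by_contra hne
    refine interiorAt_volumeForm_ne_zero hi hn hne ?_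
    rw [interiorAt_sum, ← hs]
    exact Finset.sum_congr rfl fun l _ => by rw [interiorAt_smul, hg l]
  have h2 : ∑ i : Fin (k + 2), (g i.castSucc - g (Fin.last (k + 2))) • V i.castSucc x = 0 := by
    rw [Fin.sum_univ_castSucc] at h1 h0
    simp only [sub_smul, Finset.sum_sub_distrib]
    rw [← Finset.smul_sum, eq_neg_of_add_eq_zero_left h1, eq_neg_of_add_eq_zero_left h0, smul_neg,
      sub_self]
  refine Fin.lastCases rfl (fun i => ?_) l
  exact sub_eq_zero.1 (Fintype.linearIndependent_iff.1 hi _ h2 i)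

/-- The members of an abelian relation are the same multiple of the forms `A_l`. -/
lemma IsAbelianRelation.exists_eq_smul (hU : IsOpen U) (hV : ∀ x ∈ U, IsAdaptedAt V x)
    (hF : ∀ l, ∀ x ∈ U, F l x = Submodule.span 𝕜 {V l x}) {η : Fin (k + 3) → Form 𝕜 E M (k + 1)}
    (h : IsAbelianRelation F U η) {x : M} (hx : x ∈ U) :
    ∃ c : 𝕜, ∀ l, η l x = c • basicFamily V l x :=
  (hV x hx).exists_eq_smul (fun l => (IsBasic.d_eq_zero hU hV hF (h.basic l) hx).1)
    (h.sum_eq_zero x hx)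

end AbelianRelations

/-! ### Change of the family of vector fields -/

section FrameChange

variable {𝕜 : Type*} [RCLike 𝕜]
  {E : Type*} [NormedAddCommGroup E] [NormedSpace 𝕜 E] [FiniteDimensional 𝕜 E] [CompleteSpace E]
  {M : Type*} [TopologicalSpace M] [ChartedSpace E M] [IsManifold 𝓘(𝕜, E) ω M] {y : M} {m k : ℕ}

variable (𝕜) in
/-- The determinant of `V_{τ(1)}, …, V_{τ(n)}` in the basis `V₁, …, Vₙ`, where `∑ V_l = 0`. -/
def permDet (τ : Equiv.Perm (Fin (m + 2))) : 𝕜 :=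
  (Matrix.of fun i j : Fin (m + 1) => Fin.lastCases (motive := fun _ => 𝕜) (-1)
    (fun i => if j = i then 1 else 0) (τ i.castSucc)).det

lemma permDet_one : permDet 𝕜 (1 : Equiv.Perm (Fin (m + 2))) = 1 := by
  unfold permDet
  refine Eq.trans ?_ (Matrix.det_one (R := 𝕜) (n := Fin (m + 1)))
  congr 1
  ext i j
  rw [Matrix.of_apply, Equiv.Perm.one_apply, Fin.lastCases_castSucc, Matrix.one_apply]
  simp only [eq_comm]

namespace IsAdaptedAt

variable {V V' : Fin (m + 2) → VField 𝕜 E M}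

lemma dualCoframe_apply (hV : IsAdaptedAt V y) (l : Fin (m + 2)) (j : Fin (m + 1)) :
    dualCoframe (fun i : Fin (m + 1) => V i.castSucc) j y (V l y) =
      Fin.lastCases (motive := fun _ => 𝕜) (-1) (fun i => if j = i then 1 else 0) l := by
  have h := fun i j : Fin (m + 1) => dualCoframe_apply_self hV.linearIndependent hV.card_eq i j
  refine Fin.lastCases ?_ (fun i => ?_) l
  · have h4 := hV.sum_eq_zero.self_of_nhds
    rw [Fin.sum_univ_castSucc] at h4
    rw [eq_neg_of_add_eq_zero_right h4, map_neg, map_sum, Finset.sum_congr rfl fun i _ => h j i]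
    simp
  · rw [h j i, Fin.lastCases_castSucc]

lemma volumeForm_apply_perm (hV : IsAdaptedAt V y) (τ : Equiv.Perm (Fin (m + 2))) (h : 𝕜)
    (hVV' : ∀ l, V' l y = h • V (τ l) y) :
    volumeForm (fun i : Fin (m + 1) => V i.castSucc) y (fun i : Fin (m + 1) => V' i.castSucc y) =
      h ^ (m + 1) * permDet 𝕜 τ := by
  rw [volumeForm_apply]
  have e : (Matrix.of fun i j : Fin (m + 1) =>
      dualCoframe (fun i : Fin (m + 1) => V i.castSucc) j y (V' i.castSucc y)) =
      h • Matrix.of fun i j : Fin (m + 1) => Fin.lastCases (motive := fun _ => 𝕜) (-1)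
    (fun i => if j = i then 1 else 0) (τ i.castSucc) := by
    ext i j
    rw [Matrix.of_apply, Matrix.smul_apply, Matrix.of_apply, hVV', map_smul, hV.dualCoframe_apply]
  rw [e, Matrix.det_smul, Fintype.card_fin]
  rfl

lemma permDet_ne_zero (hV : IsAdaptedAt V y) (hV' : IsAdaptedAt V' y)
    (τ : Equiv.Perm (Fin (m + 2))) (h : 𝕜)
    (hVV' : ∀ l, V' l y = h • V (τ l) y) : permDet 𝕜 τ ≠ 0 := by
  intro h0
  have h1 := hV.volumeForm_apply_perm τ h hVV'
  have h2 := eq_smul_volumeForm hV'.linearIndependent hV'.card_eq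
    (volumeForm (fun i : Fin (m + 1) => V i.castSucc) y)
  rw [h1, h0, mul_zero] at h2
  have h3 := volumeForm_self hV.linearIndependent hV.card_eq
  have h4 := (DFunLike.congr_fun h2 (fun i : Fin (m + 1) => V i.castSucc y)).symm.trans h3
  exact zero_ne_one ((zero_mul _).symm.trans h4)

/-- The factor comes from the volume form, of weight `n = m + 1` in `h`, and from `V_{τ(l)} = h⁻¹ V'_l`. -/
lemma basicFamily_perm (hV : IsAdaptedAt V y) (hV' : IsAdaptedAt V' y)
    (τ : Equiv.Perm (Fin (m + 2))) {h : 𝕜} (h0 : h ≠ 0)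
    (hVV' : ∀ l, V' l y = h • V (τ l) y) (l : Fin (m + 2)) :
    basicFamily V (τ l) y = (permDet 𝕜 τ * h ^ m) • basicFamily V' l y := by
  have h1 := hV.volumeForm_apply_perm τ h hVV'
  have h2 := eq_smul_volumeForm hV'.linearIndependent hV'.card_eq
    (volumeForm (fun i : Fin (m + 1) => V i.castSucc) y)
  rw [h1] at h2
  have h3 : V (τ l) y = h⁻¹ • V' l y := by rw [hVV', inv_smul_smul₀ h0]
  rw [hV.basicFamily_eq, hV'.basicFamily_eq, h3, interiorAt_smul, h2]
  ext w
  change h⁻¹ * (h ^ (m + 1) * permDet 𝕜 τ * _) = permDet 𝕜 τ * h ^ m * _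
  rw [← mul_assoc]
  congr 1
  field_simp
  ring

/-- The 1-forms of two families of vector fields with the same directions, in any order. -/
lemma omega_perm {V V' : Fin (k + 3) → VField 𝕜 E M} (hV : IsAdaptedAt V y)
    (hV' : IsAdaptedAt V' y) (τ : Equiv.Perm (Fin (k + 3))) {h : M → 𝕜}
    (hh : FunAnalyticAt 𝕜 E h y) (h0 : h y ≠ 0)
    (hVV' : ∀ᶠ x in 𝓝 y, ∀ l, V' l x = h x • V (τ l) x) (w : TangentSpace 𝓘(𝕜, E) y) :
    omega V y w = omega V' y w +
      (h y ^ (k + 1))⁻¹ * mvfderiv 𝓘(𝕜, E) (fun x => h x ^ (k + 1)) y w := by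
  have hG : FunAnalyticAt 𝕜 E (fun x => h x ^ (k + 1)) y := hh.pow (k + 1)
  have h1 : FunAnalyticAt 𝕜 E (fun _ : M => (1 : 𝕜)) y := contMDiffAt_const
  have hc : FunAnalyticAt 𝕜 E (fun _ : M => permDet 𝕜 τ) y := contMDiffAt_const
  have hb := permDet_ne_zero hV hV' τ (h y) hVV'.self_of_nhds
  have key : omega V y = omega V' y +
      (h y ^ (k + 1))⁻¹ • mvfderiv 𝓘(𝕜, E) (fun x => h x ^ (k + 1)) y := by
    -- both 1-forms are read off from the exterior derivative of `A_{τ(l)}`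
    refine hV'.covector_ext fun l => ?_
    have e1 := hV.d_smul_basicFamily h1 (τ l)
    have e2 := hV'.d_smul_basicFamily (hc.mul hG) l
    have e3 : Form.d (fun x => (1 : 𝕜) • basicFamily V (τ l) x) y =
        Form.d (fun x => (permDet 𝕜 τ * h x ^ (k + 1)) • basicFamily V' l x) y := by
      refine Form.d_congr ?_
      filter_upwards [hV.eventually, hV'.eventually, hVV', hh.continuousAt.eventually_ne h0]
        with x a b c d
      rw [basicFamily_perm a b τ d c, one_smul]
    have e4 := DFunLike.congr_fun (eq_smul_volumeForm hV.linearIndependent hV.card_eq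
      (Form.d (fun x => (1 : 𝕜) • basicFamily V (τ l) x) y))
        (fun i : Fin (k + 2) => V' i.castSucc y)
    rw [ContinuousAlternatingMap.smul_apply, e1,
      hV.volumeForm_apply_perm τ (h y) hVV'.self_of_nhds, e3] at e4
    have e5 := e2.symm.trans e4
    have e6 : mvfderiv 𝓘(𝕜, E) (fun x => permDet 𝕜 τ * h x ^ (k + 1)) y (V' l y) =
        permDet 𝕜 τ * mvfderiv 𝓘(𝕜, E) (fun x => h x ^ (k + 1)) y (V' l y) := by
      have := mvfderiv_mul hc.mdifferentiableAt hG.mdifferentiableAt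
      rw [mvfderiv_const, smul_zero, add_zero] at this
      exact DFunLike.congr_fun this (V' l y)
    have e7 : mvfderiv 𝓘(𝕜, E) (fun _ : M => (1 : 𝕜)) y (V (τ l) y) = 0 := by
      rw [mvfderiv_const]; rfl
    have e8 : omega V y (V' l y) = h y * omega V y (V (τ l) y) := by
      rw [hVV'.self_of_nhds l]; exact map_smul _ _ _
    have e9 : permDet 𝕜 τ * mvfderiv 𝓘(𝕜, E) (fun x => h x ^ (k + 1)) y (V' l y) +
        permDet 𝕜 τ * h y ^ (k + 1) * omega V' y (V' l y) =
        (0 + 1 * omega V y (V (τ l) y)) * (h y ^ (k + 2) * permDet 𝕜 τ) := by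
      rw [← e6, ← e7]; exact e5
    have aux : ∀ b G O D t S : 𝕜, b ≠ 0 → G ≠ 0 → b * D + b * G * O = (0 + 1 * S) * (t * G * b) →
        t * S = O + G⁻¹ * D := by
      intro b G O D t S hb hG h
      refine mul_left_cancel₀ (mul_ne_zero hb hG) ?_
      rw [mul_add, show b * G * (G⁻¹ * D) = b * D by field_simp]
      linear_combination -h
    refine e8.trans (aux _ _ _ _ _ _ hb (pow_ne_zero (k + 1) h0) (e9.trans ?_))
    rw [← pow_succ']
  exact DFunLike.congr_fun key w

end IsAdaptedAt

end FrameChange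

/-! ### The fibres of the line bundles `E` and `⊗^{n-1} E*` -/

section TensorPower

variable {𝕜 : Type*} [Field 𝕜] {N : Type*} [AddCommMonoid N] [Module 𝕜 N] {n : ℕ}

lemma exists_dual_apply_eq_one {e : N} (he : e ≠ 0) : ∃ φ : Module.Dual 𝕜 N, φ e = 1 := by
  let _ : AddCommGroup N := Module.addCommMonoidToAddCommGroup 𝕜
  obtain ⟨φ, hφ⟩ := (LinearMap.toSpanSingleton 𝕜 N e).exists_leftInverse_of_injective
    (LinearMap.ker_toSpanSingleton 𝕜 he)
  refine ⟨φ, ?_⟩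
  have := DFunLike.congr_fun hφ 1
  simpa using this

/-- The evaluation at `e ⊗ ⋯ ⊗ e` on a tensor power of the dual space. -/
def tensorEval (n : ℕ) (e : N) : (⨂[𝕜]^n (Module.Dual 𝕜 N)) →ₗ[𝕜] 𝕜 :=
  PiTensorProduct.lift ((MultilinearMap.mkPiAlgebra 𝕜 (Fin n) 𝕜).compLinearMap
    fun _ => LinearMap.applyₗ e)

lemma tensorEval_tprod (e : N) (φ : Fin n → Module.Dual 𝕜 N) :
    tensorEval n e (PiTensorProduct.tprod 𝕜 φ) = ∏ i, φ i e := by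
  unfold tensorEval
  exact (PiTensorProduct.lift.tprod φ).trans (by simp)

/-- If `N` is a line spanned by `e`, then `tensorEval n e` is the coordinate of the line
`⊗ⁿ N*` with respect to `ψ ⊗ ⋯ ⊗ ψ`, where `ψ` is dual to `e`. -/
lemma tensorEval_smul_tprod {e : N} (he : ∀ e' : N, ∃ c : 𝕜, c • e = e') {ψ : Module.Dual 𝕜 N}
    (hψ : ψ e = 1) (t : ⨂[𝕜]^n (Module.Dual 𝕜 N)) :
    tensorEval n e t • (PiTensorProduct.tprod 𝕜 fun _ : Fin n => ψ) = t := by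
  have h0 : ∀ φ : Module.Dual 𝕜 N, φ = φ e • ψ := by
    intro φ
    ext e'
    obtain ⟨c, rfl⟩ := he e'
    rw [LinearMap.smul_apply, map_smul, map_smul, hψ, smul_eq_mul, smul_eq_mul,
      smul_eq_mul, mul_one, mul_comm]
  induction t using PiTensorProduct.induction_on with
  | smul_tprod r φ =>
    have h1 : PiTensorProduct.tprod 𝕜 φ =
        (∏ i, φ i e) • (PiTensorProduct.tprod 𝕜 fun _ : Fin n => ψ) := by
      have := (PiTensorProduct.tprod 𝕜 (s := fun _ : Fin n => Module.Dual 𝕜 N)).map_smul_univ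
        (fun i => φ i e) (fun _ => ψ)
      rwa [← funext fun i => h0 (φ i)] at this
    rw [map_smul, tensorEval_tprod, smul_eq_mul, mul_smul, ← h1]
  | add s t hs ht => rw [map_add, add_smul, hs, ht]

lemma tensorEval_smul (c : 𝕜) (e : N) (t : ⨂[𝕜]^n (Module.Dual 𝕜 N)) :
    tensorEval n (c • e) t = c ^ n * tensorEval n e t := by
  induction t using PiTensorProduct.induction_on with
  | smul_tprod r φ =>
    rw [map_smul, map_smul, tensorEval_tprod, tensorEval_tprod]
    simp only [map_smul, smul_eq_mul, Finset.prod_mul_distrib, Finset.prod_const, Finset.card_univ,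
      Fintype.card_fin]
    ring
  | add s t hs ht => rw [map_add, map_add, hs, ht, mul_add]

end TensorPower

section Fibres

variable {𝕜 : Type*} [RCLike 𝕜] {k : ℕ}
  {M : Type*} [TopologicalSpace M] [ChartedSpace (Model 𝕜 k) M]
  [IsManifold 𝓘(𝕜, Model 𝕜 k) ω M]

namespace IsOrdering

variable {lines : (x : M) → Set (Submodule 𝕜 (TangentSpace 𝓘(𝕜, Model 𝕜 k) x))}
  {U : Set M} {F : Fin (k + 3) → Distribution 𝕜 (Model 𝕜 k) M} {x : M}

lemma exists_generator (h : IsOrdering lines U F) (hx : x ∈ U) :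
    ∃ v : Fin (k + 3) → TangentSpace 𝓘(𝕜, Model 𝕜 k) x,
      ∀ l, v l ≠ 0 ∧ F l x = Submodule.span 𝕜 {v l} := by
  have (l : Fin (k + 3)) : ∃ v : TangentSpace 𝓘(𝕜, Model 𝕜 k) x,
      v ≠ 0 ∧ F l x = Submodule.span 𝕜 {v} := by
    obtain ⟨U', _, _, hxU', v, _, hv⟩ := h.foliation l x hx
    exact ⟨v x, hv x hxU'⟩
  exact ⟨fun l => (this l).choose, fun l => (this l).choose_spec⟩

lemma injective (h : IsOrdering lines U F) (hx : x ∈ U) : Function.Injective fun l => F l x := by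
  intro a b hab
  obtain ⟨v, hv⟩ := h.exists_generator hx
  have hmem : ∀ l, v l ∈ F l x := fun l => by
    rw [(hv l).2]; exact Submodule.mem_span_singleton_self _
  obtain ⟨l₀, hl₀⟩ : ∃ l₀ : Fin (k + 3), l₀ ∉ ({a, b} : Finset (Fin (k + 3))) := by
    by_contra! hc
    have h1 := Finset.card_le_card (fun l _ => hc l : (Finset.univ : Finset (Fin (k + 3))) ⊆ {a, b})
    have h2 := Finset.card_le_two (a := a) (b := b)
    rw [Finset.card_univ, Fintype.card_fin] at h1
    omega
  rw [Finset.mem_insert, Finset.mem_singleton, not_or] at hl₀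
  have hg := h.general_position x hx (Function.update v b (v a)) (fun l => ?_) l₀
  · have hinj := hg.injective (a₁ := ⟨a, fun e => hl₀.1 e.symm⟩) (a₂ := ⟨b, fun e => hl₀.2 e.symm⟩)
    by_contra hne
    refine hne (congrArg Subtype.val (hinj ?_))
    dsimp only
    rw [Function.update_self, Function.update_of_ne hne]
  · by_cases hl : l = b
    · subst hl
      rw [Function.update_self]
      exact ⟨(show F a x = F l x from hab) ▸ hmem a, (hv a).1⟩
    · rw [Function.update_of_ne hl]
      exact ⟨hmem l, (hv l).1⟩

/-- The numbering of the lines at a point. -/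
def linesEquiv (h : IsOrdering lines U F) (hx : x ∈ U) : Fin (k + 3) ≃ lines x :=
  Equiv.ofBijective (fun l => ⟨F l x, by rw [h.lines_eq x hx]; exact mem_range_self l⟩)
    ⟨fun _ _ e => h.injective hx (congrArg Subtype.val e), fun L => by
      have hL : L.1 ∈ range fun l => F l x := h.lines_eq x hx ▸ L.2
      obtain ⟨l, hl⟩ := hL
      exact ⟨l, Subtype.ext hl⟩⟩

lemma mem_lines (h : IsOrdering lines U F) (hx : x ∈ U) (l : Fin (k + 3)) : F l x ∈ lines x :=
  (h.linesEquiv hx l).2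

lemma mono (h : IsOrdering lines U F) {U' : Set M} (hU' : U' ⊆ U) (ho : IsOpen U') :
    IsOrdering lines U' F := by
  refine ⟨ho, fun l x hx => ?_, fun x hx => h.lines_eq x (hU' hx),
    fun x hx => h.general_position x (hU' hx)⟩
  obtain ⟨U₁, hU₁, ho₁, hx₁, v, hv, hv'⟩ := h.foliation l x (hU' hx)
  exact ⟨U₁ ∩ U', inter_subset_right, ho₁.inter ho, ⟨hx₁, hx⟩, v, hv.mono inter_subset_left,
    fun y hy => hv' y hy.1⟩

/-- Vectors on the lines of the web with sum zero vanish if one of them vanishes. -/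
lemma eq_zero_of_sum_eq_zero (h : IsOrdering lines U F) (hx : x ∈ U)
    {c : Fin (k + 3) → TangentSpace 𝓘(𝕜, Model 𝕜 k) x} (hc : ∀ l, c l ∈ F l x)
    (hs : ∑ l, c l = 0) {l₀ : Fin (k + 3)} (h0 : c l₀ = 0) (l : Fin (k + 3)) : c l = 0 := by
  obtain ⟨v, hv⟩ := h.exists_generator hx
  have hmem : ∀ l, v l ∈ F l x := fun l => by
    rw [(hv l).2]; exact Submodule.mem_span_singleton_self _
  choose b hb using fun l => Submodule.mem_span_singleton.1 ((hv l).2 ▸ hc l)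
  by_cases hl : l = l₀
  · rw [hl, h0]
  have hli := h.general_position x hx v (fun l => ⟨hmem l, (hv l).1⟩) l₀
  have h1 : ∑ l : {l // l ≠ l₀}, b l.1 • v l.1 = 0 := by
    classical
    rw [Finset.sum_congr rfl fun (l : {l // l ≠ l₀}) _ => hb l.1]
    rw [← Finset.add_sum_erase _ _ (Finset.mem_univ l₀), h0, zero_add] at hs
    rw [← hs]
    exact (Finset.sum_subtype (Finset.univ.erase l₀) (by simp) c).symm
  rw [← hb l, Fintype.linearIndependent_iff.1 hli (fun l => b l.1) h1 ⟨l, hl⟩, zero_smul]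

end IsOrdering

namespace CurveWeb

variable {W : CurveWeb 𝕜 k M} {U : Set M} {F : Fin (k + 3) → Distribution 𝕜 (Model 𝕜 k) M} {x : M}

lemma component_mem (e : W.E x) (L : Submodule 𝕜 (TangentSpace 𝓘(𝕜, Model 𝕜 k) x)) :
    component e L ∈ L := by
  unfold component
  split_ifs with h
  · exact (e.1 ⟨L, h⟩).2
  · exact zero_mem _

lemma component_smul (c : 𝕜) (e : W.E x) (L : Submodule 𝕜 (TangentSpace 𝓘(𝕜, Model 𝕜 k) x)) :
    component (c • e) L = c • component e L := by
  unfold component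
  split_ifs with h
  · rfl
  · rw [smul_zero]

lemma component_sub (e e' : W.E x) (L : Submodule 𝕜 (TangentSpace 𝓘(𝕜, Model 𝕜 k) x)) :
    component (e - e') L = component e L - component e' L := by
  unfold component
  split_ifs with h
  · rfl
  · rw [sub_zero]

lemma component_ext (h : IsOrdering W.lines U F) (hx : x ∈ U) {e e' : W.E x}
    (hc : ∀ l, component e (F l x) = component e' (F l x)) : e = e' := by
  refine Subtype.ext (DFinsupp.ext fun L => Subtype.ext ?_)
  obtain ⟨l, rfl⟩ := (h.linesEquiv hx).surjective L
  have := hc l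
  unfold component at this
  rw [dif_pos (h.mem_lines hx l), dif_pos (h.mem_lines hx l)] at this
  exact this

lemma trace_eq_sum (h : IsOrdering W.lines U F) (hx : x ∈ U)
    (d : ⨁ l : W.lines x, (l : Submodule 𝕜 (TangentSpace 𝓘(𝕜, Model 𝕜 k) x))) :
    W.trace x d = ∑ l, (d (h.linesEquiv hx l) : TangentSpace 𝓘(𝕜, Model 𝕜 k) x) := by
  classical
  let _ : Fintype (W.lines x) := Fintype.ofEquiv _ (h.linesEquiv hx)
  unfold trace
  rw [(h.linesEquiv hx).sum_comp (fun L => (d L : TangentSpace 𝓘(𝕜, Model 𝕜 k) x)),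
    DirectSum.coeLinearMap_eq_dfinsuppSum]
  exact DFinsupp.sum_eq_sum_fintype _ fun _ => rfl

lemma sum_component (h : IsOrdering W.lines U F) (hx : x ∈ U) (e : W.E x) :
    ∑ l, component e (F l x) = 0 := by
  have h1 := trace_eq_sum h hx e.1
  rw [LinearMap.mem_ker.1 e.2] at h1
  refine Eq.trans (Finset.sum_congr rfl fun l _ => ?_) h1.symm
  unfold component
  rw [dif_pos (h.mem_lines hx l)]
  rfl

lemma exists_component_eq (h : IsOrdering W.lines U F) (hx : x ∈ U)
    {c : Fin (k + 3) → TangentSpace 𝓘(𝕜, Model 𝕜 k) x} (hc : ∀ l, c l ∈ F l x)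
    (hs : ∑ l, c l = 0) : ∃ e : W.E x, ∀ l, component e (F l x) = c l := by
  classical
  let _ : Fintype (W.lines x) := Fintype.ofEquiv _ (h.linesEquiv hx)
  have hc' : ∀ L : W.lines x, c ((h.linesEquiv hx).symm L) ∈ L.1 := by
    intro L
    obtain ⟨l, rfl⟩ := (h.linesEquiv hx).surjective L
    rw [Equiv.symm_apply_apply]
    exact hc l
  let d : ⨁ l : W.lines x, (l : Submodule 𝕜 (TangentSpace 𝓘(𝕜, Model 𝕜 k) x)) :=
    DFinsupp.equivFunOnFintype.symm fun L => ⟨c ((h.linesEquiv hx).symm L), hc' L⟩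
  have hd : ∀ l, (d (h.linesEquiv hx l) : TangentSpace 𝓘(𝕜, Model 𝕜 k) x) = c l := by
    intro l
    change c ((h.linesEquiv hx).symm (h.linesEquiv hx l)) = c l
    rw [Equiv.symm_apply_apply]
  refine ⟨⟨d, ?_⟩, fun l => ?_⟩
  · rw [LinearMap.mem_ker, trace_eq_sum h hx, Finset.sum_congr rfl fun l _ => hd l, hs]
  · unfold component
    rw [dif_pos (h.mem_lines hx l)]
    exact hd l

lemma component_ne_zero (h : IsOrdering W.lines U F) (hx : x ∈ U) {e : W.E x} (he : e ≠ 0)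
    (l : Fin (k + 3)) : component e (F l x) ≠ 0 := by
  intro h0
  refine he (component_ext h hx fun j => ?_)
  rw [h.eq_zero_of_sum_eq_zero hx (fun l => component_mem e (F l x)) (sum_component h hx e) h0 j]
  have := component_smul (0 : 𝕜) (0 : W.E x) (F j x)
  rw [zero_smul, zero_smul] at this
  exact this.symm

lemma span_component (h : IsOrdering W.lines U F) (hx : x ∈ U) {e : W.E x} (he : e ≠ 0)
    (l : Fin (k + 3)) : F l x = Submodule.span 𝕜 {component e (F l x)} := by
  obtain ⟨v, hv⟩ := h.exists_generator hx
  have h1 := component_mem e (F l x)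
  obtain ⟨c, hc⟩ : ∃ c : 𝕜, c • v l = component e (F l x) :=
    Submodule.mem_span_singleton.1 (((hv l).2 ▸ le_rfl : F l x ≤ Submodule.span 𝕜 {v l}) h1)
  have hc0 : c ≠ 0 := by
    rintro rfl
    exact component_ne_zero h hx he l (by rw [← hc, zero_smul])
  refine (hv l).2.trans ?_
  rw [← hc]
  exact (Submodule.span_singleton_smul_eq (IsUnit.mk0 c hc0) _).symm

lemma exists_smul_eq (h : IsOrdering W.lines U F) (hx : x ∈ U) {e : W.E x} (he : e ≠ 0)
    (e' : W.E x) : ∃ c : 𝕜, c • e = e' := by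
  have h1 := component_mem e' (F 0 x)
  rw [span_component h hx he 0] at h1
  obtain ⟨c, hc⟩ := Submodule.mem_span_singleton.1 h1
  refine ⟨c, ?_⟩
  by_contra hne
  refine component_ne_zero h hx (sub_ne_zero.2 hne) 0 ?_
  rw [component_sub, component_smul, hc, ← span_component h hx he 0, sub_self]

lemma exists_ne_zero (h : IsOrdering W.lines U F) (hx : x ∈ U) : ∃ e : W.E x, e ≠ 0 := by
  obtain ⟨v, hv⟩ := h.exists_generator hx
  have hmem : ∀ l, v l ∈ F l x := fun l => by
    rw [(hv l).2]; exact Submodule.mem_span_singleton_self _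
  have hli := (h.general_position x hx v (fun l => ⟨hmem l, (hv l).1⟩) (Fin.last (k + 2))).comp
    (fun i : Fin (k + 2) => ⟨i.castSucc, (Fin.castSucc_lt_last i).ne⟩)
    (fun i j hij => Fin.castSucc_injective _ (congrArg Subtype.val hij))
  have hn : k + 2 = Module.finrank 𝕜 (TangentSpace 𝓘(𝕜, Model 𝕜 k) x) :=
    (finrank_euclideanSpace_fin (𝕜 := 𝕜) (n := k + 2)).symm
  have hsum := sum_inverse_smul hli hn (v (Fin.last (k + 2)))
  set b := (frameMap (𝕜 := 𝕜) fun i : Fin (k + 2) => v i.castSucc).inverse (v (Fin.last (k + 2)))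
  let c : Fin (k + 3) → TangentSpace 𝓘(𝕜, Model 𝕜 k) x := fun l => Fin.lastCases
    (motive := fun _ => TangentSpace 𝓘(𝕜, Model 𝕜 k) x)
    (-v (Fin.last (k + 2))) (fun i => b i • v i.castSucc) l
  have hcl : c (Fin.last (k + 2)) = -v (Fin.last (k + 2)) := Fin.lastCases_last
  have hcc : ∀ i : Fin (k + 2), c i.castSucc = b i • v i.castSucc := fun i =>
    Fin.lastCases_castSucc i
  have hc : ∀ l, c l ∈ F l x := by
    refine Fin.lastCases ?_ fun i => ?_
    · rw [hcl]; exact neg_mem (hmem _)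
    · rw [hcc]; exact Submodule.smul_mem _ _ (hmem _)
  have hs : ∑ l, c l = 0 := by
    rw [Fin.sum_univ_castSucc, hcl, Finset.sum_congr rfl fun i _ => hcc i]
    exact add_neg_eq_zero.2 hsum
  obtain ⟨e, he⟩ := exists_component_eq h hx hc hs
  refine ⟨e, fun h0 => ?_⟩
  have h1 := he (Fin.last (k + 2))
  have := component_smul (0 : 𝕜) (0 : W.E x) (F (Fin.last (k + 2)) x)
  rw [zero_smul, zero_smul] at this
  rw [h0, this, hcl] at h1
  exact (hv _).1 (neg_eq_zero.1 h1.symm)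

lemma finrank_E (W : CurveWeb 𝕜 k M) (x : M) : Module.finrank 𝕜 (W.E x) = 1 := by
  obtain ⟨U, F, hx, h⟩ := W.locally_foliated x
  obtain ⟨e, he⟩ := exists_ne_zero h hx
  exact finrank_eq_one e he fun e' => exists_smul_eq h hx he e'

lemma exists_smul_eq' {e : W.E x} (he : e ≠ 0) (e' : W.E x) : ∃ c : 𝕜, c • e = e' := by
  obtain ⟨U, F, hx, h⟩ := W.locally_foliated x
  exact exists_smul_eq h hx he e'

lemma dualForm_apply {e : W.E x} (he : e ≠ 0) : dualForm e e = 1 := by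
  have h : ∃ φ : Module.Dual 𝕜 (W.E x), φ e = 1 := exists_dual_apply_eq_one he
  unfold dualForm
  rw [dif_pos h]
  exact h.choose_spec

/-- The coordinate on the line `⊗^{n-1} Eₓ*` given by a nonzero `e ∈ Eₓ`: the evaluation at
`e ⊗ ⋯ ⊗ e`. -/
def coord (e : W.E x) : W.L x →ₗ[𝕜] 𝕜 := tensorEval (k + 1) e

lemma coord_smul_tprod {e : W.E x} (he : e ≠ 0) (t : W.L x) :
    coord e t • (PiTensorProduct.tprod 𝕜 fun _ : Fin (k + 1) => dualForm e : W.L x) = t :=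
  tensorEval_smul_tprod (N := W.E x) (n := k + 1) (exists_smul_eq' he) (dualForm_apply he) t

lemma coord_smul (c : 𝕜) (e : W.E x) (t : W.L x) : coord (c • e) t = c ^ (k + 1) * coord e t :=
  tensorEval_smul (N := W.E x) (n := k + 1) c e t

section Sections

variable {σ σ' : (x : M) → W.E x}

lemma coord_dualPower (hσ : σ x ≠ 0) : coord (σ x) (dualPower σ x) = 1 := by
  refine (tensorEval_tprod (σ x) fun _ => dualForm (σ x)).trans ?_
  exact Finset.prod_eq_one fun _ _ => dualForm_apply hσ

lemma coord_smul_dualPower (hσ : σ x ≠ 0) (t : W.L x) : coord (σ x) t • dualPower σ x = t :=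
  coord_smul_tprod hσ t

lemma dualPower_ne_zero (hσ : σ x ≠ 0) : dualPower σ x ≠ 0 := by
  intro h
  have := coord_dualPower hσ
  rw [h, map_zero] at this
  exact zero_ne_one this

lemma smul_dualPower_inj (hσ : σ x ≠ 0) {a b : 𝕜} :
    a • dualPower σ x = b • dualPower σ x ↔ a = b := by
  refine ⟨fun h => ?_, fun h => by rw [h]⟩
  have := congrArg (coord (σ x)) h
  rwa [map_smul, map_smul, coord_dualPower hσ, smul_eq_mul, smul_eq_mul, mul_one, mul_one] at this

lemma eq_smul_dualPower_iff (hσ : σ x ≠ 0) {t : W.L x} {a : 𝕜} :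
    t = a • dualPower σ x ↔ coord (σ x) t = a := by
  rw [← smul_dualPower_inj hσ, coord_smul_dualPower hσ]

end Sections

end CurveWeb

end Fibres

/-! ### Local frames of the web -/

section Frames

variable {𝕜 : Type*} [RCLike 𝕜] {k : ℕ}
  {M : Type*} [TopologicalSpace M] [ChartedSpace (Model 𝕜 k) M]
  [IsManifold 𝓘(𝕜, Model 𝕜 k) ω M]

namespace IsAdaptedAt

variable {V : Fin (k + 3) → VField 𝕜 (Model 𝕜 k) M} {y : M}

lemma omega_analyticAt (hV : IsAdaptedAt V y) : (omega V).toForm.AnalyticAt y := by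
  refine hV.isFrameAt.analyticAt_iff.2 fun r => ?_
  have h1 : FunAnalyticAt 𝕜 (Model 𝕜 k) (fun x => ∑ j : Fin (k + 2),
      dualCoframe (fun j : Fin (k + 2) => V j.castSucc) j x
        (VectorField.mlieBracket 𝓘(𝕜, Model 𝕜 k) (V j.castSucc) (V (r 0).castSucc) x)) y :=
    contMDiffAt_finsetSum fun j _ => hV.isFrameAt.funAnalyticAt_dualCoframe
      ((hV.analytic _).mlieBracket (hV.analytic _)) j
  refine ContMDiffAt.congr_of_eventuallyEq h1 (hV.eventually.mono fun x hx => ?_)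
  exact hx.omega_apply_castSucc (r 0)

end IsAdaptedAt

namespace CurveWeb

variable {W : CurveWeb 𝕜 k M} {U U' : Set M} {F F' : Fin (k + 3) → Distribution 𝕜 (Model 𝕜 k) M}
  {σ σ' : (x : M) → W.E x} {x : M}

namespace IsFrame

lemma fields_ne_zero (h : W.IsFrame U F σ) (hx : x ∈ U) (l : Fin (k + 3)) : fields F σ l x ≠ 0 :=
  component_ne_zero h.ordering hx (h.ne_zero x hx) l

lemma span_fields (h : W.IsFrame U F σ) (l : Fin (k + 3)) :
    ∀ x ∈ U, F l x = Submodule.span 𝕜 {fields F σ l x} :=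
  fun x hx => span_component h.ordering hx (h.ne_zero x hx) l

lemma mem_nhds (h : W.IsFrame U F σ) (hx : x ∈ U) : U ∈ 𝓝 x := h.ordering.isOpen.mem_nhds hx

lemma isAdaptedAt (h : W.IsFrame U F σ) (hx : x ∈ U) : IsAdaptedAt (fields F σ) x where
  analytic l := (h.analytic l).analyticAt h.ordering.isOpen hx
  linearIndependent := (h.ordering.general_position x hx (fun l => fields F σ l x)
    (fun l => ⟨component_mem _ _, h.fields_ne_zero hx l⟩) (Fin.last (k + 2))).comp
      (fun i : Fin (k + 2) => ⟨i.castSucc, (Fin.castSucc_lt_last i).ne⟩)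
      (fun _ _ hij => Fin.castSucc_injective _ (congrArg Subtype.val hij))
  card_eq := (finrank_euclideanSpace_fin (𝕜 := 𝕜) (n := k + 2)).symm
  sum_eq_zero := by
    filter_upwards [h.mem_nhds hx] with y hy using sum_component h.ordering hy (σ y)
  ne_zero := h.fields_ne_zero hx _

lemma mono (h : W.IsFrame U F σ) (hU' : U' ⊆ U) (ho : IsOpen U') : W.IsFrame U' F σ :=
  ⟨h.ordering.mono hU' ho, fun l => (h.analytic l).mono hU', fun x hx => h.ne_zero x (hU' hx)⟩

lemma reorder (h : W.IsFrame U F σ) (τ : Equiv.Perm (Fin (k + 3))) :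
    W.IsFrame U (fun l => F (τ l)) σ where
  ordering :=
    { isOpen := h.ordering.isOpen
      foliation := fun l => h.ordering.foliation (τ l)
      lines_eq := fun x hx => by
        rw [h.ordering.lines_eq x hx]
        exact (τ.surjective.range_comp fun l => F l x).symm
      general_position := fun x hx v hv l₀ => by
        have h1 := h.ordering.general_position x hx (fun l => v (τ.symm l)) (fun l => by
          have := hv (τ.symm l)
          rwa [Equiv.apply_symm_apply] at this) (τ l₀)
        have h2 := h1.comp (fun l : {l // l ≠ l₀} => (⟨τ l.1, fun e => l.2 (τ.injective e)⟩ :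
          {l // l ≠ τ l₀})) (fun a b hab => Subtype.ext (τ.injective (congrArg Subtype.val hab)))
        have e : ((fun l : {l // l ≠ τ l₀} => v (τ.symm l.1)) ∘ fun l : {l // l ≠ l₀} =>
          (⟨τ l.1, fun e => l.2 (τ.injective e)⟩ : {l // l ≠ τ l₀})) = fun l => v l.1 := by
          funext l
          exact congrArg v (τ.symm_apply_apply l.1)
        rwa [e] at h2 }
  analytic l := h.analytic (τ l)
  ne_zero := h.ne_zero

/-- The 1-form of a frame does not depend on the order of the foliations. -/
lemma omega_reorder (h : W.IsFrame U F σ) (τ : Equiv.Perm (Fin (k + 3))) (hx : x ∈ U) :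
    omega (fields (fun l => F (τ l)) σ) x = omega (fields F σ) x := by
  have h1 : FunAnalyticAt 𝕜 (Model 𝕜 k) (fun _ : M => (1 : 𝕜)) x := contMDiffAt_const
  ext w
  have := (h.isAdaptedAt hx).omega_perm ((h.reorder τ).isAdaptedAt hx) τ h1 one_ne_zero
    (Eventually.of_forall fun y l => (one_smul 𝕜 (fields F σ (τ l) y)).symm) w
  rw [this]
  simp only [one_pow, mvfderiv_const]
  simp

end IsFrame

/-- Near every point of an open set on which the foliations are ordered, there are frames. -/
lemma exists_isFrame (h : IsOrdering W.lines U F) (hx : x ∈ U) :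
    ∃ U' ⊆ U, ∃ σ, x ∈ U' ∧ W.IsFrame U' F σ := by
  choose U₁ hU₁ ho hxU v hva hv using fun l => h.foliation l x hx
  set U₂ := ⋂ l, U₁ l with hU₂
  have ho₂ : IsOpen U₂ := isOpen_iInter_of_finite ho
  have hx₂ : x ∈ U₂ := mem_iInter.2 hxU
  have hsub : ∀ l, U₂ ⊆ U₁ l := fun l => iInter_subset _ l
  have hU₂U : U₂ ⊆ U := (hsub 0).trans (hU₁ 0)
  have hord := h.mono hU₂U ho₂
  have hva' : ∀ l, ∀ y ∈ U₂, (v l).AnalyticAt y := fun l y hy =>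
    (hva l).analyticAt (ho l) (hsub l hy)
  have hmem : ∀ l, ∀ y ∈ U₂, v l y ∈ F l y := fun l y hy => by
    rw [(hv l y (hsub l hy)).2]; exact Submodule.mem_span_singleton_self _
  have hfr : ∀ y ∈ U₂, IsFrameAt (fun i : Fin (k + 2) => v i.castSucc) y := fun y hy =>
    ⟨fun i => hva' _ y hy, (h.general_position y (hU₂U hy) (fun l => v l y)
      (fun l => ⟨hmem l y hy, (hv l y (hsub l hy)).1⟩) (Fin.last (k + 2))).comp
        (fun i : Fin (k + 2) => ⟨i.castSucc, (Fin.castSucc_lt_last i).ne⟩)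
        (fun _ _ hij => Fin.castSucc_injective _ (congrArg Subtype.val hij)),
      (finrank_euclideanSpace_fin (𝕜 := 𝕜) (n := k + 2)).symm⟩
  -- the generators are rescaled so that their sum is zero
  let b : Fin (k + 2) → M → 𝕜 := fun i y =>
    dualCoframe (fun i : Fin (k + 2) => v i.castSucc) i y (v (Fin.last (k + 2)) y)
  let c : Fin (k + 3) → M → 𝕜 := fun l y => Fin.lastCases (motive := fun _ => 𝕜) (-1)
    (fun i => b i y) l
  have hcl : ∀ y, c (Fin.last (k + 2)) y = -1 := fun y => Fin.lastCases_last
  have hcc : ∀ (i : Fin (k + 2)) y, c i.castSucc y = b i y := fun i y => Fin.lastCases_castSucc i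
  have hca : ∀ l, ∀ y ∈ U₂, FunAnalyticAt 𝕜 (Model 𝕜 k) (c l) y := by
    intro l y hy
    refine Fin.lastCases ?_ (fun i => ?_) l
    · rw [funext hcl]; exact contMDiffAt_const
    · rw [funext (hcc i)]
      exact (hfr y hy).funAnalyticAt_dualCoframe (hva' _ y hy) i
  have hsum : ∀ y ∈ U₂, ∑ l, c l y • v l y = 0 := by
    intro y hy
    rw [Fin.sum_univ_castSucc, hcl, Finset.sum_congr rfl fun i _ => by rw [hcc i], neg_one_smul]
    exact add_neg_eq_zero.2 (sum_dualCoframe_smul (hfr y hy).linearIndependent (hfr y hy).card_eq _)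
  have hex : ∀ y, ∃ e : W.E y, y ∈ U₂ → ∀ l, component e (F l y) = c l y • v l y := by
    intro y
    by_cases hy : y ∈ U₂
    · obtain ⟨e, he⟩ := exists_component_eq hord hy
        (fun l => Submodule.smul_mem _ (c l y) (hmem l y hy)) (hsum y hy)
      exact ⟨e, fun _ => he⟩
    · exact ⟨0, fun hy' => absurd hy' hy⟩
  choose σ hσ using hex
  refine ⟨U₂, hU₂U, σ, hx₂, hord, fun l => ?_, fun y hy h0 => ?_⟩
  · intro y hy
    have h1 : VField.AnalyticAt (fun y => c l y • v l y) y := (hva' l y hy).smul (hca l y hy)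
    exact (ContMDiffAt.contMDiffWithinAt (h1 : ContMDiffAt _ _ _ _ _)).congr
      (fun z hz => congrArg (Bundle.TotalSpace.mk' _ z) (hσ z hz l))
      (congrArg (Bundle.TotalSpace.mk' _ y) (hσ y hy l))
  · have h1 := hσ y hy (Fin.last (k + 2))
    have h2 := component_smul (0 : 𝕜) (0 : W.E y) (F (Fin.last (k + 2)) y)
    rw [zero_smul, zero_smul] at h2
    rw [h0, h2, hcl, neg_one_smul] at h1
    exact (hv _ y (hsub _ hy)).1 (neg_eq_zero.1 h1.symm)

lemma exists_isFrame_of_mem (W : CurveWeb 𝕜 k M) (x : M) : ∃ U F σ, x ∈ U ∧ W.IsFrame U F σ := by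
  obtain ⟨U, F, hx, h⟩ := W.locally_foliated x
  obtain ⟨U', _, σ, hx', h'⟩ := exists_isFrame h hx
  exact ⟨U', F, σ, hx', h'⟩

/-- Distinct lines of two orderings at a point stay distinct nearby, since linear independence is an
open condition. -/
lemma eventually_ne_of_ne (h : W.IsFrame U F σ) (h' : W.IsFrame U' F' σ') (hx : x ∈ U)
    (hx' : x ∈ U') {l j : Fin (k + 3)} (hne : F' l x ≠ F j x) : ∀ᶠ y in 𝓝 x, F' l y ≠ F j y := by
  have hy := mem_extChartAt_source (I := 𝓘(𝕜, Model 𝕜 k)) x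
  let u : Fin 2 → VField 𝕜 (Model 𝕜 k) M := ![fields F' σ' l, fields F σ j]
  have hu : ∀ i, (u i).AnalyticAt x := fun i => by
    fin_cases i
    · exact (h'.isAdaptedAt hx').analytic l
    · exact (h.isAdaptedAt hx).analytic j
  have hli : LinearIndependent 𝕜 (fun i => u i x) := by
    have e : (fun i => u i x) = ![fields F' σ' l x, fields F σ j x] := by
      funext i; fin_cases i <;> rfl
    rw [e, LinearIndependent.pair_iff' (h'.fields_ne_zero hx' l)]
    intro a ha
    refine hne ?_
    have ha0 : a ≠ 0 := by
      rintro rfl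
      rw [zero_smul] at ha
      exact h.fields_ne_zero hx j ha.symm
    rw [h'.span_fields l x hx', h.span_fields j x hx, ← ha]
    exact (Submodule.span_singleton_smul_eq (IsUnit.mk0 a ha0) _).symm
  have h1 := eventually_linearIndependent (fun i => (hu i).inChart hy)
    (linearIndependent_inChart hli hy)
  filter_upwards [eventually_of_extChartAt 𝕜 hy h1, eventually_mem_extChartAt_source 𝕜 hy,
    h.mem_nhds hx, h'.mem_nhds hx'] with y h2 hys hyU hyU' heq
  have h3 := linearIndependent_of_inChart hys h2
  have e : (fun i => u i y) = ![fields F' σ' l y, fields F σ j y] := by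
    funext i; fin_cases i <;> rfl
  rw [e, LinearIndependent.pair_iff' (h'.fields_ne_zero hyU' l)] at h3
  have h4 : fields F σ j y ∈ F' l y := by
    rw [heq]; exact component_mem _ _
  rw [h'.span_fields l y hyU'] at h4
  obtain ⟨a, ha⟩ := Submodule.mem_span_singleton.1 h4
  exact h3 a ha

/-- The change of frames: near a point, two frames differ by a permutation of the foliations and by
an analytic factor. -/
lemma IsFrame.exists_change (h : W.IsFrame U F σ) (h' : W.IsFrame U' F' σ') (hx : x ∈ U)
    (hx' : x ∈ U') : ∃ (τ : Equiv.Perm (Fin (k + 3))) (a : M → 𝕜),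
      FunAnalyticAt 𝕜 (Model 𝕜 k) a x ∧ ∀ᶠ y in 𝓝 x, a y ≠ 0 ∧ σ' y = a y • σ y ∧
        (∀ l, F' l y = F (τ l) y) ∧ ∀ l, fields F' σ' l y = a y • fields F σ (τ l) y := by
  let τ : Equiv.Perm (Fin (k + 3)) :=
    (h'.ordering.linesEquiv hx').trans (h.ordering.linesEquiv hx).symm
  have hτ : ∀ l, F' l x = F (τ l) x := by
    intro l
    have : h.ordering.linesEquiv hx (τ l) = h'.ordering.linesEquiv hx' l :=
      Equiv.apply_symm_apply _ _
    exact (congrArg Subtype.val this).symm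
  have hne : ∀ᶠ y in 𝓝 x, ∀ l j, j ≠ τ l → F' l y ≠ F j y := by
    refine eventually_all.2 fun l => eventually_all.2 fun j => ?_
    by_cases hj : j = τ l
    · exact Eventually.of_forall fun y hy => absurd hj hy
    · refine (eventually_ne_of_ne h h' hx hx' (l := l) (j := j) fun e => hj ?_).mono fun y hy _ => hy
      exact h.ordering.injective hx (e.symm.trans (hτ l))
  let i₀ : Fin (k + 2) := 0
  let a : M → 𝕜 := fun y => dualCoframe (fun i : Fin (k + 2) => fields F σ i.castSucc) i₀ y
    (fields F' σ' (τ.symm i₀.castSucc) y)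
  have ha : FunAnalyticAt 𝕜 (Model 𝕜 k) a x :=
    (h.isAdaptedAt hx).isFrameAt.funAnalyticAt_dualCoframe ((h'.isAdaptedAt hx').analytic _) i₀
  refine ⟨τ, a, ha, ?_⟩
  filter_upwards [hne, h.mem_nhds hx, h'.mem_nhds hx'] with y hy hyU hyU'
  have hF : ∀ l, F' l y = F (τ l) y := by
    intro l
    have h1 := h'.ordering.mem_lines hyU' l
    rw [h.ordering.lines_eq y hyU] at h1
    obtain ⟨j, hj⟩ := h1
    by_cases hjl : j = τ l
    · rw [← hjl]; exact hj.symm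
    · exact absurd hj.symm (hy l j hjl)
  obtain ⟨t, ht⟩ := exists_smul_eq h.ordering hyU (h.ne_zero y hyU) (σ' y)
  have hfl : ∀ l, fields F' σ' l y = t • fields F σ (τ l) y := by
    intro l
    change component (σ' y) (F' l y) = _
    rw [hF l, ← ht, component_smul]
    rfl
  have hat : a y = t := by
    change dualCoframe _ i₀ y (fields F' σ' (τ.symm i₀.castSucc) y) = t
    rw [hfl, Equiv.apply_symm_apply, map_smul]
    have hA := h.isAdaptedAt hyU
    have := (dualCoframe_apply_self hA.linearIndependent hA.card_eq i₀ i₀).trans (if_pos rfl)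
    exact (congrArg (fun c : 𝕜 => t * c) this).trans (mul_one t)
  have ht0 : t ≠ 0 := by
    rintro rfl
    rw [zero_smul] at ht
    exact h'.ne_zero y hyU' ht.symm
  rw [hat]
  exact ⟨ht0, ht.symm, hF, hfl⟩

/-- The transition function `G` between the sections `σ̂^{⊗(n-1)}` of two frames, and the
corresponding change of `ω` by `dG / G`. -/
lemma IsFrame.exists_transition (h : W.IsFrame U F σ) (h' : W.IsFrame U' F' σ') (hx : x ∈ U)
    (hx' : x ∈ U') : ∃ G : M → 𝕜, ∀ᶠ y in 𝓝 x, FunAnalyticAt 𝕜 (Model 𝕜 k) G y ∧ G y ≠ 0 ∧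
      dualPower σ y = G y • dualPower σ' y ∧
      (∀ w, omega (fields F σ) y w = omega (fields F' σ') y w +
        (G y)⁻¹ * mvfderiv 𝓘(𝕜, Model 𝕜 k) G y w) ∧
      (F' = F → ∀ l, basicFamily (fields F σ) l y = G y • basicFamily (fields F' σ') l y) := by
  obtain ⟨τ, a, ha, hev⟩ := h.exists_change h' hx hx'
  refine ⟨fun y => a y ^ (k + 1), ?_⟩
  filter_upwards [ha.eventually, hev, hev.eventually_nhds, h.mem_nhds hx, h'.mem_nhds hx']
    with y hay hy hyev hyU hyU'
  refine ⟨hay.pow (k + 1), pow_ne_zero _ hy.1, ?_, fun w => ?_, ?_⟩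
  · rw [eq_smul_dualPower_iff (h'.ne_zero y hyU'), hy.2.1, coord_smul,
      coord_dualPower (h.ne_zero y hyU), mul_one]
  · exact (h.isAdaptedAt hyU).omega_perm (h'.isAdaptedAt hyU') τ hay hy.1
      (hyev.mono fun z hz => hz.2.2.2) w
  · rintro rfl l
    have hτ1 : τ = 1 := by
      ext1 l
      exact (h.ordering.injective hyU (hy.2.2.1 l)).symm
    have := (h.isAdaptedAt hyU).basicFamily_perm (h'.isAdaptedAt hyU') τ hy.1 hy.2.2.2 l
    rw [hτ1, permDet_one, one_mul] at this
    exact this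

end CurveWeb

end Frames

/-! ### The connection and its curvature -/

section ConnectionCurvature

section Derivative

variable {𝕜 : Type*} [RCLike 𝕜]
  {E : Type*} [NormedAddCommGroup E] [NormedSpace 𝕜 E] [FiniteDimensional 𝕜 E] [CompleteSpace E]
  {M : Type*} [TopologicalSpace M] [ChartedSpace E M] {f g : M → 𝕜} {x : M}

lemma mvfderiv_congr (h : ∀ᶠ y in 𝓝 x, f y = g y) :
    mvfderiv 𝓘(𝕜, E) f x = mvfderiv 𝓘(𝕜, E) g x := by
  have h0 : f x = g x := h.self_of_nhds
  have h1 : f =ᶠ[𝓝 x] g := h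
  ext w
  unfold mvfderiv
  rw [h1.mfderiv_eq]
  rfl

lemma mvfderiv_mul_apply (hf : FunAnalyticAt 𝕜 E f x) (hg : FunAnalyticAt 𝕜 E g x)
    [IsManifold 𝓘(𝕜, E) ω M] (w : TangentSpace 𝓘(𝕜, E) x) :
    mvfderiv 𝓘(𝕜, E) (fun y => f y * g y) x w =
      f x * mvfderiv 𝓘(𝕜, E) g x w + g x * mvfderiv 𝓘(𝕜, E) f x w :=
  DFunLike.congr_fun (mvfderiv_mul hf.mdifferentiableAt hg.mdifferentiableAt) w

lemma mvfderiv_add_apply (hf : FunAnalyticAt 𝕜 E f x) (hg : FunAnalyticAt 𝕜 E g x)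
    [IsManifold 𝓘(𝕜, E) ω M] (w : TangentSpace 𝓘(𝕜, E) x) :
    mvfderiv 𝓘(𝕜, E) (fun y => f y + g y) x w =
      mvfderiv 𝓘(𝕜, E) f x w + mvfderiv 𝓘(𝕜, E) g x w :=
  DFunLike.congr_fun (mvfderiv_add hf.mdifferentiableAt hg.mdifferentiableAt) w

end Derivative

variable {𝕜 : Type*} [RCLike 𝕜] {k : ℕ}
  {M : Type*} [TopologicalSpace M] [ChartedSpace (Model 𝕜 k) M]
  [IsManifold 𝓘(𝕜, Model 𝕜 k) ω M]

namespace CurveWeb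

variable {W : CurveWeb 𝕜 k M} {U U' : Set M} {F F' : Fin (k + 3) → Distribution 𝕜 (Model 𝕜 k) M}
  {σ σ' : (x : M) → W.E x} {x : M} {s t : (x : M) → W.L x}

/-- The component of a section with respect to `σ̂^{⊗(n-1)}`. -/
def sectionCoord (σ : (x : M) → W.E x) (s : (x : M) → W.L x) (x : M) : 𝕜 := coord (σ x) (s x)

namespace IsFrame

lemma sectionCoord_smul_dualPower (h : W.IsFrame U F σ) (hx : x ∈ U) (s : (x : M) → W.L x) :
    sectionCoord σ s x • dualPower σ x = s x := coord_smul_dualPower (h.ne_zero x hx) (s x)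

lemma eventually_eq_smul_dualPower_iff (h : W.IsFrame U F σ) (hx : x ∈ U) {f : M → 𝕜} :
    (∀ᶠ y in 𝓝 x, s y = f y • dualPower σ y) ↔ ∀ᶠ y in 𝓝 x, sectionCoord σ s y = f y := by
  constructor <;> intro h1 <;> filter_upwards [h1, h.mem_nhds hx] with y hy hyU
  · exact (eq_smul_dualPower_iff (h.ne_zero y hyU)).1 hy
  · exact (eq_smul_dualPower_iff (h.ne_zero y hyU)).2 hy

/-- Analyticity of a section can be tested with any frame. -/
lemma sectionAnalyticAt_iff (h : W.IsFrame U F σ) (hx : x ∈ U) :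
    SectionAnalyticAt s x ↔ FunAnalyticAt 𝕜 (Model 𝕜 k) (sectionCoord σ s) x := by
  constructor
  · rintro ⟨U', F', σ', h', hx', f, hf, hs⟩
    obtain ⟨G, hG⟩ := h'.exists_transition h hx' hx
    refine ContMDiffAt.congr_of_eventuallyEq (hf.mul hG.self_of_nhds.1) ?_
    refine (h.eventually_eq_smul_dualPower_iff hx).1 ?_
    filter_upwards [hs, hG] with y hy hGy
    rw [hy, hGy.2.2.1, smul_smul]
    rfl
  · intro hf
    exact ⟨U, F, σ, h, hx, _, hf, (h.eventually_eq_smul_dualPower_iff hx).2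
      (Eventually.of_forall fun _ => rfl)⟩

end IsFrame

lemma SectionAnalyticAt.eventually (hs : SectionAnalyticAt s x) :
    ∀ᶠ y in 𝓝 x, SectionAnalyticAt s y := by
  obtain ⟨U, F, σ, hx, h⟩ := exists_isFrame_of_mem W x
  filter_upwards [FunAnalyticAt.eventually ((h.sectionAnalyticAt_iff hx).1 hs), h.mem_nhds hx]
    with y hy hyU
  exact (h.sectionAnalyticAt_iff hyU).2 hy

/-- The connection in a frame: `∇_w (f σ̂^{⊗(n-1)}) = (df(w) + f ω(w)) σ̂^{⊗(n-1)}`. -/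
def frameNabla (F : Fin (k + 3) → Distribution 𝕜 (Model 𝕜 k) M) (σ : (x : M) → W.E x)
    (s : (x : M) → W.L x) (x : M) : TangentSpace 𝓘(𝕜, Model 𝕜 k) x →ₗ[𝕜] W.L x :=
  ((mvfderiv 𝓘(𝕜, Model 𝕜 k) (sectionCoord σ s) x +
    sectionCoord σ s x • omega (fields F σ) x : TangentSpace 𝓘(𝕜, Model 𝕜 k) x →L[𝕜] 𝕜) :
      TangentSpace 𝓘(𝕜, Model 𝕜 k) x →ₗ[𝕜] 𝕜).smulRight (dualPower σ x)

lemma frameNabla_apply (w : TangentSpace 𝓘(𝕜, Model 𝕜 k) x) : frameNabla F σ s x w =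
    (mvfderiv 𝓘(𝕜, Model 𝕜 k) (sectionCoord σ s) x w +
      sectionCoord σ s x * omega (fields F σ) x w) • dualPower σ x := rfl

/-- The connections defined by two frames agree. -/
lemma IsFrame.nabla_eq (h : W.IsFrame U F σ) (h' : W.IsFrame U' F' σ') (hx : x ∈ U) (hx' : x ∈ U')
    {f f' : M → 𝕜} (hf : FunAnalyticAt 𝕜 (Model 𝕜 k) f x)
    (hff' : ∀ᶠ y in 𝓝 x, f y • dualPower σ y = f' y • dualPower σ' y)
    (w : TangentSpace 𝓘(𝕜, Model 𝕜 k) x) :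
    (mvfderiv 𝓘(𝕜, Model 𝕜 k) f x w + f x * omega (fields F σ) x w) • dualPower σ x =
      (mvfderiv 𝓘(𝕜, Model 𝕜 k) f' x w + f' x * omega (fields F' σ') x w) • dualPower σ' x := by
  obtain ⟨G, hG⟩ := h.exists_transition h' hx hx'
  have hf' : ∀ᶠ y in 𝓝 x, f' y = f y * G y := by
    filter_upwards [hff', hG, h'.mem_nhds hx'] with y hy hGy hyU
    rw [hGy.2.2.1, smul_smul] at hy
    exact ((smul_dualPower_inj (h'.ne_zero y hyU)).1 hy).symm
  obtain ⟨hGa, hG0, hGd, hGo, _⟩ := hG.self_of_nhds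
  rw [hGd, smul_smul, mvfderiv_congr hf', mvfderiv_mul_apply hf hGa, hf'.self_of_nhds, hGo]
  congr 1
  field_simp
  ring

lemma IsFrame.frameNabla_eq (h : W.IsFrame U F σ) (h' : W.IsFrame U' F' σ') (hx : x ∈ U)
    (hx' : x ∈ U') (hs : SectionAnalyticAt s x) : frameNabla F σ s x = frameNabla F' σ' s x := by
  ext w
  refine h.nabla_eq h' hx hx' ((h.sectionAnalyticAt_iff hx).1 hs) ?_ w
  filter_upwards [h.mem_nhds hx, h'.mem_nhds hx'] with y hy hy'
  rw [h.sectionCoord_smul_dualPower hy, h'.sectionCoord_smul_dualPower hy']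

variable (W) in
/-- The global connection: `∇` is computed at `x` in a frame near `x`. -/
def webNabla (s : (x : M) → W.L x) (x : M) : TangentSpace 𝓘(𝕜, Model 𝕜 k) x →ₗ[𝕜] W.L x :=
  frameNabla (exists_isFrame_of_mem W x).choose_spec.choose
    (exists_isFrame_of_mem W x).choose_spec.choose_spec.choose s x

lemma IsFrame.webNabla_eq (h : W.IsFrame U F σ) (hx : x ∈ U) (hs : SectionAnalyticAt s x) :
    W.webNabla s x = frameNabla F σ s x :=
  have h1 := (exists_isFrame_of_mem W x).choose_spec.choose_spec.choose_spec
  h1.2.frameNabla_eq h h1.1 hx hs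

lemma IsFrame.webNabla_apply (h : W.IsFrame U F σ) (hx : x ∈ U) {f : M → 𝕜}
    (hf : FunAnalyticAt 𝕜 (Model 𝕜 k) f x) (hs : ∀ᶠ y in 𝓝 x, s y = f y • dualPower σ y)
    (w : TangentSpace 𝓘(𝕜, Model 𝕜 k) x) : W.webNabla s x w =
      (mvfderiv 𝓘(𝕜, Model 𝕜 k) f x w + f x * omega (fields F σ) x w) • dualPower σ x := by
  rw [h.webNabla_eq hx ⟨U, F, σ, h, hx, f, hf, hs⟩, frameNabla_apply]
  have h1 := (h.eventually_eq_smul_dualPower_iff hx).1 hs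
  rw [mvfderiv_congr h1, h1.self_of_nhds]

/-- The section `∇_X s`, near a point. -/
lemma IsFrame.eventually_webNabla (h : W.IsFrame U F σ) (hx : x ∈ U) (hs : SectionAnalyticAt s x)
    (X : VField 𝕜 (Model 𝕜 k) M) : ∀ᶠ y in 𝓝 x, W.webNabla s y (X y) =
      (mvfderiv 𝓘(𝕜, Model 𝕜 k) (sectionCoord σ s) y (X y) +
        sectionCoord σ s y * omega (fields F σ) y (X y)) • dualPower σ y := by
  filter_upwards [hs.eventually, h.mem_nhds hx] with y hy hyU
  rw [h.webNabla_eq hyU hy, frameNabla_apply]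

lemma IsFrame.funAnalyticAt_omega (h : W.IsFrame U F σ) (hx : x ∈ U) {X : VField 𝕜 (Model 𝕜 k) M}
    (hX : X.AnalyticAt x) :
    FunAnalyticAt 𝕜 (Model 𝕜 k) (fun y => omega (fields F σ) y (X y)) x :=
  (h.isAdaptedAt hx).omega_analyticAt.apply (X := fun _ => X) fun _ => hX

lemma IsFrame.funAnalyticAt_webNabla (h : W.IsFrame U F σ) (hx : x ∈ U)
    (hs : SectionAnalyticAt s x) {X : VField 𝕜 (Model 𝕜 k) M} (hX : X.AnalyticAt x) :
    FunAnalyticAt 𝕜 (Model 𝕜 k) (fun y => mvfderiv 𝓘(𝕜, Model 𝕜 k) (sectionCoord σ s) y (X y) +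
        sectionCoord σ s y * omega (fields F σ) y (X y)) x :=
  have hc := (h.sectionAnalyticAt_iff hx).1 hs
  (FunAnalyticAt.mvfderiv hc hX).add (ContMDiffAt.mul hc (h.funAnalyticAt_omega hx hX))

variable (W) in
/-- The connection `∇` on `⊗^{n-1} E*`. -/
def webConnection : W.Connection where
  nabla := W.webNabla
  nabla_congr s t x hs hst := by
    obtain ⟨U, F, σ, hx, h⟩ := exists_isFrame_of_mem W x
    have h1 : ∀ᶠ y in 𝓝 x, s y = sectionCoord σ s y • dualPower σ y := by
      filter_upwards [h.mem_nhds hx] with y hy using (h.sectionCoord_smul_dualPower hy s).symm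
    have hc := (h.sectionAnalyticAt_iff hx).1 hs
    ext w
    rw [h.webNabla_apply hx hc h1, h.webNabla_apply hx hc (by
      filter_upwards [h1, hst] with y a b using b.symm.trans a)]
  nabla_add s t x hs ht := by
    obtain ⟨U, F, σ, hx, h⟩ := exists_isFrame_of_mem W x
    have hcs := (h.sectionAnalyticAt_iff hx).1 hs
    have hct := (h.sectionAnalyticAt_iff hx).1 ht
    ext w
    rw [LinearMap.add_apply, h.webNabla_eq hx hs, h.webNabla_eq hx ht,
      h.webNabla_apply hx (f := fun y => sectionCoord σ s y + sectionCoord σ t y) (hcs.add hct),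
      mvfderiv_add_apply hcs hct, frameNabla_apply, frameNabla_apply, ← add_smul]
    · congr 1; ring
    · filter_upwards [h.mem_nhds hx] with y hy
      rw [add_smul, h.sectionCoord_smul_dualPower hy, h.sectionCoord_smul_dualPower hy]
  leibniz f s x hf hs w := by
    obtain ⟨U, F, σ, hx, h⟩ := exists_isFrame_of_mem W x
    have hc := (h.sectionAnalyticAt_iff hx).1 hs
    rw [h.webNabla_eq hx hs, h.webNabla_apply hx (f := fun y => f y * sectionCoord σ s y)
      (hf.mul hc), mvfderiv_mul_apply hf hc, frameNabla_apply, smul_smul]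
    · rw [← h.sectionCoord_smul_dualPower hx s, smul_smul, ← add_smul]
      congr 1
      ring
    · filter_upwards [h.mem_nhds hx] with y hy
      rw [mul_smul, h.sectionCoord_smul_dualPower hy]
  analytic U' s X hU' hs hX x hx' := by
    obtain ⟨U, F, σ, hx, h⟩ := exists_isFrame_of_mem W x
    have hX' := hX.analyticAt hU' hx'
    exact ⟨U, F, σ, h, hx, _, h.funAnalyticAt_webNabla hx (hs x hx') hX',
      h.eventually_webNabla hx (hs x hx') X⟩

lemma IsFrame.sectionAnalyticAt_dualPower (h : W.IsFrame U F σ) (hx : x ∈ U) :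
    SectionAnalyticAt (dualPower σ) x :=
  ⟨U, F, σ, h, hx, fun _ => 1, contMDiffAt_const, Eventually.of_forall fun _ => (one_smul 𝕜 _).symm⟩

lemma IsFrame.webNabla_dualPower (h : W.IsFrame U F σ) (hx : x ∈ U)
    (w : TangentSpace 𝓘(𝕜, Model 𝕜 k) x) :
    W.webNabla (dualPower σ) x w = omega (fields F σ) x w • dualPower σ x := by
  have h1 : FunAnalyticAt 𝕜 (Model 𝕜 k) (fun _ : M => (1 : 𝕜)) x := contMDiffAt_const
  rw [h.webNabla_apply hx h1 (Eventually.of_forall fun _ => (one_smul 𝕜 _).symm), mvfderiv_const,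
    one_mul]
  congr 1
  exact zero_add _

/-- A connection is determined by its values on the sections `σ̂^{⊗(n-1)}`. -/
lemma Connection.nabla_eq_webNabla (D : W.Connection)
    (hD : ∀ U F σ, W.IsFrame U F σ → ∀ x ∈ U, ∀ w : TangentSpace 𝓘(𝕜, Model 𝕜 k) x,
      D.nabla (dualPower σ) x w = omega (fields F σ) x w • dualPower σ x)
    (hs : SectionAnalyticAt s x) : D.nabla s x = W.webNabla s x := by
  obtain ⟨U, F, σ, hx, h⟩ := exists_isFrame_of_mem W x
  have hc := (h.sectionAnalyticAt_iff hx).1 hs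
  have hev : ∀ᶠ y in 𝓝 x, s y = sectionCoord σ s y • dualPower σ y := by
    filter_upwards [h.mem_nhds hx] with y hy using (h.sectionCoord_smul_dualPower hy s).symm
  ext w
  rw [D.nabla_congr s _ x hs hev, D.leibniz _ _ x hc (h.sectionAnalyticAt_dualPower hx),
    hD U F σ h x hx, h.webNabla_apply hx hc hev, smul_smul, ← add_smul]

/-- The curvature of `∇` in a frame is `dω`. -/
lemma IsFrame.curvature (h : W.IsFrame U F σ) (hx : x ∈ U) (hs : SectionAnalyticAt s x)
    {X Y : VField 𝕜 (Model 𝕜 k) M} (hX : X.AnalyticAt x) (hY : Y.AnalyticAt x) :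
    W.webNabla (fun y => W.webNabla s y (Y y)) x (X x) -
      W.webNabla (fun y => W.webNabla s y (X y)) x (Y x) -
        W.webNabla s x (VectorField.mlieBracket 𝓘(𝕜, Model 𝕜 k) X Y x) =
      (omega (fields F σ)).toForm.d x ![X x, Y x] • s x := by
  have hc := (h.sectionAnalyticAt_iff hx).1 hs
  have hder : ∀ {Z : VField 𝕜 (Model 𝕜 k) M} (_ : Z.AnalyticAt x) (w : TangentSpace 𝓘(𝕜, Model 𝕜 k) x),
      mvfderiv 𝓘(𝕜, Model 𝕜 k) (fun y => mvfderiv 𝓘(𝕜, Model 𝕜 k) (sectionCoord σ s) y (Z y) +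
        sectionCoord σ s y * omega (fields F σ) y (Z y)) x w =
      mvfderiv 𝓘(𝕜, Model 𝕜 k) (fun y => mvfderiv 𝓘(𝕜, Model 𝕜 k) (sectionCoord σ s) y (Z y)) x w +
        (sectionCoord σ s x *
          mvfderiv 𝓘(𝕜, Model 𝕜 k) (fun y => omega (fields F σ) y (Z y)) x w +
          omega (fields F σ) x (Z x) * mvfderiv 𝓘(𝕜, Model 𝕜 k) (sectionCoord σ s) x w) := by
    intro Z hZ w
    have hm : FunAnalyticAt 𝕜 (Model 𝕜 k)
        (fun y => sectionCoord σ s y * omega (fields F σ) y (Z y)) x :=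
      ContMDiffAt.mul hc (h.funAnalyticAt_omega hx hZ)
    rw [mvfderiv_add_apply (FunAnalyticAt.mvfderiv hc hZ) hm,
      mvfderiv_mul_apply hc (h.funAnalyticAt_omega hx hZ)]
  have hd := Form.d_one_apply (h.isAdaptedAt hx).omega_analyticAt hX hY
  have hl := mvfderiv_mlieBracket hc hX hY
  rw [h.webNabla_apply hx (h.funAnalyticAt_webNabla hx hs hY) (h.eventually_webNabla hx hs Y),
    h.webNabla_apply hx (h.funAnalyticAt_webNabla hx hs hX) (h.eventually_webNabla hx hs X),
    h.webNabla_eq hx hs, frameNabla_apply, hder hX, hder hY, ← sub_smul, ← sub_smul,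
    hl]
  rw [hd, ← h.sectionCoord_smul_dualPower hx s, smul_smul]
  congr 1
  change _ = (mvfderiv 𝓘(𝕜, Model 𝕜 k) (fun y => omega (fields F σ) y (Y y)) x (X x) -
    mvfderiv 𝓘(𝕜, Model 𝕜 k) (fun y => omega (fields F σ) y (X y)) x (Y x) -
      omega (fields F σ) x (VectorField.mlieBracket 𝓘(𝕜, Model 𝕜 k) X Y x)) * _
  ring

lemma IsFrame.d_omega_eq (h : W.IsFrame U F σ) (h' : W.IsFrame U' F' σ') (hx : x ∈ U)
    (hx' : x ∈ U') : (omega (fields F σ)).toForm.d x = (omega (fields F' σ')).toForm.d x := by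
  refine (h.isAdaptedAt hx).isFrameAt.ext fun r _ => ?_
  have ha := fun i => (h.isAdaptedAt hx).isFrameAt.analytic (r i)
  have hs := h.sectionAnalyticAt_dualPower hx
  have h1 := (h.curvature hx hs (ha 0) (ha 1)).symm.trans (h'.curvature hx' hs (ha 0) (ha 1))
  have e : (fun a => fields F σ (r a).castSucc x) =
      ![fields F σ (r 0).castSucc x, fields F σ (r 1).castSucc x] := by
    funext a; fin_cases a <;> rfl
  rw [e]
  exact (smul_dualPower_inj (h.ne_zero x hx)).1 h1

variable (W) in
/-- The curvature of `∇`. -/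
def webCurvature : Form 𝕜 (Model 𝕜 k) M 2 := fun x =>
  (omega (fields (exists_isFrame_of_mem W x).choose_spec.choose
    (exists_isFrame_of_mem W x).choose_spec.choose_spec.choose)).toForm.d x

lemma IsFrame.webCurvature_eq (h : W.IsFrame U F σ) (hx : x ∈ U) :
    W.webCurvature x = (omega (fields F σ)).toForm.d x :=
  have h1 := (exists_isFrame_of_mem W x).choose_spec.choose_spec.choose_spec
  h1.2.d_omega_eq h h1.1 hx

lemma webCurvature_analyticAt (W : CurveWeb 𝕜 k M) (x : M) : W.webCurvature.AnalyticAt x := by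
  obtain ⟨U, F, σ, hx, h⟩ := exists_isFrame_of_mem W x
  refine (h.isAdaptedAt hx).isFrameAt.analyticAt_iff.2 fun r => ?_
  have ha := fun i => (h.isAdaptedAt hx).isFrameAt.analytic (r i)
  have h1 := (FunAnalyticAt.mvfderiv (h.funAnalyticAt_omega hx (ha 1)) (ha 0)).sub
    (FunAnalyticAt.mvfderiv (h.funAnalyticAt_omega hx (ha 0)) (ha 1)) |>.sub
    (h.funAnalyticAt_omega hx ((ha 0).mlieBracket (ha 1)))
  refine ContMDiffAt.congr_of_eventuallyEq h1 ?_
  filter_upwards [h.mem_nhds hx] with y hy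
  have hb := fun i => (h.isAdaptedAt hy).isFrameAt.analytic (r i)
  have e : (fun a => fields F σ (r a).castSucc y) =
      ![fields F σ (r 0).castSucc y, fields F σ (r 1).castSucc y] := by
    funext a; fin_cases a <;> rfl
  rw [h.webCurvature_eq hy, e]
  exact Form.d_one_apply (h.isAdaptedAt hy).omega_analyticAt (hb 0) (hb 1)

lemma webConnection_isCurvature (W : CurveWeb 𝕜 k M) :
    W.webConnection.IsCurvature W.webCurvature := by
  intro U₁ s X Y hU₁ hs hX hY x hx₁
  obtain ⟨U, F, σ, hx, h⟩ := exists_isFrame_of_mem W x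
  rw [h.webCurvature_eq hx]
  exact h.curvature hx (hs x hx₁) (hX.analyticAt hU₁ hx₁) (hY.analyticAt hU₁ hx₁)

end CurveWeb

end ConnectionCurvature

/-! ### Locality of abelian relations -/

section Locality

variable {𝕜 : Type*} [RCLike 𝕜]
  {E : Type*} [NormedAddCommGroup E] [NormedSpace 𝕜 E] [FiniteDimensional 𝕜 E] [CompleteSpace E]
  {M : Type*} [TopologicalSpace M] [ChartedSpace E M] [IsManifold 𝓘(𝕜, E) ω M] {p : ℕ}
  {ι : Type*} [Fintype ι] {F : ι → Distribution 𝕜 E M} {U : Set M} {η θ : ι → Form 𝕜 E M (p + 1)}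

lemma IsAbelianRelation.mono (h : IsAbelianRelation F U η) {U' : Set M} (hU' : U' ⊆ U) :
    IsAbelianRelation F U' η :=
  ⟨fun i x hx => h.analytic i x (hU' hx), fun i => (h.basic i).mono hU',
    fun x hx => h.sum_eq_zero x (hU' hx)⟩

lemma IsAbelianRelation.congr (h : IsAbelianRelation F U η) (hU : IsOpen U)
    (hηθ : ∀ i, ∀ x ∈ U, θ i x = η i x) : IsAbelianRelation F U θ := by
  have hev : ∀ i, ∀ x ∈ U, ∀ᶠ y in 𝓝 x, η i y = θ i y := fun i x hx => by
    filter_upwards [hU.mem_nhds hx] with y hy using (hηθ i y hy).symm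
  refine ⟨fun i x hx => (h.analytic i x hx).congr (hev i x hx), fun i U' hU' ho v hv hvF => ?_,
    fun x hx => ?_⟩
  · have h1 := h.basic i U' hU' ho v hv hvF
    have h0 : ∀ y ∈ U', interiorProduct v (θ i) y = 0 := fun y hy => by
      change interiorAt (v y) (θ i y) = 0
      rw [hηθ i y (hU' hy)]
      exact (h1 y hy).1
    refine fun y hy => ⟨h0 y hy, ?_⟩
    have h2 := (h1 y hy).2
    rw [lieDeriv_eq ho (fun z hz => (h1 z hz).1) hy] at h2
    rw [lieDeriv_eq ho h0 hy, ← Form.d_congr (hev i y (hU' hy)), h2]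
  · rw [← h.sum_eq_zero x hx]
    exact Finset.sum_congr rfl fun i _ => hηθ i x hx

lemma isAbelianRelation_of_local
    (h : ∀ x ∈ U, ∃ U₁, IsOpen U₁ ∧ x ∈ U₁ ∧ IsAbelianRelation F U₁ η) :
    IsAbelianRelation F U η := by
  refine ⟨fun i x hx => ?_, fun i U' hU' ho v hv hvF y hy => ?_, fun x hx => ?_⟩
  · obtain ⟨U₁, _, hx₁, h₁⟩ := h x hx
    exact h₁.analytic i x hx₁
  · obtain ⟨U₁, ho₁, hy₁, h₁⟩ := h y (hU' hy)
    exact h₁.basic i (U' ∩ U₁) inter_subset_right (ho.inter ho₁) v (hv.mono inter_subset_left)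
      (fun z hz => hvF z hz.1) y ⟨hy, hy₁⟩
  · obtain ⟨U₁, _, hx₁, h₁⟩ := h x hx
    exact h₁.sum_eq_zero x hx₁

end Locality

/-! ### Abelian relations and flat sections -/

section AbelianRank

variable {𝕜 : Type*} [RCLike 𝕜] {k : ℕ}
  {M : Type*} [TopologicalSpace M] [ChartedSpace (Model 𝕜 k) M]
  [IsManifold 𝓘(𝕜, Model 𝕜 k) ω M]

namespace CurveWeb

variable {W : CurveWeb 𝕜 k M} {U U' : Set M} {F F' : Fin (k + 3) → Distribution 𝕜 (Model 𝕜 k) M}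
  {σ σ' : (x : M) → W.E x} {x : M} {s t : (x : M) → W.L x}
  {η : Fin (k + 3) → Form 𝕜 (Model 𝕜 k) M (k + 1)}

namespace IsFrame

lemma isAbelianRelation_iff (h : W.IsFrame U F σ) {f : M → 𝕜} :
    IsAbelianRelation F U (fun l x => f x • basicFamily (fields F σ) l x) ↔
      ∀ x ∈ U, FunAnalyticAt 𝕜 (Model 𝕜 k) f x ∧
        mvfderiv 𝓘(𝕜, Model 𝕜 k) f x + f x • omega (fields F σ) x = 0 :=
  isAbelianRelation_smul_basicFamily_iff h.ordering.isOpen (fun _ hx => h.isAdaptedAt hx)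
    h.span_fields

lemma exists_eq_smul (h : W.IsFrame U F σ) (hη : IsAbelianRelation F U η) :
    ∃ f : M → 𝕜, (∀ l, ∀ x ∈ U, η l x = f x • basicFamily (fields F σ) l x) ∧
      IsAbelianRelation F U (fun l x => f x • basicFamily (fields F σ) l x) := by
  have h1 : ∀ x, ∃ c : 𝕜, x ∈ U → ∀ l, η l x = c • basicFamily (fields F σ) l x := by
    intro x
    by_cases hx : x ∈ U
    · obtain ⟨c, hc⟩ := hη.exists_eq_smul h.ordering.isOpen (fun _ hx => h.isAdaptedAt hx)
        h.span_fields hx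
      exact ⟨c, fun _ => hc⟩
    · exact ⟨0, fun hx' => absurd hx' hx⟩
  choose f hf using h1
  exact ⟨f, fun l x hx => hf x hx l,
    hη.congr h.ordering.isOpen fun l x hx => (hf x hx l).symm⟩

/-- A nonzero section with zero covariant derivative near a point forces the curvature to vanish. -/
lemma webCurvature_eq_zero (h : W.IsFrame U F σ) (hx : x ∈ U) {f : M → 𝕜}
    (hf : ∀ᶠ y in 𝓝 x, FunAnalyticAt 𝕜 (Model 𝕜 k) f y ∧
      mvfderiv 𝓘(𝕜, Model 𝕜 k) f y + f y • omega (fields F σ) y = 0) (h0 : f x ≠ 0) :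
    W.webCurvature x = 0 := by
  let s : (x : M) → W.L x := fun y => f y • dualPower σ y
  have hs : SectionAnalyticAt s x :=
    ⟨U, F, σ, h, hx, f, hf.self_of_nhds.1, Eventually.of_forall fun _ => rfl⟩
  have hn : ∀ᶠ y in 𝓝 x, W.webNabla s y = 0 := by
    filter_upwards [hf, h.mem_nhds hx] with y hy hyU
    ext w
    rw [h.webNabla_apply hyU hy.1 (Eventually.of_forall fun _ => rfl)]
    have := DFunLike.congr_fun hy.2 w
    exact (congrArg (fun c : 𝕜 => c • dualPower σ y) this).trans (zero_smul 𝕜 _)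
  have hz : ∀ {X : VField 𝕜 (Model 𝕜 k) M}, W.webNabla (fun y => W.webNabla s y (X y)) x = 0 := by
    intro X
    have hc : FunAnalyticAt 𝕜 (Model 𝕜 k) (fun _ : M => (0 : 𝕜)) x := contMDiffAt_const
    ext w
    rw [h.webNabla_apply hx hc (hn.mono fun y hy => by rw [hy, zero_smul]; rfl), mvfderiv_const,
      zero_mul, add_zero]
    exact zero_smul 𝕜 _
  rw [h.webCurvature_eq hx]
  refine (h.isAdaptedAt hx).isFrameAt.ext fun r _ => ?_
  have ha := fun i => (h.isAdaptedAt hx).isFrameAt.analytic (r i)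
  have h1 := h.curvature hx hs (ha 0) (ha 1)
  rw [hz, hz, hn.self_of_nhds, LinearMap.zero_apply, LinearMap.zero_apply, LinearMap.zero_apply,
    sub_zero, sub_zero] at h1
  have e : (fun a => fields F σ (r a).castSucc x) =
      ![fields F σ (r 0).castSucc x, fields F σ (r 1).castSucc x] := by
    funext a; fin_cases a <;> rfl
  rw [e]
  change (0 : W.L x) = _ • (f x • dualPower σ x) at h1
  rw [smul_smul, ← zero_smul 𝕜 (dualPower σ x), smul_dualPower_inj (h.ne_zero x hx)] at h1
  exact (mul_eq_zero.1 h1.symm).resolve_right h0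

/-- If the curvature vanishes near a point, then `df + f ω = 0` has a solution without zeros: the
exponential of a primitive of `-ω`. -/
lemma exists_solution (h : W.IsFrame U F σ) (hx : x ∈ U)
    (hΩ : ∀ᶠ y in 𝓝 x, W.webCurvature y = 0) : ∃ f : M → 𝕜, ∀ᶠ y in 𝓝 x,
      FunAnalyticAt 𝕜 (Model 𝕜 k) f y ∧ f y ≠ 0 ∧
        mvfderiv 𝓘(𝕜, Model 𝕜 k) f y + f y • omega (fields F σ) y = 0 := by
  have hd : ∀ᶠ y in 𝓝 x, (omega (fields F σ)).toForm.d y = 0 := by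
    filter_upwards [hΩ, h.mem_nhds hx] with y hy hyU
    rw [← h.webCurvature_eq hyU, hy]
  obtain ⟨g, hg⟩ := CovectorField.exists_primitive (h.isAdaptedAt hx).omega_analyticAt hd
  refine ⟨fun y => NormedSpace.exp (-g y), ?_⟩
  filter_upwards [hg] with y hy
  have hys := mem_extChartAt_source (I := 𝓘(𝕜, Model 𝕜 k)) y
  have hga := (contMDiffAt_iff_analyticAt_comp_symm hys).1 hy.1
  have hea : FunAnalyticAt 𝕜 (Model 𝕜 k) (fun y => NormedSpace.exp (-g y)) y :=
    (contMDiffAt_iff_analyticAt_comp_symm hys).2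
      (AnalyticAt.comp (g := NormedSpace.exp) (NormedSpace.exp_analytic _) hga.neg)
  have hne : NormedSpace.exp (-g y) ≠ 0 := (NormedSpace.isUnit_exp_of_mem_ball (𝕂 := 𝕜)
    (by rw [NormedSpace.expSeries_radius_eq_top 𝕜 𝕜]; exact edist_lt_top _ _)).ne_zero
  refine ⟨hea, hne, ?_⟩
  ext w
  have h1 := HasDerivAt.comp_hasFDerivAt (extChartAt 𝓘(𝕜, Model 𝕜 k) y y)
    (hasDerivAt_exp (𝕂 := 𝕜)) hga.differentiableAt.hasFDerivAt.neg
  have h2 := mvfderiv_eq_fderiv hys hy.1.mdifferentiableAt w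
  have h3 := mvfderiv_eq_fderiv hys hea.mdifferentiableAt w
  rw [show (fun y => NormedSpace.exp (-g y)) ∘ (extChartAt 𝓘(𝕜, Model 𝕜 k) y).symm =
    NormedSpace.exp ∘ (-(g ∘ (extChartAt 𝓘(𝕜, Model 𝕜 k) y).symm)) from rfl, h1.fderiv] at h3
  rw [hy.2] at h2
  have h4 : (-(g ∘ (extChartAt 𝓘(𝕜, Model 𝕜 k) y).symm)) (extChartAt 𝓘(𝕜, Model 𝕜 k) y y) =
      -g y := by
    rw [Pi.neg_apply, Function.comp_apply, extChartAt_to_inv]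
  rw [h4] at h3
  change mvfderiv 𝓘(𝕜, Model 𝕜 k) (fun y => NormedSpace.exp (-g y)) y w +
    NormedSpace.exp (-g y) * omega (fields F σ) y w = 0
  rw [h2]
  refine (congrArg (fun c : 𝕜 => c + _) h3).trans ?_
  change NormedSpace.exp (-g y) * -_ + _ = (0 : 𝕜)
  rw [mul_neg]
  exact neg_add_cancel _

end IsFrame

open scoped Classical in
/-- The map `σ̂^{⊗(n-1)} ↦ (A_l)_l`, computed in a frame near each point of `U`. -/
def relationMap (h : IsOrdering W.lines U F) (x : M) : W.L x →ₗ[𝕜]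
    (Fin (k + 3) → (TangentSpace 𝓘(𝕜, Model 𝕜 k) x) [⋀^Fin (k + 1)]→L[𝕜] 𝕜) :=
  if hx : x ∈ U then
    LinearMap.pi fun l => (coord ((exists_isFrame h hx).choose_spec.2.choose x)).smulRight
      (basicFamily (fields F (exists_isFrame h hx).choose_spec.2.choose) l x)
  else 0

lemma IsFrame.relationMap_apply (h : IsOrdering W.lines U F) (h' : W.IsFrame U' F σ) (hU' : U' ⊆ U)
    (hx : x ∈ U') (t : W.L x) (l : Fin (k + 3)) :
    relationMap h x t l = coord (σ x) t • basicFamily (fields F σ) l x := by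
  obtain ⟨hx₁, h₁⟩ := (exists_isFrame h (hU' hx)).choose_spec.2.choose_spec
  set σ₁ := (exists_isFrame h (hU' hx)).choose_spec.2.choose with hσ₁
  have h0 : relationMap h x t l = coord (σ₁ x) t • basicFamily (fields F σ₁) l x := by
    unfold relationMap
    rw [dif_pos (hU' hx)]
    rfl
  obtain ⟨G, hG⟩ := h'.exists_transition h₁ hx hx₁
  obtain ⟨_, _, hd, _, hA⟩ := hG.self_of_nhds
  have hc : coord (σ₁ x) t = coord (σ x) t * G x := by
    rw [← eq_smul_dualPower_iff (h₁.ne_zero x hx₁), mul_smul, ← hd,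
      coord_smul_dualPower (h'.ne_zero x hx)]
  rw [h0, hA rfl l, hc, smul_smul]

lemma relationMap_dualPower (h : IsOrdering W.lines U F) (h' : W.IsFrame U' F σ) (hU' : U' ⊆ U)
    (hx : x ∈ U') (l : Fin (k + 3)) :
    relationMap h x (dualPower σ x) l = basicFamily (fields F σ) l x := by
  rw [h'.relationMap_apply h hU' hx, coord_dualPower (h'.ne_zero x hx), one_smul]

lemma relationMap_injective (h : IsOrdering W.lines U F) (hx : x ∈ U) :
    Function.Injective (relationMap h x) := by
  obtain ⟨U', hU', σ, hx', h'⟩ := exists_isFrame h hx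
  refine (injective_iff_map_eq_zero _).2 fun t ht => ?_
  have h1 := congrFun ht 0
  rw [h'.relationMap_apply h hU' hx'] at h1
  have h2 : coord (σ x) t = 0 :=
    (smul_eq_zero.1 h1).resolve_right ((h'.isAdaptedAt hx').basicFamily_ne_zero 0)
  rw [← coord_smul_dualPower (h'.ne_zero x hx') t, h2, zero_smul]

/-- Sections with zero covariant derivative are the same as abelian relations. -/
lemma isFlat_iff_isAbelianRelation (h : IsOrdering W.lines U F) (hU' : U' ⊆ U) (ho : IsOpen U') :
    W.webConnection.IsFlat U' s ↔ IsAbelianRelation F U' (fun l x => relationMap h x (s x) l) := by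
  have key : ∀ x ∈ U', ∃ U₁ ⊆ U', IsOpen U₁ ∧ x ∈ U₁ ∧ (W.webConnection.IsFlat U₁ s ↔
      IsAbelianRelation F U₁ (fun l x => relationMap h x (s x) l)) := by
    intro x hx
    obtain ⟨U₁, hU₁, σ, hx₁, h₁⟩ := exists_isFrame (h.mono hU' ho) hx
    refine ⟨U₁, hU₁, h₁.ordering.isOpen, hx₁, ?_⟩
    have e : ∀ l, ∀ y ∈ U₁, relationMap h y (s y) l =
        sectionCoord σ s y • basicFamily (fields F σ) l y := fun l y hy =>
      h₁.relationMap_apply h (hU₁.trans hU') hy (s y) l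
    have e1 : IsAbelianRelation F U₁ (fun l x => relationMap h x (s x) l) ↔
        IsAbelianRelation F U₁ (fun l x => sectionCoord σ s x • basicFamily (fields F σ) l x) :=
      ⟨fun h2 => h2.congr h₁.ordering.isOpen fun l y hy => (e l y hy).symm,
        fun h2 => h2.congr h₁.ordering.isOpen e⟩
    rw [e1, h₁.isAbelianRelation_iff]
    refine forall₂_congr fun y hy => ?_
    rw [h₁.sectionAnalyticAt_iff hy]
    refine and_congr_right fun hf => ?_
    change W.webNabla s y = 0 ↔ _
    rw [h₁.webNabla_eq hy ((h₁.sectionAnalyticAt_iff hy).2 hf)]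
    constructor
    · intro h0
      ext w
      have h1 := DFunLike.congr_fun h0 w
      rw [frameNabla_apply] at h1
      exact (smul_eq_zero.1 h1).resolve_right (dualPower_ne_zero (h₁.ne_zero y hy))
    · intro h0
      ext w
      have h1 := DFunLike.congr_fun h0 w
      rw [frameNabla_apply]
      exact (congrArg (fun c : 𝕜 => c • dualPower σ y) h1).trans (zero_smul 𝕜 _)
  constructor
  · intro hf
    refine isAbelianRelation_of_local fun x hx => ?_
    obtain ⟨U₁, hU₁, ho₁, hx₁, h₁⟩ := key x hx
    exact ⟨U₁, ho₁, hx₁, h₁.1 fun y hy => hf y (hU₁ hy)⟩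
  · intro ha x hx
    obtain ⟨U₁, hU₁, ho₁, hx₁, h₁⟩ := key x hx
    exact h₁.2 (ha.mono hU₁) x hx₁

lemma exists_section_of_isAbelianRelation (h : IsOrdering W.lines U F) (hU' : U' ⊆ U)
    (ho : IsOpen U') (hη : IsAbelianRelation F U' η) :
    ∃ s, W.webConnection.IsFlat U' s ∧ ∀ l, ∀ x ∈ U', η l x = relationMap h x (s x) l := by
  have h1 : ∀ x, ∃ t : W.L x, x ∈ U' → ∀ l, η l x = relationMap h x t l := by
    intro x
    by_cases hx : x ∈ U'
    · obtain ⟨U₁, hU₁, σ, hx₁, h₁⟩ := exists_isFrame (h.mono hU' ho) hx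
      obtain ⟨f, hf, _⟩ := h₁.exists_eq_smul (hη.mono hU₁)
      refine ⟨f x • dualPower σ x, fun _ l => ?_⟩
      rw [map_smul, Pi.smul_apply, relationMap_dualPower h h₁ (hU₁.trans hU') hx₁, hf l x hx₁]
    · exact ⟨0, fun hx' => absurd hx' hx⟩
  choose s hs using h1
  exact ⟨s, (isFlat_iff_isAbelianRelation h hU' ho).2
    (hη.congr ho fun l x hx => (hs x hx l).symm), fun l x hx => hs x hx l⟩

lemma IsFrame.isAbelianRelation_of_isLogSolution (h : W.IsFrame U F σ) {f : M → 𝕜}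
    (hf : IsLogSolution (omega (fields F σ)) U f) :
    IsAbelianRelation F U (fun l x => f x • basicFamily (fields F σ) l x) ∧
      ∀ l, ∀ x ∈ U, f x • basicFamily (fields F σ) l x ≠ 0 := by
  refine ⟨h.isAbelianRelation_iff.2 fun x hx => ⟨(hf x hx).1, ?_⟩, fun l x hx => ?_⟩
  · obtain ⟨_, h0, h1⟩ := hf x hx
    have h2 : mvfderiv 𝓘(𝕜, Model 𝕜 k) f x = f x • -omega (fields F σ) x := by
      rw [← h1, smul_inv_smul₀ h0]
    rw [h2, smul_neg, neg_add_cancel]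
  · exact smul_ne_zero (hf x hx).2.1 ((h.isAdaptedAt hx).basicFamily_ne_zero l)

lemma IsFrame.exists_isLogSolution (h : W.IsFrame U F σ) (hU : IsConnected U)
    (hη : IsAbelianRelation F U η) (hne : ∃ l, ∃ x ∈ U, η l x ≠ 0) :
    ∃ f, IsLogSolution (omega (fields F σ)) U f ∧
      (∀ l, ∀ x ∈ U, η l x = f x • basicFamily (fields F σ) l x) ∧
      ∀ g : M → 𝕜, (∀ l, ∀ x ∈ U, η l x = g x • basicFamily (fields F σ) l x) →
        ∀ x ∈ U, g x = f x := by
  obtain ⟨f, hf, ha⟩ := h.exists_eq_smul hη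
  have hf' := h.isAbelianRelation_iff.1 ha
  have ho := h.ordering.isOpen
  -- the zeros of `f` form an open set, and so do the other points
  have hsub : U ⊆ {x | x ∈ U ∧ f x ≠ 0} := by
    refine hU.isPreconnected.subset_left_of_subset_union (v := {x | ∀ᶠ y in 𝓝 x, f y = 0})
      (isOpen_iff_mem_nhds.2 fun x hx => ?_) isOpen_setOfPred_eventually_nhds ?_ (fun x hx => ?_) ?_
    · filter_upwards [h.mem_nhds hx.1, (hf' x hx.1).1.continuousAt.eventually_ne hx.2] with y a b
      exact ⟨a, b⟩
    · exact disjoint_left.2 fun x hx hx' => hx.2 (hx' : ∀ᶠ y in 𝓝 x, f y = 0).self_of_nhds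
    · by_cases h0 : f x = 0
      · refine Or.inr (eventually_eq_zero_of_mvfderiv_add_eq_zero
          (h.isAdaptedAt hx).omega_analyticAt ?_ h0)
        filter_upwards [h.mem_nhds hx] with y hy using hf' y hy
      · exact Or.inl ⟨hx, h0⟩
    · obtain ⟨l, x, hx, hlx⟩ := hne
      refine ⟨x, hx, hx, fun h0 => hlx ?_⟩
      rw [hf l x hx, h0]
      exact zero_smul 𝕜 (basicFamily (fields F σ) l x)
  refine ⟨f, fun x hx => ⟨(hf' x hx).1, (hsub hx).2, ?_⟩, hf, fun g hg x hx => ?_⟩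
  · rw [eq_neg_of_add_eq_zero_left (hf' x hx).2, smul_neg, inv_smul_smul₀ (hsub hx).2]
  · have h1 := (hg 0 x hx).symm.trans (hf 0 x hx)
    exact smul_left_injective 𝕜 ((h.isAdaptedAt hx).basicFamily_ne_zero 0) h1

/-! ### The rank -/

lemma eventually_eq_zero_of_solution (h : W.IsFrame U F σ) (hx : x ∈ U) {f : M → 𝕜}
    (hf : ∀ᶠ y in 𝓝 x, FunAnalyticAt 𝕜 (Model 𝕜 k) f y ∧
      mvfderiv 𝓘(𝕜, Model 𝕜 k) f y + f y • omega (fields F σ) y = 0) (h0 : f x = 0) :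
    ∀ᶠ y in 𝓝 x, f y = 0 :=
  eventually_eq_zero_of_mvfderiv_add_eq_zero (h.isAdaptedAt hx).omega_analyticAt hf h0

/-- Near a point, an abelian relation is `(f A_l)` for a solution `f` of `df + f ω = 0`. -/
lemma exists_solution_of_mem (h : W.IsFrame U F σ) (hx : x ∈ U)
    (hη : η ∈ abelianRelationsNear F k x) : ∃ f : M → 𝕜,
      (∀ᶠ y in 𝓝 x, FunAnalyticAt 𝕜 (Model 𝕜 k) f y ∧
        mvfderiv 𝓘(𝕜, Model 𝕜 k) f y + f y • omega (fields F σ) y = 0) ∧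
      ∀ᶠ y in 𝓝 x, ∀ l, η l y = f y • basicFamily (fields F σ) l y := by
  obtain ⟨U₁, ho₁, hx₁, hη₁⟩ := hη
  have h2 := h.mono (U' := U ∩ U₁) inter_subset_left (h.ordering.isOpen.inter ho₁)
  obtain ⟨f, hf, ha⟩ := h2.exists_eq_smul (hη₁.mono inter_subset_right)
  refine ⟨f, ?_, ?_⟩ <;> filter_upwards [h2.mem_nhds ⟨hx, hx₁⟩] with y hy
  · exact h2.isAbelianRelation_iff.1 ha y hy
  · exact fun l => hf l y hy

lemma rank_abelianGerms_eq_one (h : IsOrdering W.lines U F) (hx : x ∈ U)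
    (hΩ : ∀ᶠ y in 𝓝 x, W.webCurvature y = 0) : Module.rank 𝕜 (AbelianGerms F k x) = 1 := by
  obtain ⟨U', _, σ, hx', h'⟩ := exists_isFrame h hx
  obtain ⟨f, hf⟩ := h'.exists_solution hx' hΩ
  obtain ⟨U₁, hU₁, ho₁, hx₁⟩ := eventually_nhds_iff.1 (hf.and (h'.mem_nhds hx'))
  have h₁ := h'.mono (U' := U₁) (fun y hy => (hU₁ y hy).2) ho₁
  let θ : Fin (k + 3) → Form 𝕜 (Model 𝕜 k) M (k + 1) := fun l y =>
    f y • basicFamily (fields F σ) l y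
  have hθ : θ ∈ abelianRelationsNear F k x := ⟨U₁, ho₁, hx₁, h₁.isAbelianRelation_iff.2
    fun y hy => ⟨(hU₁ y hy).1.1, (hU₁ y hy).1.2.2⟩⟩
  have hfx : f x ≠ 0 := hf.self_of_nhds.2.1
  refine rank_eq_one (⟨_, Submodule.mem_map_of_mem hθ⟩ : AbelianGerms F k x) (fun h0 => ?_) ?_
  · have h1 := congrArg Subtype.val h0
    have h2 : ∀ᶠ y in 𝓝 x, ∀ l, θ l y = 0 := (Submodule.Quotient.mk_eq_zero _).1 h1
    exact smul_ne_zero hfx ((h'.isAdaptedAt hx').basicFamily_ne_zero 0) (h2.self_of_nhds 0)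
  · rintro ⟨_, η, hη, rfl⟩
    obtain ⟨g, hg, hηg⟩ := exists_solution_of_mem h' hx' hη
    refine ⟨g x * (f x)⁻¹, Subtype.ext ?_⟩
    change (g x * (f x)⁻¹) • Submodule.Quotient.mk θ = Submodule.Quotient.mk η
    rw [← Submodule.Quotient.mk_smul, Submodule.Quotient.eq]
    -- two solutions are proportional, by uniqueness for the linear equation
    have hc : FunAnalyticAt 𝕜 (Model 𝕜 k) (fun _ : M => g x * (f x)⁻¹) x := contMDiffAt_const
    have h1 := eventually_eq_zero_of_solution h' hx' (f := fun y => g x * (f x)⁻¹ * f y + -g y) ?_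
      (by rw [mul_assoc, inv_mul_cancel₀ hfx, mul_one, add_neg_cancel])
    · change ∀ᶠ y in 𝓝 x, ∀ l, (g x * (f x)⁻¹) • θ l y - η l y = 0
      filter_upwards [h1, hηg] with y hy hyη l
      rw [hyη l, smul_smul, add_neg_eq_zero.1 hy, sub_self]
    · filter_upwards [hf, hg, hc.eventually] with y hy hyg hyc
      have hn : FunAnalyticAt 𝕜 (Model 𝕜 k) (fun y => -g y) y := hyg.1.neg
      refine ⟨(hyc.mul hy.1).add hn, ?_⟩
      ext w
      have e1 := DFunLike.congr_fun hy.2.2 w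
      have e2 := DFunLike.congr_fun hyg.2 w
      have e3 : mvfderiv 𝓘(𝕜, Model 𝕜 k) (fun y => -g y) y w =
          -mvfderiv 𝓘(𝕜, Model 𝕜 k) g y w := DFunLike.congr_fun mvfderiv_neg w
      have e4 := mvfderiv_mul_apply hyc hy.1 w
      rw [mvfderiv_const] at e4
      have e5 := mvfderiv_add_apply (hyc.mul hy.1) hn w
      change mvfderiv 𝓘(𝕜, Model 𝕜 k) (fun y => g x * (f x)⁻¹ * f y + -g y) y w +
        (g x * (f x)⁻¹ * f y + -g y) * omega (fields F σ) y w = 0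
      refine (congrArg (fun c : 𝕜 => c + _) (e5.trans (congrArg₂ (· + ·) e4 e3))).trans ?_
      have e1' : mvfderiv 𝓘(𝕜, Model 𝕜 k) f y w + f y * omega (fields F σ) y w = 0 := e1
      have e2' : mvfderiv 𝓘(𝕜, Model 𝕜 k) g y w + g y * omega (fields F σ) y w = 0 := e2
      have aux : ∀ c a b o u v : 𝕜, u + a * o = 0 → v + b * o = 0 →
          c * u + a * 0 + -v + (c * a + -b) * o = 0 := by
        intro c a b o u v h1 h2
        linear_combination c * h1 - h2
      exact aux _ _ _ _ _ _ e1' e2'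

lemma rank_abelianGerms_eq_zero (h : IsOrdering W.lines U F) (hx : x ∈ U)
    (hΩ : ¬ ∀ᶠ y in 𝓝 x, W.webCurvature y = 0) : Module.rank 𝕜 (AbelianGerms F k x) = 0 := by
  obtain ⟨U', _, σ, hx', h'⟩ := exists_isFrame h hx
  suffices hbot : AbelianGerms F k x = ⊥ by rw [hbot, rank_bot]
  refine (Submodule.eq_bot_iff _).2 ?_
  rintro _ ⟨η, hη, rfl⟩
  obtain ⟨f, hf, hηf⟩ := exists_solution_of_mem h' hx' hη
  have h0 : f x = 0 := by
    by_contra hfx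
    refine hΩ ?_
    have hne : ∀ᶠ y in 𝓝 x, f y ≠ 0 := hf.self_of_nhds.1.continuousAt.eventually_ne hfx
    filter_upwards [hf.eventually_nhds, hne, h'.mem_nhds hx'] with y hy hy0 hyU
    exact h'.webCurvature_eq_zero hyU hy hy0
  refine (Submodule.Quotient.mk_eq_zero _).2 ?_
  change ∀ᶠ y in 𝓝 x, ∀ l, η l y = 0
  filter_upwards [eventually_eq_zero_of_solution h' hx' hf h0, hηf] with y hy hyη l
  rw [hyη l, hy]
  exact zero_smul 𝕜 (basicFamily (fields F σ) l y)

/-- On a connected manifold, the curvature vanishes identically if it vanishes near a point. -/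
lemma webCurvature_eq_zero_of_eventually [PreconnectedSpace M]
    (hΩ : ∀ᶠ y in 𝓝 x, W.webCurvature y = 0) : W.webCurvature = 0 := by
  have hcl : IsClopen {x | ∀ᶠ y in 𝓝 x, W.webCurvature y = 0} := by
    refine ⟨isClosed_of_closure_subset fun y hy => ?_, isOpen_setOfPred_eventually_nhds⟩
    exact (webCurvature_analyticAt W y).eventually_eq_zero (mem_closure_iff_frequently.1 hy)
  have huniv := hcl.eq_univ ⟨x, hΩ⟩
  funext y
  have hy : y ∈ {x | ∀ᶠ y in 𝓝 x, W.webCurvature y = 0} := huniv ▸ mem_univ y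
  exact (hy : ∀ᶠ z in 𝓝 y, W.webCurvature z = 0).self_of_nhds

lemma rank_eq_one [Nonempty M] (hΩ : W.webCurvature = 0) : W.rank = 1 := by
  have h1 : ∀ (x : M) (F : Fin (k + 3) → Distribution 𝕜 (Model 𝕜 k) M),
      (∃ U, x ∈ U ∧ IsOrdering W.lines U F) →
      Cardinal.toENat (Module.rank 𝕜 (AbelianGerms F k x)) = 1 := by
    rintro x F ⟨U, hx, h⟩
    rw [rank_abelianGerms_eq_one h hx (Eventually.of_forall fun y => congrFun hΩ y), map_one]
  refine le_antisymm (iSup_le fun x => iSup_le fun F => iSup_le fun hF => (h1 x F hF).le) ?_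
  obtain ⟨x⟩ := ‹Nonempty M›
  obtain ⟨U, F, hx, h⟩ := W.locally_foliated x
  rw [← h1 x F ⟨U, hx, h⟩]
  exact le_iSup_of_le x (le_iSup_of_le F (le_iSup_of_le ⟨U, hx, h⟩ le_rfl))

lemma rank_eq_zero [PreconnectedSpace M] (hΩ : W.webCurvature ≠ 0) : W.rank = 0 := by
  refine le_antisymm (iSup_le fun x => iSup_le fun F => iSup_le fun ⟨U, hx, h⟩ => ?_) bot_le
  rw [rank_abelianGerms_eq_zero h hx fun h0 => hΩ (webCurvature_eq_zero_of_eventually h0), map_zero]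

end CurveWeb

end AbelianRank

/-! ### The Blaschke curvature of a web of three curves -/

section Blaschke

variable {𝕜 : Type*} [RCLike 𝕜] {k : ℕ}
  {M : Type*} [TopologicalSpace M]

namespace CurveWeb

section

variable [ChartedSpace (Model 𝕜 k) M] [IsManifold 𝓘(𝕜, Model 𝕜 k) ω M] {W : CurveWeb 𝕜 k M}
  {U : Set M} {F : Fin (k + 3) → Distribution 𝕜 (Model 𝕜 k) M} {σ : (x : M) → W.E x} {x : M}

/-- A frame remains one after multiplication by a nowhere zero function. -/
lemma IsFrame.smul (h : W.IsFrame U F σ) {a : M → 𝕜}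
    (ha : ∀ x ∈ U, FunAnalyticAt 𝕜 (Model 𝕜 k) a x) (h0 : ∀ x ∈ U, a x ≠ 0) :
    W.IsFrame U F (fun x => a x • σ x) where
  ordering := h.ordering
  analytic l y hy := by
    have h1 : VField.AnalyticAt (fun y => a y • fields F σ l y) y :=
      ((h.analytic l).analyticAt h.ordering.isOpen hy).smul (ha y hy)
    exact (ContMDiffAt.contMDiffWithinAt (h1 : ContMDiffAt _ _ _ _ _)).congr
      (fun z _ => congrArg (Bundle.TotalSpace.mk' _ z) (component_smul (a z) (σ z) (F l z)))
      (congrArg (Bundle.TotalSpace.mk' _ y) (component_smul (a y) (σ y) (F l y)))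
  ne_zero y hy := smul_ne_zero (h0 y hy) (h.ne_zero y hy)

end

variable [ChartedSpace (Model 𝕜 0) M] [IsManifold 𝓘(𝕜, Model 𝕜 0) ω M] {W : CurveWeb 𝕜 0 M}
  {U U' : Set M} {F : Fin 3 → Distribution 𝕜 (Model 𝕜 0) M} {σ : (x : M) → W.E x} {x : M}
  {η : Fin 3 → CovectorField 𝕜 (Model 𝕜 0) M}

/-- `(γ ∧ A_l) (V₁, V₂) = γ (V_l)`. -/
lemma IsFrame.wedge_basicFamily (h : W.IsFrame U F σ) (hx : x ∈ U) {l : Fin 3}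
    {β : TangentSpace 𝓘(𝕜, Model 𝕜 0) x →L[𝕜] 𝕜}
    (hβ : ∀ w, β w = basicFamily (fields F σ) l x fun _ => w)
    (γ : TangentSpace 𝓘(𝕜, Model 𝕜 0) x →L[𝕜] 𝕜) :
    wedge ![γ, β] (fun i : Fin 2 => fields F σ i.castSucc x) = γ (fields F σ l x) := by
  have hA := h.isAdaptedAt hx
  let c : Fin 2 → Fin 3 → 𝕜 := fun i j =>
    dualCoframe (fun i : Fin 2 => fields F σ i.castSucc) i x (fields F σ j x)
  have hc : ∀ i j : Fin 2, c i j.castSucc = if i = j then 1 else 0 := fun i j =>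
    dualCoframe_apply_self hA.linearIndependent hA.card_eq i j
  have h1 : wedge ![γ, β] (fun i : Fin 2 => fields F σ i.castSucc x) =
      γ (fields F σ 0 x) * β (fields F σ 1 x) - β (fields F σ 0 x) * γ (fields F σ 1 x) :=
    Matrix.det_fin_two _
  have h2 : ∀ j, β (fields F σ j x) = c 0 l * c 1 j - c 1 l * c 0 j := by
    intro j
    rw [hβ, hA.basicFamily_eq l]
    exact Matrix.det_fin_two _
  have h3 : fields F σ l x = c 0 l • fields F σ 0 x + c 1 l • fields F σ 1 x := by
    have := sum_dualCoframe_smul hA.linearIndependent hA.card_eq (fields F σ l x)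
    rw [Fin.sum_univ_two] at this
    exact this.symm
  have e00 : c 0 0 = 1 := hc 0 0
  have e10 : c 1 0 = 0 := hc 1 0
  have e01 : c 0 1 = 0 := hc 0 1
  have e11 : c 1 1 = 1 := hc 1 1
  rw [h1, h2, h2, e00, e10, e01, e11]
  refine Eq.trans ?_ ((congrArg γ h3).trans ((map_add γ _ _).trans
    (congrArg₂ (· + ·) (map_smul γ _ _) (map_smul γ _ _)))).symm
  simp only [smul_eq_mul]
  ring

/-- If `η_l = A_l` near `x`, then `ω` is the only covector `γ` at `x` with `dη_l = γ ∧ η_l`. -/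
lemma IsFrame.d_eq_wedge_iff (h : W.IsFrame U F σ)
    (hη : ∀ x ∈ U, ∀ l, (η l).toForm x = basicFamily (fields F σ) l x) (hx : x ∈ U)
    (γ : TangentSpace 𝓘(𝕜, Model 𝕜 0) x →L[𝕜] 𝕜) :
    (∀ l, (η l).toForm.d x = wedge ![γ, η l x]) ↔ γ = omega (fields F σ) x := by
  have hA := h.isAdaptedAt hx
  have h1 : ∀ l, (η l).toForm.d x (fun i : Fin 2 => fields F σ i.castSucc x) =
      omega (fields F σ) x (fields F σ l x) := by
    intro l
    have hf : FunAnalyticAt 𝕜 (Model 𝕜 0) (fun _ : M => (1 : 𝕜)) x := contMDiffAt_const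
    have h2 := hA.d_smul_basicFamily hf l
    have h3 : (η l).toForm.d x = Form.d (fun y => (1 : 𝕜) • basicFamily (fields F σ) l y) x :=
      Form.d_congr (by
        filter_upwards [h.mem_nhds hx] with y hy
        rw [hη y hy l]
        exact (one_smul 𝕜 (basicFamily (fields F σ) l y)).symm)
    rw [mvfderiv_const, one_mul] at h2
    rw [h3]
    exact h2.trans (zero_add _)
  have h2 : ∀ (γ : TangentSpace 𝓘(𝕜, Model 𝕜 0) x →L[𝕜] 𝕜) l,
      wedge ![γ, η l x] (fun i : Fin 2 => fields F σ i.castSucc x) = γ (fields F σ l x) :=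
    fun γ l => h.wedge_basicFamily hx
      (fun w => DFunLike.congr_fun (hη x hx l) (fun _ : Fin 1 => w)) γ
  constructor
  · intro hγ
    refine hA.covector_ext fun l => ?_
    rw [← h1, ← h2, hγ l]
  · rintro rfl l
    refine sub_eq_zero.1 (hA.isFrameAt.eq_zero_of_apply ?_)
    exact sub_eq_zero.2 ((h1 l).trans (h2 _ l).symm)

/-- A normalized coframe is locally the family `A₁, A₂, A₃` of a frame. -/
lemma IsNormalizedCoframe.exists_isFrame (h : W.IsNormalizedCoframe U F η) (hx : x ∈ U) :
    ∃ U' ⊆ U, ∃ σ, x ∈ U' ∧ W.IsFrame U' F σ ∧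
      ∀ y ∈ U', ∀ l, (η l).toForm y = basicFamily (fields F σ) l y := by
  obtain ⟨U', hU', σ, hx', h'⟩ := WebGeometry.CurveWeb.exists_isFrame h.ordering hx
  have hg : ∀ y ∈ U', ∃ g : 𝕜, ∀ l, (η l).toForm y = g • basicFamily (fields F σ) l y := by
    intro y hy
    refine (h'.isAdaptedAt hy).exists_eq_smul (fun l => ?_) ?_
    · ext w
      exact h.annihilates l y (hU' hy) _ (component_mem _ _)
    · ext w
      have := DFunLike.congr_fun (h.sum_eq_zero y (hU' hy)) (w 0)
      rw [ContinuousAlternatingMap.sum_apply]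
      rw [sum_apply] at this
      exact this
  -- the coefficient is `η₁ (V₂)`
  let g : M → 𝕜 := fun y => η 0 y (fields F σ 1 y)
  have hga : ∀ y ∈ U', FunAnalyticAt 𝕜 (Model 𝕜 0) g y := fun y hy =>
    (h.analytic 0 y (hU' hy)).apply (X := fun _ => fields F σ 1)
      fun _ => (h'.isAdaptedAt hy).analytic 1
  have hgη : ∀ y ∈ U', ∀ l, (η l).toForm y = g y • basicFamily (fields F σ) l y := by
    intro y hy
    obtain ⟨c, hc⟩ := hg y hy
    have hA := h'.isAdaptedAt hy
    have h1 : g y = c * basicFamily (fields F σ) 0 y (fun _ => fields F σ 1 y) :=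
      DFunLike.congr_fun (hc 0) (fun _ => fields F σ 1 y)
    have h2 : basicFamily (fields F σ) 0 y (fun _ => fields F σ 1 y) = 1 := by
      rw [hA.basicFamily_eq 0, interiorAt_apply]
      refine Eq.trans ?_ (volumeForm_self hA.linearIndependent hA.card_eq)
      refine congrArg (volumeForm (fun i : Fin 2 => fields F σ i.castSucc) y) (funext fun i => ?_)
      fin_cases i <;> rfl
    rw [h1, h2, mul_one]
    exact hc
  have hg0 : ∀ y ∈ U', g y ≠ 0 := by
    intro y hy h0
    refine h.ne_zero 0 y (hU' hy) (ContinuousLinearMap.ext fun w => ?_)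
    have := DFunLike.congr_fun (hgη y hy 0) (fun _ => w)
    rw [h0] at this
    exact this.trans (zero_mul _)
  have h'' := h'.smul (fun y hy => (hga y hy).inv₀ (hg0 y hy)) fun y hy => inv_ne_zero (hg0 y hy)
  refine ⟨U', hU', _, hx', h'', fun y hy l => ?_⟩
  rw [hgη y hy l]
  have h1 := (h'.isAdaptedAt hy).basicFamily_perm (h''.isAdaptedAt hy) 1 (inv_ne_zero (hg0 y hy))
    (fun l => component_smul (g y)⁻¹ (σ y) (F l y)) l
  rw [permDet_one, one_mul, pow_one] at h1
  refine (congrArg (fun A => g y • A) h1).trans ?_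
  exact smul_inv_smul₀ (hg0 y hy) _

/-- Near every point there are normalized coframes: the forms `A₁, A₂, A₃` of a frame. -/
lemma exists_isNormalizedCoframe (W : CurveWeb 𝕜 0 M) (x : M) :
    ∃ U F η, x ∈ U ∧ W.IsNormalizedCoframe U F η := by
  obtain ⟨U, F, σ, hx, h⟩ := exists_isFrame_of_mem W x
  let e : ∀ y : M, ((TangentSpace 𝓘(𝕜, Model 𝕜 0) y) [⋀^Fin 1]→L[𝕜] 𝕜) ≃
      (TangentSpace 𝓘(𝕜, Model 𝕜 0) y →L[𝕜] 𝕜) := fun y =>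
    (ContinuousAlternatingMap.ofSubsingleton 𝕜 (TangentSpace 𝓘(𝕜, Model 𝕜 0) y) 𝕜 (0 : Fin 1)).symm
  let η : Fin 3 → CovectorField 𝕜 (Model 𝕜 0) M := fun l y => e y (basicFamily (fields F σ) l y)
  have hη : ∀ l, (η l).toForm = basicFamily (fields F σ) l := fun l =>
    funext fun y => (e y).symm_apply_apply _
  have hs : ∀ l y w, η l y w = basicFamily (fields F σ) l y fun _ => w := fun l y w => rfl
  refine ⟨U, F, η, hx, h.ordering, fun l y hy => ?_, fun l y hy h0 => ?_, fun l y hy w hw => ?_,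
    fun y hy => ?_⟩
  · have hf : FunAnalyticAt 𝕜 (Model 𝕜 0) (fun _ : M => (1 : 𝕜)) y := contMDiffAt_const
    rw [hη l]
    exact ((h.isAdaptedAt hy).basicFamily_analyticAt hf l).congr
      (Eventually.of_forall fun z => one_smul 𝕜 (basicFamily (fields F σ) l z))
  · refine (h.isAdaptedAt hy).basicFamily_ne_zero l ?_
    rw [← hη l]
    ext w
    exact DFunLike.congr_fun h0 (w 0)
  · rw [h.span_fields l y hy] at hw
    obtain ⟨c, rfl⟩ := Submodule.mem_span_singleton.1 hw
    rw [map_smul, hs, (h.isAdaptedAt hy).basicFamily_eq l]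
    have := DFunLike.congr_fun (interiorAt_self (fields F σ l y)
      (volumeForm (fun i : Fin 2 => fields F σ i.castSucc) y)) (Fin.elim0 : Fin 0 → _)
    refine (congrArg (fun t : 𝕜 => c * t) (Eq.trans ?_ this)).trans (mul_zero c)
    refine congrArg (volumeForm (fun i : Fin 2 => fields F σ i.castSucc) y) (funext fun i => ?_)
    fin_cases i <;> rfl
  · refine ContinuousLinearMap.ext fun w => ?_
    have hA := h.isAdaptedAt hy
    have h1 : ∑ l, basicFamily (fields F σ) l y = 0 := by
      rw [Finset.sum_congr rfl fun l _ => hA.basicFamily_eq l, ← interiorAt_sum,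
        hA.sum_eq_zero.self_of_nhds]
      ext w
      exact DFunLike.congr_fun (map_zero (volumeForm (fun i : Fin 2 => fields F σ i.castSucc)
        y).toAlternatingMap.curryLeft) w
    have h2 := DFunLike.congr_fun h1 fun _ => w
    rw [ContinuousAlternatingMap.sum_apply] at h2
    rw [sum_apply]
    exact h2

/-- The curvature of the connection is the Blaschke curvature. -/
theorem isBlaschkeCurvature_webCurvature (W : CurveWeb 𝕜 0 M) :
    W.IsBlaschkeCurvature W.webCurvature := by
  refine ⟨exists_isNormalizedCoframe W, fun U F η h => ?_⟩
  choose! V hVU σ hxV hσ hη using fun x (hx : x ∈ U) => h.exists_isFrame hx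
  let γ : CovectorField 𝕜 (Model 𝕜 0) M := fun x => omega (fields F (σ x)) x
  have hγ : ∀ x ∈ U, ∀ y ∈ V x, γ y = omega (fields F (σ x)) y := by
    intro x hx y hy
    have hyU := hVU x hx hy
    exact ((hσ x hx).d_eq_wedge_iff (hη x hx) hy _).1
      (((hσ y hyU).d_eq_wedge_iff (hη y hyU) (hxV y hyU) _).2 rfl)
  have hev : ∀ x ∈ U, ∀ᶠ y in 𝓝 x, γ.toForm y = (omega (fields F (σ x))).toForm y := by
    intro x hx
    filter_upwards [(hσ x hx).mem_nhds (hxV x hx)] with y hy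
    exact congrArg (ContinuousAlternatingMap.ofSubsingleton 𝕜 _ 𝕜 (0 : Fin 1)) (hγ x hx y hy)
  refine ⟨γ, ⟨fun x hx => ?_, fun x hx => ?_⟩, fun x hx => ?_, fun γ' hγ' x hx => ?_⟩
  · exact ((hσ x hx).isAdaptedAt (hxV x hx)).omega_analyticAt.congr
      ((hev x hx).mono fun y hy => hy.symm)
  · exact ((hσ x hx).d_eq_wedge_iff (hη x hx) (hxV x hx) _).2 rfl
  · rw [(hσ x hx).webCurvature_eq (hxV x hx)]
    exact (Form.d_congr (hev x hx)).symm
  · exact ((hσ x hx).d_eq_wedge_iff (hη x hx) (hxV x hx) _).1 (hγ'.2 x hx)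

end CurveWeb

end Blaschke

end WebGeometry

end

open WebGeometry WebGeometry.CurveWeb in
theorem mainTheorem1 {𝕜 : Type*} [RCLike 𝕜] {k : ℕ}
    {M : Type*} [TopologicalSpace M] [ChartedSpace (Model 𝕜 k) M]
    [IsManifold 𝓘(𝕜, Model 𝕜 k) ω M] (W : CurveWeb 𝕜 k M) :
    -- `E` is a line bundle, with nowhere zero analytic sections near every point
    (∀ x, Module.finrank 𝕜 (W.E x) = 1) ∧
    (∀ x, ∃ U F σ, x ∈ U ∧ W.IsFrame U F σ) ∧
    -- nonzero local abelian relations are the same as functions `f` with `d(log f) = -ω`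
    (∀ U F σ, W.IsFrame U F σ →
      (∀ f, IsLogSolution (omega (fields F σ)) U f →
        IsAbelianRelation F U (fun l x => f x • basicFamily (fields F σ) l x) ∧
        ∀ l, ∀ x ∈ U, f x • basicFamily (fields F σ) l x ≠ 0) ∧
      (IsConnected U → ∀ η : Fin (k + 3) → Form 𝕜 (Model 𝕜 k) M (k + 1), IsAbelianRelation F U η →
        (∃ l, ∃ x ∈ U, η l x ≠ 0) →
        ∃ f, IsLogSolution (omega (fields F σ)) U f ∧
          (∀ l, ∀ x ∈ U, η l x = f x • basicFamily (fields F σ) l x) ∧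
          ∀ g : M → 𝕜, (∀ l, ∀ x ∈ U, η l x = g x • basicFamily (fields F σ) l x) →
            ∀ x ∈ U, g x = f x)) ∧
    -- `ω` does not depend on the order of the vector fields
    (∀ U F σ, W.IsFrame U F σ → ∀ τ : Equiv.Perm (Fin (k + 3)), ∀ x ∈ U,
      omega (fields (fun l => F (τ l)) σ) x = omega (fields F σ) x) ∧
    -- the connections defined by two frames agree: `∇ (f σ̂^{⊗(n-1)}) = (df + f ω) σ̂^{⊗(n-1)}`
    (∀ U F σ U' F' σ', W.IsFrame U F σ → W.IsFrame U' F' σ' → ∀ x ∈ U ∩ U', ∀ f f' : M → 𝕜,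
      FunAnalyticAt 𝕜 (Model 𝕜 k) f x → FunAnalyticAt 𝕜 (Model 𝕜 k) f' x →
      (∀ᶠ y in 𝓝 x, f y • dualPower σ y = f' y • dualPower σ' y) →
      ∀ w : TangentSpace 𝓘(𝕜, Model 𝕜 k) x,
        (mvfderiv 𝓘(𝕜, Model 𝕜 k) f x w + f x * omega (fields F σ) x w) • dualPower σ x =
          (mvfderiv 𝓘(𝕜, Model 𝕜 k) f' x w + f' x * omega (fields F' σ') x w) • dualPower σ' x) ∧
    -- they glue to a unique global connection `D`, with curvature `Ω`, given locally by `dω`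
    ∃ (D : W.Connection) (Ω : Form 𝕜 (Model 𝕜 k) M 2),
      (∀ U F σ, W.IsFrame U F σ → ∀ x ∈ U, ∀ w : TangentSpace 𝓘(𝕜, Model 𝕜 k) x,
        D.nabla (dualPower σ) x w = omega (fields F σ) x w • dualPower σ x) ∧
      (∀ D' : W.Connection,
        (∀ U F σ, W.IsFrame U F σ → ∀ x ∈ U, ∀ w : TangentSpace 𝓘(𝕜, Model 𝕜 k) x,
          D'.nabla (dualPower σ) x w = omega (fields F σ) x w • dualPower σ x) →
        ∀ s x, SectionAnalyticAt s x → D'.nabla s x = D.nabla s x) ∧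
      Ω.AnalyticOn univ ∧
      (∀ U F σ, W.IsFrame U F σ → ∀ x ∈ U, Ω x = (omega (fields F σ)).toForm.d x) ∧
      D.IsCurvature Ω ∧
      -- abelian relations are the same as sections with zero covariant derivative
      (∀ U F, IsOrdering W.lines U F →
        ∃ Ψ : ∀ x, W.L x →ₗ[𝕜]
            (Fin (k + 3) → (TangentSpace 𝓘(𝕜, Model 𝕜 k) x) [⋀^Fin (k + 1)]→L[𝕜] 𝕜),
          (∀ U' ⊆ U, ∀ σ, W.IsFrame U' F σ → ∀ x ∈ U', ∀ l,
            Ψ x (dualPower σ x) l = basicFamily (fields F σ) l x) ∧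
          (∀ x ∈ U, Function.Injective (Ψ x)) ∧
          ∀ U' ⊆ U, IsOpen U' →
            (∀ s : (x : M) → W.L x,
              D.IsFlat U' s ↔ IsAbelianRelation F U' (fun l x => Ψ x (s x) l)) ∧
            ∀ η : Fin (k + 3) → Form 𝕜 (Model 𝕜 k) M (k + 1), IsAbelianRelation F U' η →
              ∃ s, D.IsFlat U' s ∧ ∀ l, ∀ x ∈ U', η l x = Ψ x (s x) l) ∧
      -- the rank is one or zero according as `Ω` vanishes or not, for germs and for connected `M`
      (∀ U F, IsOrdering W.lines U F → ∀ x ∈ U,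
        ((∀ᶠ y in 𝓝 x, Ω y = 0) → Module.rank 𝕜 (AbelianGerms F k x) = 1) ∧
        ((¬ ∀ᶠ y in 𝓝 x, Ω y = 0) → Module.rank 𝕜 (AbelianGerms F k x) = 0)) ∧
      (ConnectedSpace M → (Ω = 0 → W.rank = 1) ∧ (Ω ≠ 0 → W.rank = 0)) ∧
      -- for `n = 2`, `Ω` is the Blaschke curvature
      (k = 0 → W.IsBlaschkeCurvature Ω) := by
  refine ⟨finrank_E W, exists_isFrame_of_mem W, fun U F σ h =>
    ⟨fun f hf => h.isAbelianRelation_of_isLogSolution hf, fun hU η hη hne =>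
      h.exists_isLogSolution hU hη hne⟩, fun U F σ h τ x hx => h.omega_reorder τ hx,
    fun U F σ U' F' σ' h h' x hx f f' hf _ hff' w => h.nabla_eq h' hx.1 hx.2 hf hff' w,
    W.webConnection, W.webCurvature, fun U F σ h x hx w => h.webNabla_dualPower hx w,
    fun D' hD' s x hs => D'.nabla_eq_webNabla hD' hs, fun x _ => webCurvature_analyticAt W x,
    fun U F σ h x hx => h.webCurvature_eq hx, webConnection_isCurvature W,
    fun U F h => ⟨relationMap h, fun U' hU' σ h' x hx l => relationMap_dualPower h h' hU' hx l,
      fun x hx => relationMap_injective h hx, fun U' hU' ho =>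
        ⟨fun s => isFlat_iff_isAbelianRelation h hU' ho, fun η hη =>
          exists_section_of_isAbelianRelation h hU' ho hη⟩⟩,
    fun U F h x hx => ⟨rank_abelianGerms_eq_one h hx, rank_abelianGerms_eq_zero h hx⟩,
    fun _ => ⟨CurveWeb.rank_eq_one, CurveWeb.rank_eq_zero⟩, ?_⟩
  rintro rfl
  exact isBlaschkeCurvature_webCurvature W
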